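/- Let $\mathcal H$ be the twisted Heisenberg–Virasoro Lie algebra: the complex Lie algebra with basis $\{L(n),I(n): n\in\mathbb Z\}\cup\{C_L,C_{L,I},C_I\}$, where $C_L,C_{L,I},C_I$ are central and $$[L(n),L(m)]=(n-m)L(n+m)+\delta_{n,-m}\tfrac{n^3-n}{12}C_L,\quad [L(n),I(m)]=-mI(n+m)-\delta_{n,-m}(n^2+n)C_{L,I},\quad [I(n),I(m)]=n\,\delta_{n,-m}C_I .$$ Let $\mathcal H^{\ge 0}$ be the span of $L(n),I(n)$ $(n\ge 0)$ and $C_L,C_{L,I},C_I$. Fix $c_L,c_{L,I}\in\mathbb C$ with $c_{L,I}\neq 0$. Let $V^{\mathcal H}(h,h_I)$ be the Verma module on whose highest weight vector $C_L,C_I,C_{L,I},L(0),I(0)$ act by $c_L,0,c_{L,I},h,h_I$, and let $L^{\mathcal H}(h,h_I)$ be its irreducible quotient. Write $\mathbf 1$ for the highest weight vector of $L^{\mathcal H}(0,0)$. The space $L^{\mathcal H}(0,0)$ carries exactly one vertex operator algebra structure with vacuum $\mathbf 1$, conformal vector $\omega=L(-2)\mathbf 1$, central charge $c_L$, and fields $Y(\omega,z)=\sum_n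 L(n)z^{-n-2}$ and $Y(I(-1)\mathbf 1,z)=\sum_n I(n)z^{-n-1}$; it is denoted $L^{\mathcal H}(c_L,c_{L,I})$. Let $E=\operatorname{span}_{\mathbb C}\{v^0,v^1\}$ be the two-dimensional $\mathcal H^{\ge0}$-module on which $L(n),I(n)$ $(n>0)$ act by zero, $L(0)v^i=v^i$, $I(0)v^1=v^0$, $I(0)v^0=0$, $C_Lv^i=c_Lv^i$, $C_{L,I}v^i=c_{L,I}v^i$, $C_Iv^i=0$ for $i=0,1$. Put $\widetilde E=U(\mathcal H)\otimes_{U(\mathcal H^{\ge0})}E$ and $$\mathcal U=\widetilde E\,/\,U(\mathcal H)\bigl(L(-1)+I(-1)/c_{L,I}\bigr)v^0 .$$ Then $\mathcal U$, with its $\mathcal H$-action, is a $\mathbb Z_{\ge0}$-graded module for the vertex operator algebra $L^{\mathcal H}(c_L,c_{L,I})$: $$\mathcal U=\bigoplus_{m\in\mathbb Z_{\ge0}}\mathcal U(m),\qquad L(0)|_{\mathcal U(m)}=(m+1)\,\mathrm{Id},$$ and the lowest component $\mathcal U(0)$ is isomorphic to $E$ as an $\mathcal H^{\ge0}$-module,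 by the canonical map $e\mapsto 1\otimes e$. Moreover $L^{\mathcal H}(1,0)$ and $V^{\mathcal H}(1,0)$, with their $\mathcal H$-actions, are $L^{\mathcal H}(c_L,c_{L,I})$-modules, and there is a short exact sequence of $L^{\mathcal H}(c_L,c_{L,I})$-modules (and of $\mathcal H$-modules) $$0\to L^{\mathcal H}(1,0)\to\mathcal U\to V^{\mathcal H}(1,0)\to0$$ which does not split. -/

import Mathlib

open scoped TensorProduct

attribute [local instance] LieRing.ofAssociativeRing

/-! ### The twisted Heisenberg-Virasoro Lie algebra -/

/-- Labels of the standard basis `{L(n), I(n) | n ∈ ℤ} ∪ {C_L, C_LI, C_I}`. -/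
inductive HVIndex : Type
  | L (n : ℤ)
  | I (n : ℤ)
  | CL
  | CLI
  | CI

/-- The twisted Heisenberg-Virasoro Lie algebra: the complex vector space with basis `HVIndex`. -/
def HV : Type := HVIndex →₀ ℂ

namespace HV

noncomputable instance : AddCommGroup HV := inferInstanceAs (AddCommGroup (HVIndex →₀ ℂ))
noncomputable instance : Module ℂ HV := inferInstanceAs (Module ℂ (HVIndex →₀ ℂ))

/-- The basis vector with a given label. -/
noncomputable def of (i : HVIndex) : HV := Finsupp.single i (1 : ℂ)

/-- The bracket of two basis vectors. -/
noncomputable def basisBracket : HVIndex → HVIndex → HV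
  | .L n, .L m =>
      ((n : ℂ) - m) • of (.L (n + m)) + (if n = -m then ((n : ℂ) ^ 3 - n) / 12 else 0) • of .CL
  | .L n, .I m =>
      (-(m : ℂ)) • of (.I (n + m)) - (if n = -m then (n : ℂ) ^ 2 + n else 0) • of .CLI
  | .I n, .L m =>
      (n : ℂ) • of (.I (m + n)) + (if m = -n then (m : ℂ) ^ 2 + m else 0) • of .CLI
  | .I n, .I m => (if n = -m then (n : ℂ) else 0) • of .CI
  | _, _ => 0

/-- The linear map out of `HV` with prescribed values on the basis. -/
noncomputable def lift {M : Type} [AddCommGroup M] [Module ℂ M] (f : HVIndex → M) : HV →ₗ[ℂ] M :=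
  Finsupp.linearCombination ℂ f

theorem lift_of {M : Type} [AddCommGroup M] [Module ℂ M] (f : HVIndex → M) (i : HVIndex) :
    lift f (of i) = f i := by
  exact (Finsupp.linearCombination_single ℂ (1 : ℂ) i).trans (one_smul ℂ (f i))

theorem hom_ext {M : Type} [AddCommGroup M] [Module ℂ M] {f g : HV →ₗ[ℂ] M}
    (h : ∀ i, f (of i) = g (of i)) : f = g :=
  Finsupp.lhom_ext' fun i => LinearMap.ext_ring (h i)

/-- The bilinear extension of `basisBracket`. -/
noncomputable def bracketMap : HV →ₗ[ℂ] HV →ₗ[ℂ] HV :=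
  lift fun i => lift fun j => basisBracket i j

theorem bracketMap_of (i j : HVIndex) : bracketMap (of i) (of j) = basisBracket i j := by
  simp [bracketMap, lift_of]

theorem basisBracket_skew (i j : HVIndex) : basisBracket i j = -basisBracket j i := by
  rcases i with n | n | _ | _ | _ <;> rcases j with m | m | _ | _ | _ <;>
    simp only [basisBracket, neg_zero]
  · rw [add_comm m n]
    by_cases h : n = -m
    · subst h; simp; module
    · have h2 : m ≠ -n := by omega
      simp only [h, h2, if_false]; module
  · module
  · module
  · by_cases h : n = -m
    · subst h; simp
    · have h2 : m ≠ -n := by omega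
      simp [h, h2]

theorem bracketMap_skew (x y : HV) : bracketMap x y = -bracketMap y x := by
  have h : bracketMap = -bracketMap.flip := by
    refine hom_ext fun i => hom_ext fun j => ?_
    simp [bracketMap_of, basisBracket_skew i j]
  exact congrArg (fun f => f x y) h

theorem bracketMap_of_basis_jacobi (i j k : HVIndex) :
    bracketMap (of i) (basisBracket j k) =
      bracketMap (basisBracket i j) (of k) + bracketMap (of j) (basisBracket i k) := by
  rcases i with a | a | _ | _ | _ <;> rcases j with b | b | _ | _ | _ <;>
    rcases k with c | c | _ | _ | _ <;>
    simp only [basisBracket, map_add, map_sub, map_smul, map_zero, LinearMap.add_apply,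
      LinearMap.sub_apply, LinearMap.smul_apply, LinearMap.zero_apply, bracketMap_of,
      smul_zero, add_zero, zero_add, sub_zero]
  all_goals
    have e1 : a + (b + c) = a + b + c := by ring
    have e2 : b + (a + c) = a + b + c := by ring
    have e3 : a + (c + b) = a + b + c := by ring
    have e4 : c + (a + b) = a + b + c := by ring
    have e5 : a + c + b = a + b + c := by ring
    have e6 : b + c + a = a + b + c := by ring
    have e7 : c + (b + a) = a + b + c := by ring
    have e8 : b + (c + a) = a + b + c := by ring
    have i1 : a = -(b + c) ↔ a + b + c = 0 := by omega
    have i2 : a + b = -c ↔ a + b + c = 0 := by omega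
    have i3 : b = -(a + c) ↔ a + b + c = 0 := by omega
    have i4 : a = -(c + b) ↔ a + b + c = 0 := by omega
    have i5 : c = -(a + b) ↔ a + b + c = 0 := by omega
    have i6 : a + c = -b ↔ a + b + c = 0 := by omega
    have i7 : b + c = -a ↔ a + b + c = 0 := by omega
    have i8 : c = -(b + a) ↔ a + b + c = 0 := by omega
    have i9 : b = -(c + a) ↔ a + b + c = 0 := by omega
    have i10 : b + a = -c ↔ a + b + c = 0 := by omega
    simp only [e1, e2, e3, e4, e5, e6, e7, e8, i1, i2, i3, i4, i5, i6, i7, i8, i9, i10]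
    by_cases h : a + b + c = 0
    · obtain rfl : c = -a - b := by omega
      simp only [h, if_true]
      push_cast
      module
    · simp only [h, if_false]
      push_cast
      module

theorem bracketMap_jacobi (x y z : HV) :
    bracketMap x (bracketMap y z) =
      bracketMap (bracketMap x y) z + bracketMap y (bracketMap x z) := by
  let T : HV →ₗ[ℂ] HV →ₗ[ℂ] HV →ₗ[ℂ] HV :=
    LinearMap.mk₂ ℂ (fun x y => bracketMap x ∘ₗ bracketMap y - bracketMap (bracketMap x y)
        - bracketMap y ∘ₗ bracketMap x)
      (fun x x' y => by ext1 z; simp; abel) (fun c x y => by ext1 z; simp [smul_sub])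
      (fun x y y' => by ext1 z; simp; abel) (fun c x y => by ext1 z; simp [smul_sub])
  have h : T = 0 := by
    refine hom_ext fun i => hom_ext fun j => hom_ext fun k => ?_
    simp [T, bracketMap_of, bracketMap_of_basis_jacobi i j k]
  have h2 : T x y z = 0 := by rw [h]; rfl
  simp only [T, LinearMap.mk₂_apply, LinearMap.sub_apply, LinearMap.comp_apply] at h2
  rw [sub_sub, sub_eq_zero] at h2
  exact h2

noncomputable instance : LieRing HV where
  bracket x y := bracketMap x y
  add_lie x y z := by simp
  lie_add x y z := by simp
  lie_self x := by
    have h : bracketMap x x = -bracketMap x x := bracketMap_skew x x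
    have h2 : (2 : ℂ) • bracketMap x x = 0 := by
      rw [two_smul]; nth_rewrite 1 [h]; exact neg_add_cancel _
    exact (smul_eq_zero.mp h2).resolve_left two_ne_zero
  leibniz_lie x y z := bracketMap_jacobi x y z

noncomputable instance : LieAlgebra ℂ HV where
  lie_smul t x y := (bracketMap x).map_smul t y

theorem lie_of (i j : HVIndex) : ⁅of i, of j⁆ = basisBracket i j := bracketMap_of i j

/-- Labels of the basis vectors spanning `H^{≥0} = H^0 ⊕ H^+`. -/
def Nonneg : HVIndex → Prop
  | .L n => 0 ≤ n
  | .I n => 0 ≤ n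
  | _ => True

/-- The subspace `H^{≥0}` spanned by `L(n), I(n)` for `n ≥ 0` and the three central elements. -/
noncomputable def nonnegSpan : Submodule ℂ HV := Submodule.span ℂ (of '' {i | Nonneg i})

theorem of_mem_nonnegSpan {i : HVIndex} (h : Nonneg i) : of i ∈ nonnegSpan :=
  Submodule.subset_span ⟨i, h, rfl⟩

theorem basisBracket_mem {i j : HVIndex} (hi : Nonneg i) (hj : Nonneg j) :
    basisBracket i j ∈ nonnegSpan := by
  have hL : ∀ n : ℤ, 0 ≤ n → of (.L n) ∈ nonnegSpan := fun n h => of_mem_nonnegSpan h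
  have hI : ∀ n : ℤ, 0 ≤ n → of (.I n) ∈ nonnegSpan := fun n h => of_mem_nonnegSpan h
  have h1 : of .CL ∈ nonnegSpan := of_mem_nonnegSpan trivial
  have h2 : of .CLI ∈ nonnegSpan := of_mem_nonnegSpan trivial
  have h3 : of .CI ∈ nonnegSpan := of_mem_nonnegSpan trivial
  rcases i with n | n | _ | _ | _ <;> rcases j with m | m | _ | _ | _ <;>
    simp only [basisBracket, zero_mem, Nonneg] at hi hj ⊢
  · exact add_mem (Submodule.smul_mem _ _ (hL _ (by omega))) (Submodule.smul_mem _ _ h1)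
  · exact sub_mem (Submodule.smul_mem _ _ (hI _ (by omega))) (Submodule.smul_mem _ _ h2)
  · exact add_mem (Submodule.smul_mem _ _ (hI _ (by omega))) (Submodule.smul_mem _ _ h2)
  · exact Submodule.smul_mem _ _ h3

/-- The Lie subalgebra `H^{≥0} = H^0 ⊕ H^+`. -/
noncomputable def nonneg : LieSubalgebra ℂ HV where
  toSubmodule := nonnegSpan
  lie_mem' {x y} hx hy := by
    change x ∈ nonnegSpan at hx
    change y ∈ nonnegSpan at hy
    change bracketMap x y ∈ nonnegSpan
    induction hx using Submodule.span_induction with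
    | zero => simp
    | add a b _ _ ha hb => simpa using add_mem ha hb
    | smul c a _ ha => simpa using Submodule.smul_mem _ c ha
    | mem a ha =>
      obtain ⟨i, hi, rfl⟩ := ha
      induction hy using Submodule.span_induction with
      | zero => simp
      | add a b _ _ ha hb => simpa using add_mem ha hb
      | smul c a _ ha => simpa using Submodule.smul_mem _ c ha
      | mem a ha =>
        obtain ⟨j, hj, rfl⟩ := ha
        rw [bracketMap_of]
        exact basisBracket_mem hi hj

/-- Operators on the basis: `L(0)` acts by `A`, `I(0)` by `B`, the central elements `C_L, C_LI, C_I`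
by the scalars `cL, cLI, cI`, and all `L(n), I(n)` with `n ≠ 0` by zero. -/
noncomputable def topOp {E : Type} [AddCommGroup E] [Module ℂ E] (cL cLI cI : ℂ)
    (A B : Module.End ℂ E) : HVIndex → Module.End ℂ E
  | .L n => if n = 0 then A else 0
  | .I n => if n = 0 then B else 0
  | .CL => cL • 1
  | .CLI => cLI • 1
  | .CI => cI • 1

theorem topOp_bracket {E : Type} [AddCommGroup E] [Module ℂ E] (cL cLI cI : ℂ)
    (A B : Module.End ℂ E) (hAB : Commute A B) {i j : HVIndex} (hi : Nonneg i) (hj : Nonneg j) :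
    lift (topOp cL cLI cI A B) (basisBracket i j) =
      ⁅topOp cL cLI cI A B i, topOp cL cLI cI A B j⁆ := by
  rcases i with n | n | _ | _ | _ <;> rcases j with m | m | _ | _ | _ <;>
    simp only [basisBracket, Nonneg, map_add, map_sub, map_smul, map_zero, lift_of] at hi hj ⊢ <;>
    simp only [topOp, Ring.lie_def, smul_mul_assoc, mul_smul_comm, one_mul, mul_one, sub_self]
  all_goals try rw [smul_comm, sub_self]
  all_goals
    by_cases hn : n = 0 <;> by_cases hm : m = 0
  all_goals
    have g1 : n + m = 0 ↔ n = 0 ∧ m = 0 := by omega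
    have g2 : n = -m ↔ n = 0 ∧ m = 0 := by omega
    have g3 : m + n = 0 ↔ n = 0 ∧ m = 0 := by omega
    have g4 : m = -n ↔ n = 0 ∧ m = 0 := by omega
    simp [g1, g2, g3, g4, hn, hm, hAB.eq]

/-- The `H^{≥0}`-module on `E` on which `H^+` acts by zero, `L(0)` and `I(0)` act by the commuting
operators `A` and `B`, and `C_L, C_LI, C_I` act by the scalars `cL, cLI, cI`. -/
noncomputable def topRep {E : Type} [AddCommGroup E] [Module ℂ E] (cL cLI cI : ℂ)
    (A B : Module.End ℂ E) (hAB : Commute A B) : nonneg →ₗ⁅ℂ⁆ Module.End ℂ E :=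
  { (lift (topOp cL cLI cI A B)).comp nonneg.toSubmodule.subtype with
    map_lie' := by
      rintro ⟨x, hx⟩ ⟨y, hy⟩
      change x ∈ nonnegSpan at hx
      change y ∈ nonnegSpan at hy
      change lift (topOp cL cLI cI A B) (bracketMap x y) =
        ⁅lift (topOp cL cLI cI A B) x, lift (topOp cL cLI cI A B) y⁆
      induction hx using Submodule.span_induction with
      | zero => simp
      | add a b _ _ ha hb => simp [ha, hb]
      | smul c a _ ha => simp [ha]
      | mem a ha =>
        obtain ⟨i, hi, rfl⟩ := ha
        induction hy using Submodule.span_induction with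
        | zero => simp
        | add a b _ _ ha hb => simp [ha, hb]
        | smul c a _ ha => simp [ha]
        | mem a ha =>
          obtain ⟨j, hj, rfl⟩ := ha
          rw [bracketMap_of, lift_of, lift_of]
          exact topOp_bracket cL cLI cI A B hAB hi hj }

theorem topRep_of {E : Type} [AddCommGroup E] [Module ℂ E] (cL cLI cI : ℂ)
    (A B : Module.End ℂ E) (hAB : Commute A B) {i : HVIndex} (hi : Nonneg i) :
    topRep cL cLI cI A B hAB ⟨of i, of_mem_nonnegSpan hi⟩ = topOp cL cLI cI A B i :=
  lift_of _ i

end HV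

/-! ### Induced modules -/

/-- The relations `x k ⊗ e = x ⊗ k e` for `x ∈ U(𝔤)`, `k ∈ 𝔨`, `e ∈ E`. -/
noncomputable def inducedRel {𝔤 : Type} [LieRing 𝔤] [LieAlgebra ℂ 𝔤] (𝔨 : LieSubalgebra ℂ 𝔤)
    {E : Type} [AddCommGroup E] [Module ℂ E] (ρ : 𝔨 →ₗ⁅ℂ⁆ Module.End ℂ E) :
    Submodule (UniversalEnvelopingAlgebra ℂ 𝔤) (UniversalEnvelopingAlgebra ℂ 𝔤 ⊗[ℂ] E) :=
  Submodule.span (UniversalEnvelopingAlgebra ℂ 𝔤)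
    {t | ∃ (x : UniversalEnvelopingAlgebra ℂ 𝔤) (k : 𝔨) (e : E),
      t = (x * UniversalEnvelopingAlgebra.ι ℂ (k : 𝔤)) ⊗ₜ[ℂ] e - x ⊗ₜ[ℂ] (ρ k e)}

/-- The induced `U(𝔤)`-module `U(𝔤) ⊗_{U(𝔨)} E` (recall that `U(𝔨)` is generated by `𝔨`). -/
abbrev Induced {𝔤 : Type} [LieRing 𝔤] [LieAlgebra ℂ 𝔤] (𝔨 : LieSubalgebra ℂ 𝔤)
    {E : Type} [AddCommGroup E] [Module ℂ E] (ρ : 𝔨 →ₗ⁅ℂ⁆ Module.End ℂ E) : Type :=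
  (UniversalEnvelopingAlgebra ℂ 𝔤 ⊗[ℂ] E) ⧸ inducedRel 𝔨 ρ

/-- The canonical map `E → U(𝔤) ⊗_{U(𝔨)} E`, `e ↦ 1 ⊗ e`. -/
noncomputable def Induced.unit {𝔤 : Type} [LieRing 𝔤] [LieAlgebra ℂ 𝔤] (𝔨 : LieSubalgebra ℂ 𝔤)
    {E : Type} [AddCommGroup E] [Module ℂ E] (ρ : 𝔨 →ₗ⁅ℂ⁆ Module.End ℂ E) :
    E →ₗ[ℂ] Induced 𝔨 ρ :=
  ((inducedRel 𝔨 ρ).mkQ.restrictScalars ℂ).comp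
    (TensorProduct.mk ℂ (UniversalEnvelopingAlgebra ℂ 𝔤) E 1)

/-! ### Modules over the Heisenberg-Virasoro algebra

Modules over the Lie algebra `HV` are modules over its universal enveloping algebra `UHV`;
submodules generated by vectors, quotients and homomorphisms are those of `UHV`-modules. -/

/-- The universal enveloping algebra of the Heisenberg-Virasoro algebra. -/
abbrev UHV : Type := UniversalEnvelopingAlgebra ℂ HV

/-- `L(n)` in the universal enveloping algebra. -/
noncomputable def opL (n : ℤ) : UHV := UniversalEnvelopingAlgebra.ι ℂ (HV.of (.L n))

/-- `I(n)` in the universal enveloping algebra. -/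
noncomputable def opI (n : ℤ) : UHV := UniversalEnvelopingAlgebra.ι ℂ (HV.of (.I n))

/-- The one-dimensional `H^{≥0}`-module on which `H^+` acts by zero and `C_L, C_I, C_LI, L(0), I(0)`
act by the scalars `cL, cI, cLI, h, hI`. -/
noncomputable def vermaTop (cL cI cLI h hI : ℂ) : HV.nonneg →ₗ⁅ℂ⁆ Module.End ℂ ℂ :=
  HV.topRep cL cLI cI (h • 1) (hI • 1)
    (((Commute.one_left (1 : Module.End ℂ ℂ)).smul_left h).smul_right hI)

/-- The Verma module `V(cL, cI, cLI, h, hI)`. -/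
abbrev Verma (cL cI cLI h hI : ℂ) : Type := Induced HV.nonneg (vermaTop cL cI cLI h hI)

/-- The highest weight vector of the Verma module. -/
noncomputable def Verma.hw (cL cI cLI h hI : ℂ) : Verma cL cI cLI h hI :=
  Induced.unit HV.nonneg (vermaTop cL cI cLI h hI) 1

/-- The maximal proper submodule of the Verma module: the sum of all proper submodules. -/
noncomputable def Verma.maxSub (cL cI cLI h hI : ℂ) : Submodule UHV (Verma cL cI cLI h hI) :=
  sSup {N | N ≠ ⊤}

/-- The irreducible highest weight module `L(cL, cI, cLI, h, hI)`, the quotient of the Verma module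
by its maximal proper submodule. -/
abbrev Irr (cL cI cLI h hI : ℂ) : Type := Verma cL cI cLI h hI ⧸ Verma.maxSub cL cI cLI h hI

/-- The highest weight vector of the irreducible highest weight module. -/
noncomputable def Irr.hw (cL cI cLI h hI : ℂ) : Irr cL cI cLI h hI :=
  (Verma.maxSub cL cI cLI h hI).mkQ (Verma.hw cL cI cLI h hI)

/-! ### The module `E`, its induced module and the quotient `U` -/

/-- The two-dimensional space `E` with basis `v^0, v^1`. -/
abbrev ESpace : Type := Fin 2 → ℂ

/-- The basis vector `v^i` of `E`. -/
def vE (i : Fin 2) : ESpace := Pi.single i 1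

/-- The operator on `E` with `v^1 ↦ v^0` and `v^0 ↦ 0`. -/
noncomputable def nilE : Module.End ℂ ESpace := Matrix.toLin' !![0, 1; 0, 0]

theorem nilE_one : nilE (vE 1) = vE 0 := by
  ext i; fin_cases i <;> simp [nilE, vE]

theorem nilE_zero : nilE (vE 0) = 0 := by
  ext i; fin_cases i <;> simp [nilE, vE]

/-- The `H^{≥0}`-module structure on `E`: `H^+` acts by zero, `L(0)` by the identity, `I(0)` by
`v^1 ↦ v^0 ↦ 0`, and `C_L, C_LI, C_I` by the scalars `cL, cLI, 0`. -/
noncomputable def repE (cL cLI : ℂ) : HV.nonneg →ₗ⁅ℂ⁆ Module.End ℂ ESpace :=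
  HV.topRep cL cLI 0 1 nilE (Commute.one_left nilE)

/-- The induced module `U(H) ⊗_{U(H^{≥0})} E`. -/
abbrev ETilde (cL cLI : ℂ) : Type := Induced HV.nonneg (repE cL cLI)

/-- The image of `v^i` in the induced module. -/
noncomputable def vTilde (cL cLI : ℂ) (i : Fin 2) : ETilde cL cLI :=
  Induced.unit HV.nonneg (repE cL cLI) (vE i)

/-- The submodule generated by `(L(-1) + I(-1) / cLI) v^0`. -/
noncomputable def singSub (cL cLI : ℂ) : Submodule UHV (ETilde cL cLI) :=
  Submodule.span UHV {(opL (-1) + (1 / cLI) • opI (-1)) • vTilde cL cLI 0}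

/-- The quotient of the induced module by the submodule generated by
`(L(-1) + I(-1) / cLI) v^0`. -/
abbrev UMod (cL cLI : ℂ) : Type := ETilde cL cLI ⧸ singSub cL cLI

/-- The canonical map `E → U`. -/
noncomputable def UMod.ofE (cL cLI : ℂ) : ESpace →ₗ[ℂ] UMod cL cLI :=
  ((singSub cL cLI).mkQ.restrictScalars ℂ).comp (Induced.unit HV.nonneg (repE cL cLI))

/-- The graded piece `U(m)`: the eigenspace of `L(0)` with eigenvalue `m + 1`. -/
noncomputable def UMod.piece (cL cLI : ℂ) (m : ℕ) : Submodule ℂ (UMod cL cLI) :=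
  Module.End.eigenspace (Algebra.lsmul ℂ ℂ (UMod cL cLI) (opL 0)) ((m : ℂ) + 1)

/-! ### Vertex operator algebras and their modules -/

/-- The mode `a_n` of the field `YM(a, z) = ∑ a_n z^{-n-1}`. -/
noncomputable abbrev mode {V M : Type} [AddCommGroup V] [Module ℂ V] [AddCommGroup M] [Module ℂ M]
    (YM : V →ₗ[ℂ] VertexOperator ℂ M) (a : V) (n : ℤ) : Module.End ℂ M :=
  VertexOperator.ncoeff (YM a) n

/-- The Jacobi identity in components (the Borcherds identity) for a space of fields
`YM : V → End(M)((z))` on `M` over a vertex algebra `(V, Y)`, where `Y(a, z) = ∑ a_n z^{-n-1}`.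
All sums have only finitely many nonzero terms. -/
def BorcherdsIdentity {V M : Type} [AddCommGroup V] [Module ℂ V] [AddCommGroup M] [Module ℂ M]
    (Y : V →ₗ[ℂ] VertexOperator ℂ V) (YM : V →ₗ[ℂ] VertexOperator ℂ M) : Prop :=
  ∀ (a b : V) (w : M) (p q r : ℤ),
    ∑ᶠ i : ℕ, ((Ring.choose p i : ℤ) : ℂ) • (mode YM (mode Y a (r + i) b) (p + q - i) w) =
      ∑ᶠ i : ℕ, ((-1 : ℂ) ^ i * ((Ring.choose r i : ℤ) : ℂ)) •
        (mode YM a (p + r - i) (mode YM b (q + i) w)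
          - (-1 : ℂ) ^ r • mode YM b (q + r - i) (mode YM a (p + i) w))

/-- `(V, Y, vac, ω)` is a vertex operator algebra of central charge `c`. Lower truncation is part of
the type of `Y`. -/
structure IsVOA {V : Type} [AddCommGroup V] [Module ℂ V] (Y : V →ₗ[ℂ] VertexOperator ℂ V)
    (vac ω : V) (c : ℂ) : Prop where
  vacuum : ∀ (n : ℤ) (b : V), mode Y vac n b = if n = -1 then b else 0
  creation : ∀ a : V, mode Y a (-1) vac = a
  creation_nonneg : ∀ (a : V) (n : ℤ), 0 ≤ n → mode Y a n vac = 0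
  jacobi : BorcherdsIdentity Y Y
  virasoro : ∀ (m n : ℤ) (b : V),
    mode Y ω (m + 1) (mode Y ω (n + 1) b) - mode Y ω (n + 1) (mode Y ω (m + 1) b) =
      ((m : ℂ) - n) • mode Y ω (m + n + 1) b +
        (if m + n = 0 then ((m : ℂ) ^ 3 - m) / 12 * c else 0) • b
  derivative : ∀ (a : V) (n : ℤ) (b : V),
    mode Y (mode Y ω 0 a) n b = (-(n : ℂ)) • mode Y a (n - 1) b
  grading : DirectSum.IsInternal fun n : ℤ => Module.End.eigenspace (mode Y ω 1) (n : ℂ)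
  finite : ∀ n : ℤ, FiniteDimensional ℂ (Module.End.eigenspace (mode Y ω 1) (n : ℂ))
  bounded : ∃ N : ℤ, ∀ n < N, Module.End.eigenspace (mode Y ω 1) (n : ℂ) = ⊥

/-- `(M, YM)` is a module for the vertex operator algebra `(V, Y, vac, ω)`. -/
structure IsVOAModule {V M : Type} [AddCommGroup V] [Module ℂ V] [AddCommGroup M] [Module ℂ M]
    (Y : V →ₗ[ℂ] VertexOperator ℂ V) (vac ω : V) (YM : V →ₗ[ℂ] VertexOperator ℂ M) : Prop where
  vacuum : ∀ (n : ℤ) (w : M), mode YM vac n w = if n = -1 then w else 0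
  jacobi : BorcherdsIdentity Y YM
  derivative : ∀ (a : V) (n : ℤ) (w : M),
    mode YM (mode Y ω 0 a) n w = (-(n : ℂ)) • mode YM a (n - 1) w
  grading : DirectSum.IsInternal fun s : ℂ => Module.End.eigenspace (mode YM ω 1) s
  finite : ∀ s : ℂ, FiniteDimensional ℂ (Module.End.eigenspace (mode YM ω 1) s)
  bounded : ∀ s : ℂ, ∃ N : ℤ, ∀ n < N, Module.End.eigenspace (mode YM ω 1) (s + n) = ⊥

/-! ### The Heisenberg-Virasoro vertex operator algebra -/

/-- The space of the Heisenberg-Virasoro vertex operator algebra `L(cL, cLI)`: the irreducible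
highest weight module `L(cL, 0, cLI, 0, 0)`. -/
abbrev HVVac (cL cLI : ℂ) : Type := Irr cL 0 cLI 0 0

/-- The vacuum vector. -/
noncomputable def vac (cL cLI : ℂ) : HVVac cL cLI := Irr.hw cL 0 cLI 0 0

/-- The conformal vector `ω = L(-2) 1`. -/
noncomputable def omega (cL cLI : ℂ) : HVVac cL cLI := opL (-2) • vac cL cLI

/-- The Heisenberg vector `I = I(-1) 1`. -/
noncomputable def heis (cL cLI : ℂ) : HVVac cL cLI := opI (-1) • vac cL cLI

/-- The fields of `ω` and `I` on an `HV`-module `M` are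
`∑ L(n) z^{-n-2}` and `∑ I(n) z^{-n-1}`. -/
def HasHVFields {cL cLI : ℂ} {M : Type} [AddCommGroup M] [Module ℂ M] [Module UHV M]
    (YM : HVVac cL cLI →ₗ[ℂ] VertexOperator ℂ M) : Prop :=
  (∀ (n : ℤ) (w : M), mode YM (omega cL cLI) (n + 1) w = opL n • w) ∧
    ∀ (n : ℤ) (w : M), mode YM (heis cL cLI) n w = opI n • w

/-- `Y` is the vertex operator map of the Heisenberg-Virasoro vertex operator algebra
`L(cL, cLI)`. -/
structure IsHVVOA {cL cLI : ℂ} (Y : HVVac cL cLI →ₗ[ℂ] VertexOperator ℂ (HVVac cL cLI)) :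
    Prop where
  voa : IsVOA Y (vac cL cLI) (omega cL cLI) cL
  fields : HasHVFields Y

/-- `YM` is a structure of module for the Heisenberg-Virasoro vertex operator algebra on the
`HV`-module `M`, compatible with the given action of `HV`. -/
structure IsHVModule {cL cLI : ℂ} (Y : HVVac cL cLI →ₗ[ℂ] VertexOperator ℂ (HVVac cL cLI))
    {M : Type} [AddCommGroup M] [Module ℂ M] [Module UHV M]
    (YM : HVVac cL cLI →ₗ[ℂ] VertexOperator ℂ M) : Prop where
  voaModule : IsVOAModule Y (vac cL cLI) (omega cL cLI) YM
  fields : HasHVFields YM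

/-- The linear map `f` commutes with the action of all modes of all fields. -/
def Intertwines {V M N : Type} [AddCommGroup V] [Module ℂ V] [AddCommGroup M] [Module ℂ M]
    [AddCommGroup N] [Module ℂ N] (YM : V →ₗ[ℂ] VertexOperator ℂ M)
    (YN : V →ₗ[ℂ] VertexOperator ℂ N) (f : M → N) : Prop :=
  ∀ (a : V) (n : ℤ) (w : M), f (mode YM a n w) = mode YN a n (f w)

/-! Everything rests on one presentation. For `cLI ≠ 0` the maximal submodule of the Verma module of
weight `h` (with `I(0)` acting by zero) is generated by the singular vector `(L(-1) + (h / cLI)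
I(-1)) v` of degree one (`Verma.maxSub_eq`), so maps out of the irreducible quotient are given by
highest weight vectors satisfying that single relation (`Irr.exists_lift`). For `h = 0` the relation
is `L(-1) 1 = 0`; for `h = 1` it is the relation imposed on `v^0` in `U`.

To prove the presentation, filter the quotient of the Verma module by the singular vector, giving
`L(-n)` weight `2n + 1` and `I(-n)` weight `2n - 1`. Every commutator then loses weight, except the
`cLI`-terms pairing `L(-j)` with `I(j)` and `I(-j)` with `L(j)`. Up to lower terms the modes act as
in a Weyl algebra, and a sum of normally ordered pairs measures the weight
(`IsSpecial.sum_weightOp`). A nonzero element of least weight in a submodule is therefore a multiple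
of the generator.

For the vertex operators, let `M` be a restricted module. Residue products with `L(z)` and `I(z)`
make the space of all fields on `M` a module over the same Lie algebra
(`IsRestricted.fieldAct_bracket`), in which the identity field behaves like a vacuum. The
presentation for `h = 0` yields a map `Φ` from the vacuum module to fields (`exists_isVertexMap`).
Its image is mutually local by Dong's lemma (`Fld.Local.prod`), mutually local fields satisfy the
Borcherds identity with residue products in place of modes (`Fld.Local.bor_eq`), and `Φ` turns modes
into residue products (`IsVertexMap.assoc`). This produces the algebra and its three modules by one
construction. Underneath lies one observation: raising the exponent `r` in the Borcherds expression
multiplies it by the difference of the variables (`Fld.bor_succ`), and a series killed by a power of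
that difference has a finite expansion (`diffOp_taylor`).

The extension is then a matter of `L(0)`-weights. The relation defining `U` has weight `2`, so `E`,
of weight `1`, survives. The map `f` sends the highest weight vector to `v^0`, and `g` kills `v^0`
and sends `v^1` to the highest weight vector. The cokernel of `f` is generated by a highest weight
vector, which gives exactness. A section would produce a vector of `E` killed by `I(0)`, hence a
multiple of `v^0`, but `g` kills `v^0`. -/

/-! ### Eventually zero sums and signed binomial coefficients -/

/-- A sequence with only finitely many nonzero terms. -/
def EvZero {M : Type} [Zero M] (f : ℕ → M) : Prop := ∃ K : ℕ, ∀ i ≥ K, f i = 0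

/-- The signed binomial coefficient `(-1)^i * choose r i`. -/
noncomputable def bc (r : ℤ) (i : ℕ) : ℂ := (-1 : ℂ) ^ i * ((Ring.choose r i : ℤ) : ℂ)

theorem bc_zero_right (r : ℤ) : bc r 0 = 1 := by simp [bc]

theorem bc_zero_succ (i : ℕ) : bc 0 (i + 1) = 0 := by simp [bc, Ring.choose_zero_succ]

theorem bc_succ_succ (r : ℤ) (i : ℕ) : bc (r + 1) (i + 1) = bc r (i + 1) - bc r i := by
  simp only [bc, Ring.choose_succ_succ]; push_cast; ring

theorem choose_succ_mul (r : ℤ) (i : ℕ) :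
    Ring.choose r (i + 1) * ((i : ℤ) + 1) = r * Ring.choose (r - 1) i := by
  have h := Ring.choose_smul_choose (R := ℤ) r (n := i + 1) (k := 1) (by omega)
  simp only [Nat.choose_one_right, Ring.choose_one_right, Nat.add_sub_cancel, nsmul_eq_mul] at h
  push_cast at h ⊢
  linear_combination h

theorem choose_mul_sub (r : ℤ) (i : ℕ) :
    Ring.choose r i * (r - i) = r * Ring.choose (r - 1) i := by
  have h := choose_succ_mul r i
  induction i with
  | zero => simp
  | succ i ih =>
    have h1 := choose_succ_mul r i
    have h2 := Ring.choose_succ_succ (r - 1) i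
    rw [sub_add_cancel] at h2
    push_cast
    linear_combination (-1) * h1 + r * h2

/-- Coefficientwise, the `z`-derivative of `(x - z)^r`; `bc_mul_sub` is the `x`-derivative. -/
theorem bc_succ_mul (r : ℤ) (i : ℕ) : bc r (i + 1) * ((i : ℂ) + 1) = -((r : ℂ) * bc (r - 1) i) := by
  have h : ((Ring.choose r (i + 1) * ((i : ℤ) + 1) : ℤ) : ℂ) = ((r * Ring.choose (r - 1) i : ℤ) : ℂ) :=
    congrArg _ (choose_succ_mul r i)
  push_cast at h
  simp only [bc, pow_succ]
  linear_combination (-(-1 : ℂ) ^ i) * h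

theorem bc_mul_sub (r : ℤ) (i : ℕ) : bc r i * ((r : ℂ) - i) = (r : ℂ) * bc (r - 1) i := by
  have h : ((Ring.choose r i * (r - (i : ℤ)) : ℤ) : ℂ) = ((r * Ring.choose (r - 1) i : ℤ) : ℂ) :=
    congrArg _ (choose_mul_sub r i)
  push_cast at h
  simp only [bc]
  linear_combination ((-1 : ℂ) ^ i) * h

theorem bc_neg_one (i : ℕ) : bc (-1) i = 1 := by
  induction i with
  | zero => exact bc_zero_right _
  | succ i ih =>
    have h := bc_succ_succ (-1) i
    rw [neg_add_cancel, bc_zero_succ, ih] at h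
    linear_combination -h

theorem bc_nat_succ (n : ℕ) : bc n (n + 1) = 0 := by
  simp [bc, Ring.choose_natCast]

section Sums

variable {M N : Type} [AddCommGroup M] [AddCommGroup N]

theorem EvZero.map {f : ℕ → M} (h : EvZero f) (g : ℕ → M → N) (hg : ∀ i, g i 0 = 0) :
    EvZero fun i => g i (f i) :=
  let ⟨K, hK⟩ := h
  ⟨K, fun i hi => by simp only [hK i hi, hg]⟩

theorem EvZero.succ {f : ℕ → M} (h : EvZero f) : EvZero fun i => f (i + 1) :=
  let ⟨K, hK⟩ := h
  ⟨K, fun i hi => hK _ (by omega)⟩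

theorem EvZero.smul [Module ℂ M] {f : ℕ → M} (h : EvZero f) (c : ℕ → ℂ) :
    EvZero fun i => c i • f i := h.map (fun i x => c i • x) fun _ => smul_zero _

theorem EvZero.finite {f : ℕ → M} (h : EvZero f) : (Function.support f).Finite := by
  obtain ⟨K, hK⟩ := h
  refine (Set.finite_lt_nat K).subset fun i hi => ?_
  by_contra hh
  exact hi (hK i (not_lt.mp hh))

theorem finsum_eq_range {f : ℕ → M} {K : ℕ} (h : ∀ i ≥ K, f i = 0) :
    ∑ᶠ i, f i = ∑ i ∈ Finset.range K, f i := by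
  refine finsum_eq_sum_of_support_subset f fun i hi => ?_
  by_contra hh
  exact hi (h i (by simpa using hh))

theorem EvZero.finsum_add {f g : ℕ → M} (hf : EvZero f) (hg : EvZero g) :
    ∑ᶠ i, (f i + g i) = ∑ᶠ i, f i + ∑ᶠ i, g i := finsum_add_distrib hf.finite hg.finite

theorem EvZero.finsum_sub {f g : ℕ → M} (hf : EvZero f) (hg : EvZero g) :
    ∑ᶠ i, (f i - g i) = ∑ᶠ i, f i - ∑ᶠ i, g i := finsum_sub_distrib hf.finite hg.finite

theorem EvZero.map_finsum {f : ℕ → M} (hf : EvZero f) (g : M →+ N) :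
    g (∑ᶠ i, f i) = ∑ᶠ i, g (f i) := g.map_finsum hf.finite

theorem EvZero.smul_finsum [Module ℂ M] {f : ℕ → M} (hf : EvZero f) (c : ℂ) :
    c • (∑ᶠ i, f i) = ∑ᶠ i, c • f i := hf.map_finsum (DistribSMul.toAddMonoidHom M c)

theorem EvZero.finsum_succ {f : ℕ → M} (hf : EvZero f) :
    ∑ᶠ i, f i = f 0 + ∑ᶠ i, f (i + 1) := by
  obtain ⟨K, hK⟩ := hf
  rw [finsum_eq_range (K := K + 1) fun i hi => hK i (by omega),
    finsum_eq_range (K := K) fun i hi => hK (i + 1) (by omega), Finset.sum_range_succ', add_comm]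

theorem finsum_bc_zero [Module ℂ M] (X : ℕ → M) : ∑ᶠ i, bc 0 i • X i = X 0 := by
  rw [finsum_eq_range (K := 1)]
  · simp [bc_zero_right]
  · intro i hi
    obtain ⟨j, rfl⟩ : ∃ j, i = j + 1 := ⟨i - 1, by omega⟩
    rw [bc_zero_succ, zero_smul]

/-- `(x - z)^(r+1) = x (x - z)^r - z (x - z)^r`, where the index shift `i + 1` records the factor
`z`. -/
theorem finsum_bc_succ [Module ℂ M] {X : ℕ → M} (hX : EvZero X) (r : ℤ) :
    ∑ᶠ i, bc (r + 1) i • X i = ∑ᶠ i, bc r i • X i - ∑ᶠ i, bc r i • X (i + 1) := by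
  rw [(hX.smul _).finsum_succ, (hX.smul (bc r)).finsum_succ]
  simp only [bc_succ_succ, sub_smul, bc_zero_right]
  rw [(hX.succ.smul _).finsum_sub (hX.succ.smul _)]
  abel

end Sums

/-! ### Two-variable expansions -/

/-- Multiplication by the difference of the two variables, on coefficients. -/
def diffOp {G : Type} [AddCommGroup G] (b : ℤ → ℤ → G) : ℤ → ℤ → G :=
  fun l k => b (l + 1) k - b l (k + 1)

section DiffOp

variable {G : Type} [AddCommGroup G]

theorem diffOp_zero : diffOp (0 : ℤ → ℤ → G) = 0 := by
  funext l k; simp [diffOp]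

theorem diffOp_iterate_zero (n : ℕ) : diffOp^[n] (0 : ℤ → ℤ → G) = 0 := by
  induction n with
  | zero => rfl
  | succ n ih => rw [Function.iterate_succ_apply, diffOp_zero, ih]

theorem diffOp_iterate_eq_zero_of_le {b : ℤ → ℤ → G} {n m : ℕ} (h : diffOp^[n] b = 0)
    (hnm : n ≤ m) : diffOp^[m] b = 0 := by
  obtain ⟨j, rfl⟩ := Nat.exists_eq_add_of_le' hnm
  rw [Function.iterate_add_apply, h, diffOp_iterate_zero]

/-- On the series `∑ b l k x^(-l-1) z^(-k-1)`, `diffOp` is multiplication by `x - z`, and a series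
killed by `(x - z)^N` is a combination of divided derivatives of the delta function. Both sides
satisfy the same first-order recursion in `p`, by Pascal's rule and the induction hypothesis for
`diffOp b`, and they agree at `p = 0`. -/
theorem diffOp_taylor {N : ℕ} {b : ℤ → ℤ → G} (h : diffOp^[N] b = 0) (p q : ℤ) :
    b p q = ∑ i ∈ Finset.range N, (Ring.choose p i : ℤ) • (diffOp^[i] b) 0 (p + q - i) := by
  induction N generalizing b p q with
  | zero => simp only [Function.iterate_zero, id] at h; simp [h]
  | succ N ih =>
    have hS := ih (b := diffOp b) (by rwa [← Function.iterate_succ_apply])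
    set T : ℤ → ℤ → G := fun p q =>
      ∑ i ∈ Finset.range (N + 1), (Ring.choose p i : ℤ) • (diffOp^[i] b) 0 (p + q - i) with hT
    have step : ∀ p q, T (p + 1) q - T p (q + 1) = diffOp b p q := by
      intro p q
      rw [hS p q]
      simp only [hT]
      rw [Finset.sum_range_succ', Finset.sum_range_succ' _ N, Ring.choose_zero_right,
        Ring.choose_zero_right]
      have e : p + 1 + q = p + (q + 1) := by ring
      simp only [e, Nat.cast_zero, add_sub_add_right_eq_sub]
      rw [← Finset.sum_sub_distrib]
      refine Finset.sum_congr rfl fun i _ => ?_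
      have e2 : p + (q + 1) - ((i + 1 : ℕ) : ℤ) = p + q - i := by push_cast; ring
      rw [Ring.choose_succ_succ, add_smul, add_sub_cancel_right, Function.iterate_succ_apply, e2]
    have base : ∀ q, T 0 q = b 0 q := by
      intro q
      simp only [hT]
      rw [Finset.sum_range_succ', Finset.sum_eq_zero]
      · simp
      · intro i _; rw [Ring.choose_zero_succ, zero_smul]
    have main : ∀ p q, b p q = T p q := by
      intro p
      induction p using Int.induction_on with
      | zero => exact fun q => (base q).symm
      | succ p ihp =>
        intro q
        have h1 := step p q
        rw [← ihp] at h1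
        have h2 : b (p + 1) q - b p (q + 1) = diffOp b p q := rfl
        rw [← h2] at h1
        exact (sub_left_inj.mp h1).symm
      | pred p ihp =>
        intro q
        have h1 := step (-p - 1) (q - 1)
        have h2 : b (-p - 1 + 1) (q - 1) - b (-p - 1) (q - 1 + 1) = diffOp b (-p - 1) (q - 1) := rfl
        rw [← h2] at h1
        simp only [sub_add_cancel] at h1
        rw [← ihp] at h1
        exact (sub_right_inj.mp h1).symm
    exact main p q

/-- Converse of `diffOp_taylor`: by Pascal's rule `diffOp` drops the term `i = 0` and shifts the
coefficients by one. The second half shows that the coefficients are unique. -/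
theorem diffOp_iterate_of_expansion {N : ℕ} {b : ℤ → ℤ → G} {F : ℕ → ℤ → G}
    (h : ∀ l k, b l k = ∑ i ∈ Finset.range N, (Ring.choose l i : ℤ) • F i (l + k - i)) :
    diffOp^[N] b = 0 ∧ ∀ i < N, ∀ k, (diffOp^[i] b) 0 k = F i k := by
  induction N generalizing b F with
  | zero =>
    refine ⟨?_, fun i hi => absurd hi (Nat.not_lt_zero i)⟩
    funext l k; simpa using h l k
  | succ N ih =>
    have hS := ih (b := diffOp b) (F := fun i => F (i + 1)) (by
      intro l k
      simp only [diffOp, h]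
      rw [Finset.sum_range_succ', Finset.sum_range_succ' _ N, Ring.choose_zero_right,
        Ring.choose_zero_right]
      have e : l + 1 + k = l + (k + 1) := by ring
      simp only [e, Nat.cast_zero, add_sub_add_right_eq_sub]
      rw [← Finset.sum_sub_distrib]
      refine Finset.sum_congr rfl fun i _ => ?_
      rw [Ring.choose_succ_succ, add_smul, add_sub_cancel_right]
      congr 2
      push_cast; omega)
    refine ⟨by rw [Function.iterate_succ_apply]; exact hS.1, fun i hi k => ?_⟩
    cases i with
    | zero =>
      rw [Function.iterate_zero, id, h, Finset.sum_range_succ', Finset.sum_eq_zero]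
      · simp
      · intro i _; rw [Ring.choose_zero_succ, zero_smul]
    | succ i => rw [Function.iterate_succ_apply]; exact hS.2 i (by omega) k

theorem diffOp_iterate_swap (b : ℤ → ℤ → G) (n : ℕ) :
    diffOp^[n] (fun l k => b k l) = fun l k => (-1 : ℤ) ^ n • (diffOp^[n] b) k l := by
  induction n with
  | zero => simp
  | succ n ih =>
    rw [Function.iterate_succ_apply', Function.iterate_succ_apply', ih]
    funext l k
    simp only [diffOp, pow_succ]
    module

theorem diffOp_iterate_neg (b : ℤ → ℤ → G) (n : ℕ) :
    diffOp^[n] (fun l k => -b l k) = fun l k => -(diffOp^[n] b) l k := by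
  induction n with
  | zero => simp
  | succ n ih =>
    rw [Function.iterate_succ_apply', Function.iterate_succ_apply', ih]
    funext l k
    simp only [diffOp]; abel

end DiffOp

/-! ### Fields and their residue products -/

/-- The space of fields `∑ F(n) z^{-n-1}` on `M`, given by their modes. -/
def Fld (M : Type) [AddCommGroup M] [Module ℂ M] : Submodule ℂ (ℤ → Module.End ℂ M) where
  carrier := {F | ∀ w, ∃ K : ℤ, ∀ k ≥ K, F k w = 0}
  zero_mem' w := ⟨0, fun _ _ => rfl⟩
  add_mem' {F G} hF hG w := by
    obtain ⟨K, hK⟩ := hF w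
    obtain ⟨J, hJ⟩ := hG w
    refine ⟨max K J, fun k hk => ?_⟩
    simp [hK k (le_trans (le_max_left _ _) hk), hJ k (le_trans (le_max_right _ _) hk)]
  smul_mem' c F hF w := by
    obtain ⟨K, hK⟩ := hF w
    exact ⟨K, fun k hk => by simp [hK k hk]⟩

namespace Fld

variable {M : Type} [AddCommGroup M] [Module ℂ M]

@[ext] theorem ext {A B : Fld M} (h : ∀ k w, A.1 k w = B.1 k w) : A = B :=
  Subtype.ext (funext fun k => LinearMap.ext (h k))

@[simp] theorem add_apply (A B : Fld M) (k : ℤ) (w : M) : (A + B).1 k w = A.1 k w + B.1 k w := rfl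
@[simp] theorem sub_apply (A B : Fld M) (k : ℤ) (w : M) : (A - B).1 k w = A.1 k w - B.1 k w := rfl
@[simp] theorem neg_apply (A : Fld M) (k : ℤ) (w : M) : (-A).1 k w = -A.1 k w := rfl
@[simp] theorem smul_apply (c : ℂ) (A : Fld M) (k : ℤ) (w : M) : (c • A).1 k w = c • A.1 k w := rfl
@[simp] theorem zsmul_apply (c : ℤ) (A : Fld M) (k : ℤ) (w : M) : (c • A).1 k w = c • A.1 k w := rfl
@[simp] theorem zero_apply (k : ℤ) (w : M) : (0 : Fld M).1 k w = 0 := rfl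

theorem evZero (A : Fld M) (k : ℤ) (w : M) : EvZero fun i : ℕ => A.1 (k + i) w := by
  obtain ⟨K, hK⟩ := A.2 w
  exact ⟨(K - k).toNat, fun i hi => hK _ (by omega)⟩

theorem trunc_finite (A : Fld M) (f : ℕ → M) (J : ℕ) : ∃ K : ℤ, ∀ j < J, ∀ k ≥ K, A.1 k (f j) = 0 := by
  induction J with
  | zero => exact ⟨0, fun j hj => absurd hj (Nat.not_lt_zero j)⟩
  | succ J ih =>
    obtain ⟨K, hK⟩ := ih
    obtain ⟨K', hK'⟩ := A.2 (f J)
    refine ⟨max K K', fun j hj k hk => ?_⟩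
    rcases Nat.lt_succ_iff_lt_or_eq.mp hj with h | rfl
    · exact hK j h k (le_trans (le_max_left _ _) hk)
    · exact hK' k (le_trans (le_max_right _ _) hk)

/-- Only finitely many nonnegative modes of `B` act nontrivially on `w`, so one bound on the modes
of `A` serves them all. -/
theorem trunc_comp (A B : Fld M) (w : M) (a : ℤ) :
    ∃ K : ℕ, ∀ i ≥ K, ∀ j : ℕ, A.1 (a + i - j) (B.1 j w) = 0 ∧ A.1 i (B.1 j w) = 0 := by
  obtain ⟨J, hJ⟩ := B.2 w
  obtain ⟨K, hK⟩ := trunc_finite A (fun j => B.1 j w) J.toNat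
  refine ⟨(K - a + J.toNat).toNat + K.toNat, fun i hi j => ?_⟩
  by_cases hj : j < J.toNat
  · exact ⟨hK j hj _ (by omega), hK j hj _ (by omega)⟩
  · rw [hJ j (by omega), map_zero, map_zero]; exact ⟨rfl, rfl⟩

/-- The coefficients of the commutator of two fields. -/
def comm (A B : Fld M) : ℤ → ℤ → Module.End ℂ M := fun l k => A.1 l * B.1 k - B.1 k * A.1 l

theorem comm_swap (A B : Fld M) : comm A B = fun l k => -comm B A k l := by
  funext l k; simp [comm]

/-- `Res_x x^l (x - z)^r A(x) C(z)` expanded in `|x| > |z|`. -/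
noncomputable def resPlus (A C : Fld M) (r l k : ℤ) : Module.End ℂ M where
  toFun w := ∑ᶠ i : ℕ, bc r i • A.1 (l + r - i) (C.1 (k + i) w)
  map_add' v w := by
    rw [← EvZero.finsum_add (((evZero C k v).map _ fun _ => map_zero _).smul _)
      (((evZero C k w).map _ fun _ => map_zero _).smul _)]
    exact finsum_congr fun i => by simp
  map_smul' c v := by
    rw [RingHom.id_apply, EvZero.smul_finsum (((evZero C k v).map _ fun _ => map_zero _).smul _)]
    exact finsum_congr fun i => by simp [smul_comm c]

/-- `Res_x x^l (x - z)^r C(z) A(x)` expanded in `|z| > |x|`, up to the sign `(-1)^r`. -/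
noncomputable def resMinus (A C : Fld M) (r l k : ℤ) : Module.End ℂ M where
  toFun w := ∑ᶠ i : ℕ, bc r i • C.1 (k + r - i) (A.1 (l + i) w)
  map_add' v w := by
    rw [← EvZero.finsum_add (((evZero A l v).map _ fun _ => map_zero _).smul _)
      (((evZero A l w).map _ fun _ => map_zero _).smul _)]
    exact finsum_congr fun i => by simp
  map_smul' c v := by
    rw [RingHom.id_apply, EvZero.smul_finsum (((evZero A l v).map _ fun _ => map_zero _).smul _)]
    exact finsum_congr fun i => by simp [smul_comm c]

theorem resPlus_apply (A C : Fld M) (r l k : ℤ) (w : M) :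
    resPlus A C r l k w = ∑ᶠ i : ℕ, bc r i • A.1 (l + r - i) (C.1 (k + i) w) := rfl

theorem resMinus_apply (A C : Fld M) (r l k : ℤ) (w : M) :
    resMinus A C r l k w = ∑ᶠ i : ℕ, bc r i • C.1 (k + r - i) (A.1 (l + i) w) := rfl

theorem evZero_plus (A C : Fld M) (l : ℕ → ℤ) (k : ℤ) (w : M) :
    EvZero fun i : ℕ => A.1 (l i) (C.1 (k + i) w) := (evZero C k w).map _ fun _ => map_zero _

/-- The right-hand side of the Borcherds identity. -/
noncomputable def bor (A C : Fld M) (r l k : ℤ) : Module.End ℂ M :=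
  resPlus A C r l k - (-1 : ℂ) ^ r • resMinus A C r l k

theorem bor_apply (A C : Fld M) (r l k : ℤ) (w : M) :
    bor A C r l k w = resPlus A C r l k w - (-1 : ℂ) ^ r • resMinus A C r l k w := rfl

theorem neg_one_zpow_succ (r : ℤ) : (-1 : ℂ) ^ (r + 1) = -(-1 : ℂ) ^ r := by
  rw [zpow_add_one₀ (by norm_num)]; ring

/-- Raising `r` multiplies by `x - z` in both expansions of `(x - z)^r`. The factor `(-1)^r` turns
the `(z - x)^r` of `resMinus` into `(x - z)^r`, so the signs match. -/
theorem bor_succ (A C : Fld M) (r : ℤ) : bor A C (r + 1) = diffOp (bor A C r) := by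
  funext l k
  ext w
  simp only [diffOp, LinearMap.sub_apply, bor_apply, resPlus_apply, resMinus_apply]
  rw [finsum_bc_succ (evZero_plus A C _ k w), finsum_bc_succ (evZero_plus C A _ l w),
    neg_one_zpow_succ]
  have e1 : ∀ i : ℕ, l + (r + 1) - i = l + 1 + r - i := fun i => by ring
  have e2 : ∀ i : ℕ, l + 1 + r - (i + 1 : ℕ) = l + r - i := fun i => by push_cast; ring
  have e3 : ∀ i : ℕ, k + ((i + 1 : ℕ) : ℤ) = k + 1 + i := fun i => by push_cast; ring
  have e4 : ∀ i : ℕ, k + (r + 1) - i = k + 1 + r - i := fun i => by ring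
  have e5 : ∀ i : ℕ, k + 1 + r - (i + 1 : ℕ) = k + r - i := fun i => by push_cast; ring
  have e6 : ∀ i : ℕ, l + ((i + 1 : ℕ) : ℤ) = l + 1 + i := fun i => by push_cast; ring
  simp only [e1, e2, e3, e4, e5, e6]
  module

theorem bor_zero (A C : Fld M) : bor A C 0 = comm A C := by
  funext l k
  ext w
  simp only [bor_apply, resPlus_apply, resMinus_apply, finsum_bc_zero, comm]
  simp

theorem bor_add_nat (A C : Fld M) (r : ℤ) (n : ℕ) : bor A C (r + n) = diffOp^[n] (bor A C r) := by
  induction n with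
  | zero => simp
  | succ n ih => rw [Function.iterate_succ_apply', ← ih, ← bor_succ]; push_cast; ring_nf

/-- Hence locality of order `N` is exactly the vanishing of `bor A C N`. -/
theorem bor_nat (A C : Fld M) (n : ℕ) : bor A C n = diffOp^[n] (comm A C) := by
  have := bor_add_nat A C 0 n
  rwa [zero_add, bor_zero] at this

theorem bor_mem (A C : Fld M) (r l : ℤ) (w : M) : ∃ K : ℤ, ∀ k ≥ K, bor A C r l k w = 0 := by
  obtain ⟨K, hK⟩ := C.2 w
  obtain ⟨J, hJ⟩ := A.2 w
  obtain ⟨K', hK'⟩ := trunc_finite C (fun i => A.1 (l + i) w) (J - l).toNat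
  refine ⟨max K (K' - r + (J - l).toNat), fun k hk => ?_⟩
  rw [ge_iff_le, max_le_iff] at hk
  rw [bor_apply, resPlus_apply, resMinus_apply, finsum_eq_zero_of_forall_eq_zero,
    finsum_eq_zero_of_forall_eq_zero, smul_zero, sub_zero]
  · intro i
    by_cases hi : i < (J - l).toNat
    · rw [hK' i hi _ (by omega), smul_zero]
    · rw [hJ (l + i) (by omega), map_zero, smul_zero]
  · intro i
    rw [hK (k + i) (by omega), map_zero, smul_zero]

theorem bor_add_left (A A' C : Fld M) (r l k : ℤ) :
    bor (A + A') C r l k = bor A C r l k + bor A' C r l k := by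
  ext w
  have h1 : resPlus (A + A') C r l k w = resPlus A C r l k w + resPlus A' C r l k w := by
    simp only [resPlus_apply, add_apply, smul_add]
    exact EvZero.finsum_add ((evZero_plus A C _ k w).smul _) ((evZero_plus A' C _ k w).smul _)
  have h2 : resMinus (A + A') C r l k w = resMinus A C r l k w + resMinus A' C r l k w := by
    simp only [resMinus_apply, add_apply, smul_add, map_add]
    exact EvZero.finsum_add ((evZero_plus C A _ l w).smul _) ((evZero_plus C A' _ l w).smul _)
  simp only [LinearMap.add_apply, bor_apply, h1, h2]
  module

theorem bor_add_right (A C C' : Fld M) (r l k : ℤ) :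
    bor A (C + C') r l k = bor A C r l k + bor A C' r l k := by
  ext w
  have h1 : resPlus A (C + C') r l k w = resPlus A C r l k w + resPlus A C' r l k w := by
    simp only [resPlus_apply, add_apply, smul_add, map_add]
    exact EvZero.finsum_add ((evZero_plus A C _ k w).smul _) ((evZero_plus A C' _ k w).smul _)
  have h2 : resMinus A (C + C') r l k w = resMinus A C r l k w + resMinus A C' r l k w := by
    simp only [resMinus_apply, add_apply, smul_add]
    exact EvZero.finsum_add ((evZero_plus C A _ l w).smul _) ((evZero_plus C' A _ l w).smul _)
  simp only [LinearMap.add_apply, bor_apply, h1, h2]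
  module

theorem bor_smul_left (c : ℂ) (A C : Fld M) (r l k : ℤ) : bor (c • A) C r l k = c • bor A C r l k := by
  ext w
  have h1 : resPlus (c • A) C r l k w = c • resPlus A C r l k w := by
    simp only [resPlus_apply, smul_apply]
    rw [EvZero.smul_finsum ((evZero_plus A C _ k w).smul _)]
    exact finsum_congr fun i => smul_comm _ _ _
  have h2 : resMinus (c • A) C r l k w = c • resMinus A C r l k w := by
    simp only [resMinus_apply, smul_apply, map_smul]
    rw [EvZero.smul_finsum ((evZero_plus C A _ l w).smul _)]
    exact finsum_congr fun i => smul_comm _ _ _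
  simp only [LinearMap.smul_apply, bor_apply, h1, h2]
  module

theorem bor_smul_right (c : ℂ) (A C : Fld M) (r l k : ℤ) :
    bor A (c • C) r l k = c • bor A C r l k := by
  ext w
  have h1 : resPlus A (c • C) r l k w = c • resPlus A C r l k w := by
    simp only [resPlus_apply, smul_apply, map_smul]
    rw [EvZero.smul_finsum ((evZero_plus A C _ k w).smul _)]
    exact finsum_congr fun i => smul_comm _ _ _
  have h2 : resMinus A (c • C) r l k w = c • resMinus A C r l k w := by
    simp only [resMinus_apply, smul_apply]
    rw [EvZero.smul_finsum ((evZero_plus C A _ l w).smul _)]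
    exact finsum_congr fun i => smul_comm _ _ _
  simp only [LinearMap.smul_apply, bor_apply, h1, h2]
  module

/-- The `n`-th residue product of fields. -/
noncomputable def prod (n : ℤ) : Fld M →ₗ[ℂ] Fld M →ₗ[ℂ] Fld M :=
  LinearMap.mk₂ ℂ (fun A C => ⟨fun k => bor A C n 0 k, fun w => bor_mem A C n 0 w⟩)
    (fun A A' C => Subtype.ext (funext fun k => bor_add_left A A' C n 0 k))
    (fun c A C => Subtype.ext (funext fun k => bor_smul_left c A C n 0 k))
    (fun A C C' => Subtype.ext (funext fun k => bor_add_right A C C' n 0 k))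
    (fun c A C => Subtype.ext (funext fun k => bor_smul_right c A C n 0 k))

theorem prod_val (n : ℤ) (A C : Fld M) (k : ℤ) : (prod n A C).1 k = bor A C n 0 k := rfl

theorem prod_apply (n : ℤ) (A C : Fld M) (k : ℤ) (w : M) :
    (prod n A C).1 k w = ∑ᶠ i : ℕ, bc n i • A.1 (n - i) (C.1 (k + i) w) -
      (-1 : ℂ) ^ n • ∑ᶠ i : ℕ, bc n i • C.1 (k + n - i) (A.1 i w) := by
  simp only [prod_val, bor_apply, resPlus_apply, resMinus_apply, zero_add]

/-! ### Residue products against shifts, commutators, derivatives and the identity field -/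

/-- Multiplication of a field by its variable. -/
def shift : Fld M →ₗ[ℂ] Fld M where
  toFun A := ⟨fun k => A.1 (k + 1), fun w => by
    obtain ⟨K, hK⟩ := A.2 w
    exact ⟨K, fun k hk => hK _ (by omega)⟩⟩
  map_add' _ _ := rfl
  map_smul' _ _ := rfl

theorem shift_val (A : Fld M) (k : ℤ) : (shift A).1 k = A.1 (k + 1) := rfl

/-- The commutator of a field with an endomorphism. -/
def ad (x : Module.End ℂ M) : Fld M →ₗ[ℂ] Fld M where
  toFun A := ⟨fun k => x * A.1 k - A.1 k * x, fun w => by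
    obtain ⟨K, hK⟩ := A.2 w
    obtain ⟨J, hJ⟩ := A.2 (x w)
    refine ⟨max K J, fun k hk => ?_⟩
    simp [hK k (le_trans (le_max_left _ _) hk), hJ k (le_trans (le_max_right _ _) hk)]⟩
  map_add' A B := by ext k w; simp; abel
  map_smul' c A := by ext k w; simp [smul_sub]

theorem ad_apply (x : Module.End ℂ M) (A : Fld M) (k : ℤ) (w : M) :
    (ad x A).1 k w = x (A.1 k w) - A.1 k (x w) := rfl

/-- The identity field. -/
def one : Fld M := ⟨fun k => if k = -1 then 1 else 0, fun w => ⟨0, fun k hk => by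
  simp only [if_neg (show k ≠ -1 by omega)]; rfl⟩⟩

theorem one_apply (k : ℤ) (w : M) : (one : Fld M).1 k w = if k = -1 then w else 0 := by
  simp only [one]; split_ifs <;> rfl

/-- The derivative of a field. -/
noncomputable def deriv : Fld M →ₗ[ℂ] Fld M where
  toFun A := ⟨fun k => (-(k : ℂ)) • A.1 (k - 1), fun w => by
    obtain ⟨K, hK⟩ := A.2 w
    exact ⟨K + 1, fun k hk => by simp [hK (k - 1) (by omega)]⟩⟩
  map_add' A B := by ext k w; simp
  map_smul' c A := by ext k w; simp [smul_comm c]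

theorem deriv_apply (A : Fld M) (k : ℤ) (w : M) : (deriv A).1 k w = (-(k : ℂ)) • A.1 (k - 1) w := rfl

/-- Write `y = (y - z) + z` inside the residue: the first summand raises `n`, the second multiplies
the result by its own variable. -/
theorem prod_shift_left (n : ℤ) (A B : Fld M) :
    prod n (shift A) B = prod (n + 1) A B + shift (prod n A B) := by
  ext k w
  rw [add_apply, shift_val, prod_val (n + 1), bor_succ]
  simp only [diffOp, LinearMap.sub_apply]
  rw [prod_val n A B, sub_add_cancel, prod_apply, bor_apply, resPlus_apply, resMinus_apply]
  have e1 : ∀ i : ℕ, n - i + 1 = 0 + 1 + n - i := fun i => by ring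
  have e2 : ∀ i : ℕ, (i : ℤ) + 1 = 0 + 1 + i := fun i => by ring
  simp only [shift_val, e1, e2]

theorem prod_shift_right (n : ℤ) (A B : Fld M) : prod n A (shift B) = shift (prod n A B) := by
  ext k w
  simp only [shift_val, prod_apply]
  have e1 : ∀ i : ℕ, k + i + 1 = k + 1 + i := fun i => by ring
  have e2 : ∀ i : ℕ, k + n - i + 1 = k + 1 + n - i := fun i => by ring
  simp only [e1, e2]

theorem ad_prod (x : Module.End ℂ M) (n : ℤ) (A B : Fld M) :
    ad x (prod n A B) = prod n (ad x A) B + prod n A (ad x B) := by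
  ext k w
  simp only [ad_apply, add_apply, prod_apply, map_sub, map_smul]
  have h1 := (((evZero_plus A B (fun i => n - i) k w)).smul (bc n)).map_finsum x.toAddMonoidHom
  have h2 := (((evZero_plus B A (fun i => k + n - i) 0 w)).smul (bc n)).map_finsum x.toAddMonoidHom
  simp only [zero_add, LinearMap.toAddMonoidHom_coe, map_smul] at h1 h2
  rw [h1, h2]
  have g1 := fun v => (evZero_plus A B (fun i => n - i) k v).smul (bc n)
  have g2 := fun v => (evZero_plus B A (fun i => k + n - i) 0 v).smul (bc n)
  have g3 := ((evZero_plus A B (fun i => n - i) k w).map (fun _ => x) fun _ => map_zero x).smul (bc n)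
  have g4 := ((evZero_plus B A (fun i => k + n - i) 0 w).map (fun _ => x) fun _ => map_zero x).smul (bc n)
  have g5 := ((evZero B k w).map (fun i v => A.1 (n - i) (x v)) fun _ => by simp).smul (bc n)
  have g6 := ((evZero A 0 w).map (fun i v => B.1 (k + n - i) (x v)) fun _ => by simp).smul (bc n)
  simp only [zero_add] at g1 g2 g3 g4 g5 g6
  simp only [smul_sub]
  rw [g3.finsum_sub g5, g5.finsum_sub (g1 (x w)), g6.finsum_sub (g2 (x w)), g4.finsum_sub g6]
  module

/-- Integration by parts: differentiate `(y - z)^n` instead of `A`, by `bc_mul_sub` in one expansion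
and `bc_succ_mul` in the other. -/
theorem prod_deriv_left (n : ℤ) (A B : Fld M) :
    prod n (deriv A) B = (-(n : ℂ)) • prod (n - 1) A B := by
  ext k w
  simp only [smul_apply, prod_apply, deriv_apply, map_smul]
  have h1 : ∀ i : ℕ, bc n i • (-((n - i : ℤ) : ℂ)) • A.1 (n - i - 1) (B.1 (k + i) w) =
      (-(n : ℂ)) • bc (n - 1) i • A.1 (n - 1 - i) (B.1 (k + i) w) := by
    intro i
    rw [smul_smul, smul_smul, sub_right_comm]
    congr 1
    have := bc_mul_sub n i
    push_cast
    linear_combination -this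
  have h2 : ∑ᶠ i : ℕ, bc n i • (-((i : ℤ) : ℂ)) • B.1 (k + n - i) (A.1 (i - 1) w) =
      (n : ℂ) • ∑ᶠ i : ℕ, bc (n - 1) i • B.1 (k + (n - 1) - i) (A.1 i w) := by
    have g := (((evZero_plus B A (fun i => k + n - i) (-1) w)).smul (fun i => -((i : ℤ) : ℂ))).smul (bc n)
    have g' := (((evZero_plus B A (fun i => k + (n - 1) - i) 0 w))).smul (bc (n - 1))
    have e1 : ∀ i : ℕ, -1 + (i : ℤ) = i - 1 := fun i => by ring
    simp only [e1] at g
    simp only [zero_add] at g'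
    rw [g.finsum_succ, g'.smul_finsum]
    simp only [Nat.cast_zero, Int.cast_zero, neg_zero, zero_smul, smul_zero, zero_add]
    refine finsum_congr fun i => ?_
    have e2 : k + n - ((i + 1 : ℕ) : ℤ) = k + (n - 1) - i := by push_cast; ring
    have e3 : ((i + 1 : ℕ) : ℤ) - 1 = i := by push_cast; ring
    rw [e2, e3, smul_smul, smul_smul]
    congr 1
    have := bc_succ_mul n i
    push_cast
    linear_combination -this
  have g3 := (((evZero_plus A B (fun i => n - 1 - i) k w))).smul (bc (n - 1))
  simp only [h1]
  rw [h2, ← g3.smul_finsum, show (-1 : ℂ) ^ n = -(-1 : ℂ) ^ (n - 1) by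
    rw [← neg_one_zpow_succ, sub_add_cancel]]
  module

/-- The `z`-derivative hits `B` and `(y - z)^n`; the latter contribution is `prod n (deriv A) B` by
`prod_deriv_left`. -/
theorem deriv_prod (n : ℤ) (A B : Fld M) :
    deriv (prod n A B) = prod n (deriv A) B + prod n A (deriv B) := by
  ext k w
  rw [prod_deriv_left]
  simp only [add_apply, smul_apply, deriv_apply, prod_apply, map_smul]
  have h1 : ∑ᶠ i : ℕ, bc n i • (-((k + i : ℤ) : ℂ)) • A.1 (n - i) (B.1 (k + i - 1) w) =
      (-(k : ℂ)) • ∑ᶠ i : ℕ, bc n i • A.1 (n - i) (B.1 (k - 1 + i) w) +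
      (n : ℂ) • ∑ᶠ i : ℕ, bc (n - 1) i • A.1 (n - 1 - i) (B.1 (k + i) w) := by
    have e1 : ∀ i : ℕ, k + (i : ℤ) - 1 = k - 1 + i := fun i => by ring
    have g := (evZero_plus A B (fun i => n - i) (k - 1) w).smul (bc n)
    have g1 := ((evZero_plus A B (fun i => n - i) (k - 1) w).smul (fun i => (-((i : ℤ) : ℂ)))).smul (bc n)
    have g2 := (evZero_plus A B (fun i => n - 1 - i) k w).smul (bc (n - 1))
    have h : ∀ i : ℕ, bc n i • (-((k + i : ℤ) : ℂ)) • A.1 (n - i) (B.1 (k + i - 1) w) =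
      (-(k : ℂ)) • bc n i • A.1 (n - i) (B.1 (k - 1 + i) w) +
        bc n i • (-((i : ℤ) : ℂ)) • A.1 (n - i) (B.1 (k - 1 + i) w) := by
      intro i; rw [e1]; push_cast; module
    simp only [h]
    rw [(g.smul _).finsum_add g1, ← g.smul_finsum, g1.finsum_succ, g2.smul_finsum]
    simp only [Nat.cast_zero, Int.cast_zero, neg_zero, zero_smul, smul_zero, zero_add]
    congr 1
    refine finsum_congr fun i => ?_
    have e2 : n - ((i + 1 : ℕ) : ℤ) = n - 1 - i := by push_cast; ring
    have e3 : k - 1 + ((i + 1 : ℕ) : ℤ) = k + i := by push_cast; ring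
    rw [e2, e3, smul_smul, smul_smul]
    congr 1
    have := bc_succ_mul n i
    push_cast
    linear_combination -this
  have h2 : ∑ᶠ i : ℕ, bc n i • (-((k + n - i : ℤ) : ℂ)) • B.1 (k + n - i - 1) (A.1 i w) =
      (-(k : ℂ)) • ∑ᶠ i : ℕ, bc n i • B.1 (k - 1 + n - i) (A.1 i w) -
      (n : ℂ) • ∑ᶠ i : ℕ, bc (n - 1) i • B.1 (k + (n - 1) - i) (A.1 i w) := by
    have g := (evZero_plus B A (fun i => k - 1 + n - i) 0 w).smul (bc n)
    have g2 := (evZero_plus B A (fun i => k + (n - 1) - i) 0 w).smul (bc (n - 1))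
    simp only [zero_add] at g g2
    rw [g.smul_finsum, g2.smul_finsum, ← (g.smul _).finsum_sub (g2.smul _)]
    refine finsum_congr fun i => ?_
    have e1 : k + n - (i : ℤ) - 1 = k - 1 + n - i := by ring
    have e2 : k + (n - 1) - (i : ℤ) = k - 1 + n - i := by ring
    rw [e1, e2, smul_smul, smul_smul, smul_smul, ← sub_smul]
    congr 1
    have := bc_mul_sub n i
    push_cast
    linear_combination -this
  rw [h1, h2, show (-1 : ℂ) ^ n = -(-1 : ℂ) ^ (n - 1) by rw [← neg_one_zpow_succ, sub_add_cancel]]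
  module

theorem one_prod (n : ℤ) (C : Fld M) : prod n one C = if n = -1 then C else 0 := by
  ext k w
  have e1 : ∀ i : ℕ, (i : ℤ) ≠ -1 := fun i => by omega
  simp only [prod_apply, one_apply, e1, if_false, map_zero, smul_zero, finsum_zero, sub_zero]
  split_ifs with h
  · subst h
    rw [finsum_eq_range (K := 1)]
    · simp [bc_zero_right]
    · intro i hi; rw [if_neg (by omega), smul_zero]
  · rw [finsum_eq_zero_of_forall_eq_zero]
    · rfl
    intro i
    split_ifs with hi
    -- Only the mode `-1` of `one` is nonzero. If `n - i = -1` with `n ≠ -1`, then `n ≥ 0` and `i =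
    -- n + 1` lies just past the last nonzero binomial coefficient.
    · obtain ⟨m, rfl⟩ : ∃ m : ℕ, n = m := ⟨n.toNat, by omega⟩
      obtain rfl : i = m + 1 := by omega
      rw [bc_nat_succ, zero_smul]
    · rw [smul_zero]

theorem prod_one_nonneg (n : ℕ) (A : Fld M) : prod n A one = 0 := by
  apply Subtype.ext
  funext k
  rw [prod_val, bor_nat]
  have : comm A one = 0 := by
    funext l k; ext w; simp only [comm, one]; split_ifs <;> simp
  rw [this, diffOp_iterate_zero]; rfl

theorem prod_one_neg_one (A : Fld M) : prod (-1) A one = A := by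
  ext k w
  simp only [prod_apply, one_apply, bc_neg_one, one_smul]
  have h1 : ∀ x : ℤ, A.1 x (if k + (-1 - x) = -1 then w else 0) = if x = k then A.1 k w else 0 := by
    intro x
    split_ifs with h h' h'
    · rw [h']
    · omega
    · omega
    · simp
  have h2 : ∀ i : ℕ, A.1 (-1 - i) (if k + i = -1 then w else 0) = if (-1 - (i : ℤ)) = k then A.1 k w else 0 := by
    intro i; rw [← h1]; congr 2; ring_nf
  simp only [h2]
  rw [zpow_neg_one, show ((-1 : ℂ))⁻¹ = -1 by norm_num]
  -- The first expansion of `(y - z)^(-1)` recovers the modes with `k < 0`, the second those with `k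
  -- ≥ 0`.
  rcases lt_or_ge k 0 with hk | hk
  · obtain ⟨m, rfl⟩ : ∃ m : ℕ, k = -1 - m := ⟨(-1 - k).toNat, by omega⟩
    rw [finsum_eq_single _ m, if_pos rfl, finsum_eq_zero_of_forall_eq_zero]
    · simp
    · intro i; rw [if_neg (by omega)]
    · intro i hi; rw [if_neg (by omega)]
  · obtain ⟨m, rfl⟩ : ∃ m : ℕ, k = m := ⟨k.toNat, by omega⟩
    rw [finsum_eq_single (fun i : ℕ => if (m : ℤ) + -1 - i = -1 then A.1 i w else 0) m,
      if_pos (by ring), finsum_eq_zero_of_forall_eq_zero]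
    · simp
    · intro i; rw [if_neg (by omega)]
    · intro i hi; rw [if_neg (by omega)]

end Fld

/-! ### Locality, the commutator formula and Dong's lemma -/

namespace Fld

variable {M : Type} [AddCommGroup M] [Module ℂ M]

/-! ### The commutator of two left multiplications as a double expansion -/

/-- Truncation of two-variable coefficients in the quadrant of nonnegative modes. -/
def Adm (b : ℤ → ℤ → Module.End ℂ M) : Prop :=
  ∀ w, ∃ K : ℕ, ∀ l k : ℕ, (K ≤ l ∨ K ≤ k) → b l k w = 0

theorem adm_diffOp {b : ℤ → ℤ → Module.End ℂ M} (hb : Adm b) : Adm (diffOp b) := by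
  intro w
  obtain ⟨K, hK⟩ := hb w
  refine ⟨K, fun l k h => ?_⟩
  have h1 := hK (l + 1) k (by omega)
  have h2 := hK l (k + 1) (by omega)
  push_cast at h1 h2
  simp [diffOp, h1, h2]

theorem adm_comm (A B : Fld M) : Adm (comm A B) := by
  intro w
  obtain ⟨K1, h1⟩ := trunc_comp A B w 0
  obtain ⟨K2, h2⟩ := trunc_comp B A w 0
  obtain ⟨J1, h3⟩ := A.2 w
  obtain ⟨J2, h4⟩ := B.2 w
  refine ⟨K1 + K2 + J1.toNat + J2.toNat, fun l k h => ?_⟩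
  simp only [comm, LinearMap.sub_apply, Module.End.mul_apply]
  rcases h with h | h
  · rw [(h1 l (by omega) k).2, h3 l (by omega), map_zero, sub_zero]
  · rw [(h2 k (by omega) l).2, h4 k (by omega), map_zero, sub_zero]

/-- The part of the double expansion where both fields act from the left. -/
noncomputable def dblPlus (b : ℤ → ℤ → Module.End ℂ M) (C : Fld M) (m q k : ℤ) (w : M) : M :=
  ∑ᶠ i : ℕ, bc m i • ∑ᶠ j : ℕ, bc q j • b (m - i) (q - j) (C.1 (k + i + j) w)

/-- The part of the double expansion where both fields act from the right. -/
noncomputable def dblMinus (b : ℤ → ℤ → Module.End ℂ M) (C : Fld M) (m q k : ℤ) (w : M) : M :=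
  ∑ᶠ i : ℕ, bc m i • ∑ᶠ j : ℕ, bc q j • C.1 (k + m + q - i - j) (b i j w)

/-- The coefficients of the commutator of two left multiplications, expressed through the commutator
`b` of the fields. -/
noncomputable def dbl (b : ℤ → ℤ → Module.End ℂ M) (C : Fld M) (m q k : ℤ) (w : M) : M :=
  dblPlus b C m q k w - (-1 : ℂ) ^ (m + q) • dblMinus b C m q k w

theorem evZero_dblPlus (b : ℕ → ℕ → Module.End ℂ M) (C : Fld M) (q k : ℤ) (w : M) :
    EvZero fun i : ℕ => ∑ᶠ j : ℕ, bc q j • b i j (C.1 (k + i + j) w) := by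
  obtain ⟨K, hK⟩ := C.2 w
  refine ⟨(K - k).toNat, fun i hi => finsum_eq_zero_of_forall_eq_zero fun j => ?_⟩
  rw [hK _ (by omega), map_zero, smul_zero]

/-- `(x - z) - (y - z) = x - y`: after `finsum_bc_succ` in each variable, the terms carrying the
factor `z` cancel. -/
theorem dblPlus_diffOp (b : ℤ → ℤ → Module.End ℂ M) (C : Fld M) (m q k : ℤ) (w : M) :
    dblPlus b C (m + 1) q k w - dblPlus b C m (q + 1) k w = dblPlus (diffOp b) C m q k w := by
  have hi : ∀ i : ℕ, ∑ᶠ j : ℕ, bc (q + 1) j • b (m - i) (q + 1 - j) (C.1 (k + i + j) w) =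
      ∑ᶠ j : ℕ, bc q j • b (m - i) (q + 1 - j) (C.1 (k + i + j) w) -
      ∑ᶠ j : ℕ, bc q j • b (m + 1 - (i + 1 : ℕ)) (q - j) (C.1 (k + (i + 1 : ℕ) + j) w) := by
    intro i
    rw [finsum_bc_succ ((evZero C (k + i) w).map (fun j v => b (m - i) (q + 1 - j) v) (by simp))]
    congr 1
    refine finsum_congr fun j => ?_
    rw [show m - (i : ℤ) = m + 1 - (i + 1 : ℕ) by push_cast; ring,
      show q + 1 - ((j + 1 : ℕ) : ℤ) = q - j by push_cast; ring,
      show k + i + ((j + 1 : ℕ) : ℤ) = k + (i + 1 : ℕ) + j by push_cast; ring]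
  have hd : ∀ i : ℕ, ∑ᶠ j : ℕ, bc q j • diffOp b (m - i) (q - j) (C.1 (k + i + j) w) =
      ∑ᶠ j : ℕ, bc q j • b (m + 1 - i) (q - j) (C.1 (k + i + j) w) -
      ∑ᶠ j : ℕ, bc q j • b (m - i) (q + 1 - j) (C.1 (k + i + j) w) := by
    intro i
    rw [← EvZero.finsum_sub
      (((evZero C (k + i) w).map (fun j v => b (m + 1 - i) (q - j) v) (by simp)).smul _)
      (((evZero C (k + i) w).map (fun j v => b (m - i) (q + 1 - j) v) (by simp)).smul _)]
    refine finsum_congr fun j => ?_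
    rw [diffOp, LinearMap.sub_apply, smul_sub, sub_add_eq_add_sub, sub_add_eq_add_sub]
  have g1 := evZero_dblPlus (fun i j => b (m + 1 - i) (q - j)) C q k w
  have g2 := evZero_dblPlus (fun i j => b (m - i) (q + 1 - j)) C q k w
  simp only [dblPlus, hi, hd, smul_sub]
  rw [finsum_bc_succ g1, (g2.smul _).finsum_sub (g1.succ.smul _), (g1.smul _).finsum_sub (g2.smul _)]
  abel

theorem evZero_dblMinus {b : ℤ → ℤ → Module.End ℂ M} (hb : Adm b) (C : Fld M) (e : ℕ → ℕ → ℤ) (q : ℤ)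
    (w : M) (s t : ℕ) :
    EvZero (fun i : ℕ => ∑ᶠ j : ℕ, bc q j • C.1 (e i j) (b (i + s : ℕ) (j + t : ℕ) w)) ∧
    ∀ i : ℕ, EvZero fun j : ℕ => C.1 (e i j) (b (i + s : ℕ) (j + t : ℕ) w) := by
  obtain ⟨K, hK⟩ := hb w
  refine ⟨⟨K, fun i hi => finsum_eq_zero_of_forall_eq_zero fun j => ?_⟩, fun i => ⟨K, fun j hj => ?_⟩⟩
  · rw [hK _ _ (Or.inl (by omega)), map_zero, smul_zero]
  · dsimp only
    rw [hK _ _ (Or.inr (by omega)), map_zero]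

/-- Here the kernels are powers of `z - x` and `z - y`, and `(z - y) - (z - x) = x - y`, whence the
opposite order on the left. Since `b` acts first, finiteness of the sums needs `Adm b`. -/
theorem dblMinus_diffOp {b : ℤ → ℤ → Module.End ℂ M} (hb : Adm b) (C : Fld M) (m q k : ℤ) (w : M) :
    dblMinus b C m (q + 1) k w - dblMinus b C (m + 1) q k w = dblMinus (diffOp b) C m q k w := by
  obtain ⟨p1, p2⟩ := evZero_dblMinus hb C (fun i j => k + m + q + 1 - i - j) q w 0 0
  obtain ⟨p3, p4⟩ := evZero_dblMinus hb C (fun i j => k + m + q - i - j) q w 0 1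
  obtain ⟨p5, p6⟩ := evZero_dblMinus hb C (fun i j => k + m + q - i - j) q w 1 0
  simp only [add_zero] at p1 p2 p3 p4 p5 p6
  have hi : ∀ i : ℕ, ∑ᶠ j : ℕ, bc (q + 1) j • C.1 (k + m + (q + 1) - i - j) (b i j w) =
      ∑ᶠ j : ℕ, bc q j • C.1 (k + m + q + 1 - i - j) (b i j w) -
      ∑ᶠ j : ℕ, bc q j • C.1 (k + m + q - i - j) (b i (j + 1 : ℕ) w) := by
    intro i
    rw [← finsum_congr (fun j => by rw [← add_assoc]), finsum_bc_succ (p2 i)]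
    congr 1
    refine finsum_congr fun j => ?_
    rw [show k + m + q + 1 - i - ((j + 1 : ℕ) : ℤ) = k + m + q - i - j by push_cast; ring]
  have hd : ∀ i : ℕ, ∑ᶠ j : ℕ, bc q j • C.1 (k + m + q - i - j) (diffOp b i j w) =
      ∑ᶠ j : ℕ, bc q j • C.1 (k + m + q - i - j) (b (i + 1 : ℕ) j w) -
      ∑ᶠ j : ℕ, bc q j • C.1 (k + m + q - i - j) (b i (j + 1 : ℕ) w) := by
    intro i
    rw [← EvZero.finsum_sub ((p6 i).smul _) ((p4 i).smul _)]
    refine finsum_congr fun j => ?_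
    rw [diffOp, LinearMap.sub_apply, map_sub, smul_sub]
    push_cast; rfl
  have ho : ∑ᶠ i : ℕ, bc (m + 1) i • ∑ᶠ j : ℕ, bc q j • C.1 (k + (m + 1) + q - i - j) (b i j w) =
      ∑ᶠ i : ℕ, bc m i • ∑ᶠ j : ℕ, bc q j • C.1 (k + m + q + 1 - i - j) (b i j w) -
      ∑ᶠ i : ℕ, bc m i • ∑ᶠ j : ℕ, bc q j • C.1 (k + m + q - i - j) (b (i + 1 : ℕ) j w) := by
    have e : k + (m + 1) + q = k + m + q + 1 := by ring
    rw [e, finsum_bc_succ p1]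
    congr 1
    refine finsum_congr fun i => ?_
    congr 1
    refine finsum_congr fun j => ?_
    rw [show k + m + q + 1 - ((i + 1 : ℕ) : ℤ) - j = k + m + q - i - j by push_cast; ring]
  simp only [dblMinus, hi, hd, ho, smul_sub]
  rw [(p1.smul _).finsum_sub (p3.smul _), (p5.smul _).finsum_sub (p3.smul _)]
  abel

/-- So `dbl` carries multiplication by `x - y` on the commutator to `diffOp` in the exponents;
`HasOPE.prod_comm` iterates this. -/
theorem dbl_diffOp {b : ℤ → ℤ → Module.End ℂ M} (hb : Adm b) (C : Fld M) (m q k : ℤ) (w : M) :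
    dbl b C (m + 1) q k w - dbl b C m (q + 1) k w = dbl (diffOp b) C m q k w := by
  rw [dbl, dbl, dbl, ← dblPlus_diffOp, ← dblMinus_diffOp hb, add_right_comm m 1 q,
    ← add_assoc m q 1, neg_one_zpow_succ]
  module

theorem dbl_eq_range {b : ℤ → ℤ → Module.End ℂ M} {C : Fld M} {m q k : ℤ} {w : M} {K : ℕ}
    (h1 : ∀ x : ℕ, K ≤ x → C.1 (k + x) w = 0) (h2 : ∀ l k : ℕ, (K ≤ l ∨ K ≤ k) → b l k w = 0) :
    dbl b C m q k w = ∑ i ∈ Finset.range K, ∑ j ∈ Finset.range K, (bc m i * bc q j) •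
      (b (m - i) (q - j) (C.1 (k + i + j) w) -
        (-1 : ℂ) ^ (m + q) • C.1 (k + m + q - i - j) (b i j w)) := by
  have e1 : dblPlus b C m q k w = ∑ i ∈ Finset.range K, ∑ j ∈ Finset.range K, (bc m i * bc q j) •
      b (m - i) (q - j) (C.1 (k + i + j) w) := by
    have hz : ∀ i j : ℕ, (K ≤ i ∨ K ≤ j) → C.1 (k + i + j) w = 0 := fun i j h => by
      have := h1 (i + j) (by omega)
      rwa [Nat.cast_add, ← add_assoc] at this
    rw [dblPlus, finsum_eq_range (K := K)]
    · refine Finset.sum_congr rfl fun i _ => ?_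
      rw [finsum_eq_range (K := K), Finset.smul_sum]
      · exact Finset.sum_congr rfl fun j _ => smul_smul _ _ _
      · intro j hj; rw [hz i j (Or.inr hj), map_zero, smul_zero]
    · intro i hi
      rw [finsum_eq_zero_of_forall_eq_zero, smul_zero]
      intro j; rw [hz i j (Or.inl hi), map_zero, smul_zero]
  have e2 : dblMinus b C m q k w = ∑ i ∈ Finset.range K, ∑ j ∈ Finset.range K, (bc m i * bc q j) •
      C.1 (k + m + q - i - j) (b i j w) := by
    rw [dblMinus, finsum_eq_range (K := K)]
    · refine Finset.sum_congr rfl fun i _ => ?_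
      rw [finsum_eq_range (K := K), Finset.smul_sum]
      · exact Finset.sum_congr rfl fun j _ => smul_smul _ _ _
      · intro j hj; rw [h2 i j (Or.inr hj), map_zero, smul_zero]
    · intro i hi
      rw [finsum_eq_zero_of_forall_eq_zero, smul_zero]
      intro j; rw [h2 i j (Or.inl hi), map_zero, smul_zero]
  rw [dbl, e1, e2, Finset.smul_sum, ← Finset.sum_sub_distrib]
  refine Finset.sum_congr rfl fun i _ => ?_
  rw [Finset.smul_sum, ← Finset.sum_sub_distrib]
  refine Finset.sum_congr rfl fun j _ => ?_
  module

theorem prod_eq_range {A C : Fld M} {n k : ℤ} {w : M} {K : ℕ}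
    (h1 : ∀ i : ℕ, K ≤ i → A.1 (n - i) (C.1 (k + i) w) = 0)
    (h2 : ∀ i : ℕ, K ≤ i → C.1 (k + n - i) (A.1 i w) = 0) :
    (prod n A C).1 k w = ∑ i ∈ Finset.range K, bc n i •
      (A.1 (n - i) (C.1 (k + i) w) - (-1 : ℂ) ^ n • C.1 (k + n - i) (A.1 i w)) := by
  rw [prod_apply, finsum_eq_range (K := K), finsum_eq_range (K := K), Finset.smul_sum,
    ← Finset.sum_sub_distrib]
  · exact Finset.sum_congr rfl fun i _ => by module
  · intro i hi; rw [h2 i hi, smul_zero]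
  · intro i hi; rw [h1 i hi, smul_zero]

/-- All four kinds of terms on one square of indices, for every large `K`: the two iterated products
can then be subtracted term by term. -/
theorem prod_prod_eq_range (A B C : Fld M) (m q k : ℤ) (w : M) : ∃ K₀ : ℕ, ∀ K ≥ K₀,
    (prod m A (prod q B C)).1 k w = ∑ i ∈ Finset.range K, ∑ j ∈ Finset.range K, (bc m i * bc q j) •
      (A.1 (m - i) (B.1 (q - j) (C.1 (k + i + j) w))
        - (-1 : ℂ) ^ q • A.1 (m - i) (C.1 (k + i + q - j) (B.1 j w))
        - (-1 : ℂ) ^ m • B.1 (q - j) (C.1 (k + m - i + j) (A.1 i w))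
        + (-1 : ℂ) ^ (m + q) • C.1 (k + m + q - i - j) (B.1 j (A.1 i w))) := by
  obtain ⟨Jc, hJc⟩ := C.2 w
  obtain ⟨Jb, hJb⟩ := B.2 w
  obtain ⟨Ja, hJa⟩ := A.2 w
  obtain ⟨K1, hK1⟩ := trunc_comp C B w (k + q)
  obtain ⟨K2, hK2⟩ := trunc_comp C A w (k + m)
  obtain ⟨K3, hK3⟩ := trunc_comp B A w 0
  obtain ⟨K4, hK4⟩ := (prod q B C).2 w
  refine ⟨(Jc - k).toNat + Jb.toNat + Ja.toNat + K1 + K2 + K3 + (K4 - k).toNat, fun K hK => ?_⟩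
  rw [prod_eq_range (K := K)]
  · refine Finset.sum_congr rfl fun i _ => ?_
    have e1 : (prod q B C).1 (k + i) w = ∑ j ∈ Finset.range K, bc q j •
        (B.1 (q - j) (C.1 (k + i + j) w) - (-1 : ℂ) ^ q • C.1 (k + i + q - j) (B.1 j w)) := by
      apply prod_eq_range
      · intro j hj; rw [hJc _ (by omega), map_zero]
      · intro j hj; rw [hJb _ (by omega), map_zero]
    have e2 : (prod q B C).1 (k + m - i) (A.1 i w) = ∑ j ∈ Finset.range K, bc q j •
        (B.1 (q - j) (C.1 (k + m - i + j) (A.1 i w)) -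
          (-1 : ℂ) ^ q • C.1 (k + m - i + q - j) (B.1 j (A.1 i w))) := by
      apply prod_eq_range
      · intro j hj
        rw [show k + m - i + (j : ℤ) = k + m + j - i by ring, (hK2 j (by omega) i).1, map_zero]
      · intro j hj; rw [(hK3 j (by omega) i).2, map_zero]
    rw [e1, e2, map_sum, Finset.smul_sum, ← Finset.sum_sub_distrib, Finset.smul_sum]
    refine Finset.sum_congr rfl fun j _ => ?_
    rw [map_smul, map_sub, map_smul, show k + m - (i : ℤ) + q - j = k + m + q - i - j by ring,
      zpow_add₀ (by norm_num : (-1 : ℂ) ≠ 0)]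
    module
  · intro i hi; rw [hK4 _ (by omega), map_zero]
  · intro i hi; rw [hJa _ (by omega), map_zero]

/-- The mixed terms, with `C` between `A` and `B`, cancel in the difference; in what remains `A` and
`B` are adjacent, both to the left or both to the right of `C`. -/
theorem dbl_comm (A B C : Fld M) (m q k : ℤ) (w : M) :
    dbl (comm A B) C m q k w =
      (prod m A (prod q B C) - prod q B (prod m A C)).1 k w := by
  obtain ⟨K1, h1⟩ := prod_prod_eq_range A B C m q k w
  obtain ⟨K2, h2⟩ := prod_prod_eq_range B A C q m k w
  obtain ⟨K3, h3⟩ := adm_comm A B w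
  obtain ⟨J, hJ⟩ := C.2 w
  set K := K1 + K2 + K3 + (J - k).toNat with hK
  rw [sub_apply, h1 K (by omega), h2 K (by omega),
    dbl_eq_range (K := K) (fun x hx => hJ _ (by omega)) (fun l k h => h3 l k (by omega)),
    Finset.sum_comm (s := Finset.range K) (t := Finset.range K)
      (f := fun i j => (bc q i * bc m j) •
      (B.1 (q - i) (A.1 (m - j) (C.1 (k + i + j) w))
        - (-1 : ℂ) ^ m • B.1 (q - i) (C.1 (k + i + m - j) (A.1 j w))
        - (-1 : ℂ) ^ q • A.1 (m - j) (C.1 (k + q - i + j) (B.1 i w))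
        + (-1 : ℂ) ^ (q + m) • C.1 (k + q + m - i - j) (A.1 j (B.1 i w)))), ← Finset.sum_sub_distrib]
  refine Finset.sum_congr rfl fun i _ => ?_
  rw [← Finset.sum_sub_distrib]
  refine Finset.sum_congr rfl fun j _ => ?_
  have e1 : k + j + (i : ℤ) = k + i + j := by ring
  have e2 : k + j + m - (i : ℤ) = k + m - i + j := by ring
  have e3 : k + q - j + (i : ℤ) = k + i + q - j := by ring
  have e4 : k + q + m - j - (i : ℤ) = k + m + q - i - j := by ring
  rw [e1, e2, e3, e4, add_comm q m]
  simp only [comm, LinearMap.sub_apply, Module.End.mul_apply, map_sub]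
  module

/-- For exponent `0` the outer sum reduces to `i = 0`, leaving a residue product with the row `l =
0` of `b`. -/
theorem dbl_zero_left (b : ℤ → ℤ → Module.End ℂ M) (C D : Fld M) (q k : ℤ) (w : M)
    (hD : ∀ k, D.1 k = b 0 k) : dbl b C 0 q k w = (prod q D C).1 k w := by
  rw [dbl, dblPlus, dblMinus, finsum_bc_zero, finsum_bc_zero, prod_apply]
  simp only [hD, Nat.cast_zero, sub_zero, add_zero, zero_add]

/-! ### Operator product expansions, the commutator formula and the Borcherds identity -/

/-- The commutator of two fields has the finite expansion with coefficients `F i`. -/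
def HasOPE (A B : Fld M) (N : ℕ) (F : ℕ → Fld M) : Prop :=
  ∀ l k, comm A B l k = ∑ i ∈ Finset.range N, (Ring.choose l i : ℤ) • (F i).1 (l + k - i)

/-- Mutual locality of two fields. -/
def Local (A B : Fld M) : Prop := ∃ N : ℕ, diffOp^[N] (comm A B) = 0

theorem HasOPE.diffOp_eq_zero {A B : Fld M} {N : ℕ} {F : ℕ → Fld M} (h : HasOPE A B N F) :
    diffOp^[N] (comm A B) = 0 :=
  (diffOp_iterate_of_expansion (F := fun i => (F i).1) h).1

theorem HasOPE.isLocal {A B : Fld M} {N : ℕ} {F : ℕ → Fld M} (h : HasOPE A B N F) : Local A B :=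
  ⟨N, h.diffOp_eq_zero⟩

theorem HasOPE.prod_eq {A B : Fld M} {N : ℕ} {F : ℕ → Fld M} (h : HasOPE A B N F) {i : ℕ}
    (hi : i < N) : prod i A B = F i := by
  apply Subtype.ext
  funext k
  rw [prod_val, bor_nat, (diffOp_iterate_of_expansion (F := fun i => (F i).1) h).2 i hi k]

theorem hasOPE_of_diffOp {A B : Fld M} {N : ℕ} (h : diffOp^[N] (comm A B) = 0) :
    HasOPE A B N fun i => prod i A B := by
  intro l k
  rw [diffOp_taylor h]
  exact Finset.sum_congr rfl fun i _ => by rw [prod_val, bor_nat]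

/-- The commutator formula for left multiplications by mutually local fields. -/
theorem HasOPE.prod_comm {A B : Fld M} {N : ℕ} {F : ℕ → Fld M} (h : HasOPE A B N F) (C : Fld M)
    (p q : ℤ) : prod p A (prod q B C) - prod q B (prod p A C) =
      ∑ i ∈ Finset.range N, (Ring.choose p i : ℤ) • prod (p + q - i) (F i) C := by
  set H : ℤ → ℤ → Fld M := fun p q => prod p A (prod q B C) - prod q B (prod p A C) with hH
  have hadm : ∀ n, Adm (diffOp^[n] (comm A B)) := by
    intro n
    induction n with
    | zero => exact adm_comm A B
    | succ n ih => rw [Function.iterate_succ_apply']; exact adm_diffOp ih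
  -- `H` inherits from the commutator of `A` and `B` that `diffOp^[N]` kills it, so `diffOp_taylor`
  -- applies in the exponents and its coefficients are read off at `p = 0`. Locality with `C` plays
  -- no role.
  have key : ∀ n p q k w, ((diffOp^[n] H) p q).1 k w = dbl (diffOp^[n] (comm A B)) C p q k w := by
    intro n
    induction n with
    | zero => intro p q k w; exact (dbl_comm A B C p q k w).symm
    | succ n ih =>
      intro p q k w
      rw [Function.iterate_succ_apply', Function.iterate_succ_apply', ← dbl_diffOp (hadm n), ← ih,
        ← ih]
      rfl
  have hexp := diffOp_iterate_of_expansion (F := fun i => (F i).1) h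
  have hN : diffOp^[N] H = 0 := by
    funext p q
    ext k w
    rw [key, hexp.1]
    simp [dbl, dblPlus, dblMinus]
  have := diffOp_taylor hN p q
  rw [show prod p A (prod q B C) - prod q B (prod p A C) = H p q from rfl, this]
  refine Finset.sum_congr rfl fun i hi => ?_
  congr 1
  ext k w
  rw [key, dbl_zero_left _ C (F i)]
  intro k
  rw [hexp.2 i (Finset.mem_range.mp hi) k]

theorem Local.symm {A B : Fld M} (h : Local A B) : Local B A := by
  obtain ⟨N, hN⟩ := h
  refine ⟨N, ?_⟩
  rw [comm_swap, diffOp_iterate_neg, diffOp_iterate_swap, hN]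
  funext l k; simp

theorem Local.bor_eq_zero {A B : Fld M} {N : ℕ} (h : diffOp^[N] (comm A B) = 0) {r : ℤ}
    (hr : N ≤ r) : bor A B r = 0 := by
  obtain ⟨m, rfl⟩ : ∃ m : ℕ, r = m := ⟨r.toNat, by omega⟩
  rw [bor_nat]
  exact diffOp_iterate_eq_zero_of_le h (by omega)

/-- The Borcherds identity for mutually local fields. -/
theorem Local.bor_eq {A B : Fld M} (h : Local A B) (p q r : ℤ) (w : M) :
    ∑ᶠ i : ℕ, ((Ring.choose p i : ℤ) : ℂ) • (prod (r + i) A B).1 (p + q - i) w =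
      bor A B r p q w := by
  obtain ⟨N, hN⟩ := h
  have hz : ∀ i : ℕ, (N - r).toNat ≤ i → bor A B (r + i) = 0 := fun i hi =>
    Local.bor_eq_zero hN (by omega)
  -- Even for negative `r`, enough factors `x - z` raise the exponent to where locality gives zero.
  -- The Taylor coefficients of `bor A B r` are then the products of index `r + i`.
  have h1 : diffOp^[(N - r).toNat] (bor A B r) = 0 := by
    rw [← bor_add_nat]; exact hz _ le_rfl
  rw [diffOp_taylor h1 p q, finsum_eq_range (K := (N - r).toNat), LinearMap.sum_apply]
  · refine Finset.sum_congr rfl fun i _ => ?_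
    rw [prod_val, bor_add_nat, LinearMap.smul_apply, Int.cast_smul_eq_zsmul]
  · intro i hi
    rw [prod_val, hz i hi]; simp

theorem local_one (A : Fld M) : Local A one := by
  refine ⟨0, ?_⟩
  funext l k; ext w; simp only [Function.iterate_zero, id, comm, one]; split_ifs <;> simp

/-! ### Locality of residue products -/

section Dong

/-- Multiplication by the difference of the two variables, on families of fields. -/
def diffFld : Module.End ℂ (ℤ → Fld M) where
  toFun φ l := φ (l + 1) - shift (φ l)
  map_add' φ ψ := by funext l; simp; abel
  map_smul' c φ := by funext l; simp [smul_sub]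

theorem diffFld_apply (φ : ℤ → Fld M) (l : ℤ) : diffFld φ l = φ (l + 1) - shift (φ l) := rfl

/-- The family of commutators of the modes of `C` with the field `A`. -/
def adFld (C : Fld M) : Fld M →ₗ[ℂ] (ℤ → Fld M) := LinearMap.pi fun l => ad (C.1 l)

theorem adFld_apply (C A : Fld M) (l : ℤ) : adFld C A l = ad (C.1 l) A := rfl

/-- Viewing the commutator series as a family of fields indexed by `l` lets linear operations on
fields be applied to it. -/
theorem diffFld_pow_val (C A : Fld M) (n : ℕ) (l k : ℤ) :
    ((diffFld ^ n) (adFld C A) l).1 k = (diffOp^[n] (comm C A)) l k := by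
  induction n generalizing l k with
  | zero => rfl
  | succ n ih =>
    rw [pow_succ', Module.End.mul_apply, diffFld_apply, Function.iterate_succ_apply', diffOp, ← ih,
      ← ih]
    rfl

theorem diffFld_pow_eq_zero {C A : Fld M} {n : ℕ} :
    (diffFld ^ n) (adFld C A) = 0 ↔ diffOp^[n] (comm C A) = 0 := by
  constructor
  · intro h
    funext l k
    rw [← diffFld_pow_val, h]; rfl
  · intro h
    funext l
    apply Subtype.ext
    funext k
    rw [diffFld_pow_val, h]; rfl

theorem diffFld_pow_comp (f : Fld M →ₗ[ℂ] Fld M) (hf : ∀ A, f (shift A) = shift (f A)) (n : ℕ)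
    (φ : ℤ → Fld M) (l : ℤ) : (diffFld ^ n) (fun l => f (φ l)) l = f ((diffFld ^ n) φ l) := by
  induction n generalizing l with
  | zero => rfl
  | succ n ih =>
    rw [pow_succ', Module.End.mul_apply, Module.End.mul_apply, diffFld_apply, diffFld_apply, ih, ih,
      map_sub, hf]

theorem diffFld_pow_translate (n : ℕ) (φ : ℤ → Fld M) (l : ℤ) :
    (diffFld ^ n) (fun l => φ (l + 1)) l = (diffFld ^ n) φ (l + 1) := by
  induction n generalizing l with
  | zero => rfl
  | succ n ih =>
    rw [pow_succ', Module.End.mul_apply, Module.End.mul_apply, diffFld_apply, diffFld_apply, ih, ih]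

theorem adFld_shift (C A : Fld M) : adFld C (shift A) = fun l => shift (adFld C A l) := rfl

/-- The commutator of `C(x)` with the `n`-th product of `A(y)` and `B(z)`, multiplied by
`(x - y)^t`. -/
noncomputable def dongAux (C B : Fld M) (n : ℤ) : ℕ → Fld M → ℤ → Fld M
  | 0, A, l => ad (C.1 l) (prod n A B)
  | t + 1, A, l => dongAux C B n t A (l + 1) - dongAux C B n t (shift A) l

theorem dongAux_shift (C B : Fld M) (n : ℤ) (t : ℕ) (A : Fld M) (l : ℤ) :
    dongAux C B n t (shift A) l = dongAux C B (n + 1) t A l + shift (dongAux C B n t A l) := by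
  induction t generalizing A l with
  | zero =>
    simp only [dongAux]
    rw [prod_shift_left, map_add]; rfl
  | succ t ih =>
    simp only [dongAux]
    rw [ih, ih (shift A), ih A l, map_sub]
    abel

/-- `x - z = (x - y) + (y - z)`: the first summand raises `t`, the second raises `n`. This drives
the induction in Dong's lemma. -/
theorem diffFld_dongAux (C B : Fld M) (n : ℤ) (t : ℕ) (A : Fld M) :
    diffFld (dongAux C B n t A) = dongAux C B n (t + 1) A + dongAux C B (n + 1) t A := by
  funext l
  rw [Pi.add_apply, diffFld_apply, dongAux, dongAux_shift]
  abel

theorem dongAux_eq_zero {C A B : Fld M} {n : ℤ} (h : ∀ j : ℕ, prod n (shift^[j] A) B = 0) (t : ℕ) :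
    dongAux C B n t A = 0 := by
  induction t generalizing A with
  | zero =>
    funext l
    have := h 0
    rw [Function.iterate_zero, id] at this
    rw [dongAux, this, map_zero]; rfl
  | succ t ih =>
    funext l
    rw [dongAux, ih h, ih (A := shift A)]
    · simp
    · intro j; rw [← Function.iterate_succ_apply]; exact h (j + 1)

theorem diffOp_comm_shift {A B : Fld M} {N : ℕ} (h : diffOp^[N] (comm A B) = 0) :
    diffOp^[N] (comm (shift A) B) = 0 := by
  have : ∀ n, diffOp^[n] (comm (shift A) B) = fun l k => (diffOp^[n] (comm A B)) (l + 1) k := by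
    intro n
    induction n with
    | zero => rfl
    | succ n ih => rw [Function.iterate_succ_apply', ih, Function.iterate_succ_apply']; rfl
  rw [this, h]; rfl

/-- By `ad_prod` the commutator splits into a part with `[C, A]` and a part with `[C, B]`. The
subtracted term is the first part times `(x - y)^t`; the second is killed by `(x - z)^N`. -/
theorem diffFld_pow_dongAux {C B : Fld M} {N : ℕ} (h : (diffFld ^ N) (adFld C B) = 0) (n : ℤ) (t : ℕ)
    (A : Fld M) :
    (diffFld ^ N) (fun l => dongAux C B n t A l - (prod n).flip B ((diffFld ^ t) (adFld C A) l)) = 0 := by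
  induction t generalizing A with
  | zero =>
    have : (fun l => dongAux C B n 0 A l - (prod n).flip B ((diffFld ^ 0) (adFld C A) l)) =
        fun l => prod n A (adFld C B l) := by
      funext l
      simp only [dongAux, pow_zero, Module.End.one_apply, adFld_apply, LinearMap.flip_apply]
      rw [ad_prod, add_sub_cancel_left]
    rw [this]
    funext l
    rw [diffFld_pow_comp (prod n A) (prod_shift_right n A), h]
    simp
  | succ t ih =>
    have e : (fun l => dongAux C B n (t + 1) A l -
          (prod n).flip B ((diffFld ^ (t + 1)) (adFld C A) l)) =
        (fun l => (fun l => dongAux C B n t A l - (prod n).flip B ((diffFld ^ t) (adFld C A) l)) (l + 1)) -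
        (fun l => dongAux C B n t (shift A) l -
          (prod n).flip B ((diffFld ^ t) (adFld C (shift A)) l)) := by
      funext l
      rw [Pi.sub_apply, dongAux, pow_succ', Module.End.mul_apply, diffFld_apply, adFld_shift,
        diffFld_pow_comp shift (fun _ => rfl), map_sub]
      exact sub_sub_sub_comm _ _ _ _
    rw [e, map_sub, ih (shift A), sub_zero]
    funext l
    exact (diffFld_pow_translate N (fun l => dongAux C B n t A l -
      (prod n).flip B ((diffFld ^ t) (adFld C A) l)) l).trans (congrFun (ih A) (l + 1))

/-- Dong's lemma. -/
theorem Local.prod {C A B : Fld M} (hCA : Local C A) (hCB : Local C B) (hAB : Local A B) (n : ℤ) :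
    Local C (Fld.prod n A B) := by
  obtain ⟨NA, hA⟩ := hCA
  obtain ⟨NB, hB⟩ := hCB
  obtain ⟨N, hN⟩ := hAB
  have hA' := diffFld_pow_eq_zero.mpr hA
  have hB' := diffFld_pow_eq_zero.mpr hB
  have hsh : ∀ j : ℕ, diffOp^[N] (comm (shift^[j] A) B) = 0 := by
    intro j
    induction j with
    | zero => exact hN
    | succ j ih => rw [Function.iterate_succ_apply']; exact diffOp_comm_shift ih
  -- Enough factors `x - y` kill the `[C, A]` part, and `(x - z)^NB` kills the rest.
  have z1 : ∀ (t : ℕ) (n : ℤ), NA ≤ t → (diffFld ^ NB) (dongAux C B n t A) = 0 := by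
    intro t n ht
    have h := diffFld_pow_dongAux hB' n t A
    obtain ⟨s, rfl⟩ := Nat.exists_eq_add_of_le' ht
    have h0 : (diffFld ^ (s + NA)) (adFld C A) = 0 := by
      rw [pow_add, Module.End.mul_apply, hA', map_zero]
    rw [h0] at h
    simpa using h
  -- Past the order of locality of `A` and `B`, the product of `B` with every shift of `A` is
  -- already zero.
  have z2 : ∀ (t : ℕ) (n : ℤ), N ≤ n → dongAux C B n t A = 0 := by
    intro t n hn
    refine dongAux_eq_zero (fun j => ?_) t
    apply Subtype.ext
    funext k
    rw [prod_val, Local.bor_eq_zero (hsh j) hn]; rfl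
  -- Induction on the number of missing factors: each `x - z` supplies one more `x - y` or one more
  -- `y - z`.
  have main : ∀ (s t : ℕ) (n : ℤ), (NA - t) + (N - n).toNat ≤ s →
      (diffFld ^ (NB + s)) (dongAux C B n t A) = 0 := by
    intro s
    induction s with
    | zero => intro t n h; exact z1 t n (by omega)
    | succ s ih =>
      intro t n h
      by_cases ht : NA ≤ t
      · rw [add_comm NB, pow_add, Module.End.mul_apply, z1 t n ht, map_zero]
      by_cases hn : N ≤ n
      · rw [z2 t n hn, map_zero]
      rw [← add_assoc, pow_succ, Module.End.mul_apply, diffFld_dongAux, map_add, ih _ _ (by omega),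
        ih _ _ (by omega), add_zero]
  exact ⟨_, diffFld_pow_eq_zero.mp (main _ 0 n le_rfl)⟩

end Dong

end Fld

/-! ### Enveloping algebras, induced modules and modules over the Heisenberg-Virasoro algebra -/

section Enveloping

variable {𝔤 : Type} [LieRing 𝔤] [LieAlgebra ℂ 𝔤]

/-- The universal property factors `ι` through `S`; composed with the inclusion this fixes the
generators, so it is the identity. -/
theorem uea_subalgebra_eq_top (S : Subalgebra ℂ (UniversalEnvelopingAlgebra ℂ 𝔤))
    (h : ∀ x, UniversalEnvelopingAlgebra.ι ℂ x ∈ S) : S = ⊤ := by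
  let f : 𝔤 →ₗ⁅ℂ⁆ S :=
    { toFun := fun x => ⟨UniversalEnvelopingAlgebra.ι ℂ x, h x⟩
      map_add' := fun x y => Subtype.ext (map_add _ x y)
      map_smul' := fun c x => Subtype.ext (map_smul _ c x)
      map_lie' := fun {x y} => Subtype.ext (LieHom.map_lie (UniversalEnvelopingAlgebra.ι ℂ) x y) }
  have hf : S.val.comp (UniversalEnvelopingAlgebra.lift ℂ f) = AlgHom.id ℂ _ := by
    apply UniversalEnvelopingAlgebra.hom_ext
    ext x
    simp only [LieHom.comp_apply, AlgHom.coe_toLieHom, AlgHom.comp_apply, AlgHom.id_apply]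
    rw [UniversalEnvelopingAlgebra.lift_ι_apply]
    rfl
  rw [eq_top_iff]
  intro x _
  have := congrArg (fun g => g x) hf
  simp only [AlgHom.comp_apply, AlgHom.id_apply] at this
  rw [← this]
  exact (UniversalEnvelopingAlgebra.lift ℂ f x).2

theorem uea_smul_mem {M : Type} [AddCommGroup M] [Module ℂ M]
    [Module (UniversalEnvelopingAlgebra ℂ 𝔤) M] [IsScalarTower ℂ (UniversalEnvelopingAlgebra ℂ 𝔤) M]
    (P : Submodule ℂ M)
    (h : ∀ x : 𝔤, ∀ w ∈ P, UniversalEnvelopingAlgebra.ι ℂ x • w ∈ P)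
    (x : UniversalEnvelopingAlgebra ℂ 𝔤) {w : M} (hw : w ∈ P) : x • w ∈ P := by
  let S : Subalgebra ℂ (UniversalEnvelopingAlgebra ℂ 𝔤) :=
    { carrier := {x | ∀ w ∈ P, x • w ∈ P}
      mul_mem' := fun {a b} ha hb w hw => by rw [mul_smul]; exact ha _ (hb _ hw)
      one_mem' := fun w hw => by rwa [one_smul]
      add_mem' := fun {a b} ha hb w hw => by rw [add_smul]; exact add_mem (ha _ hw) (hb _ hw)
      zero_mem' := fun w _ => by rw [zero_smul]; exact zero_mem _
      algebraMap_mem' := fun r w hw => by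
        rw [Algebra.algebraMap_eq_smul_one, smul_assoc, one_smul]; exact P.smul_mem r hw }
  have : x ∈ S := by rw [uea_subalgebra_eq_top S h]; trivial
  exact this w hw

/-- The universal property of induced modules. -/
noncomputable def Induced.lift (𝔨 : LieSubalgebra ℂ 𝔤) {E : Type} [AddCommGroup E] [Module ℂ E]
    (ρ : 𝔨 →ₗ⁅ℂ⁆ Module.End ℂ E) {N : Type} [AddCommGroup N] [Module ℂ N]
    [Module (UniversalEnvelopingAlgebra ℂ 𝔤) N] [IsScalarTower ℂ (UniversalEnvelopingAlgebra ℂ 𝔤) N]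
    (f : E →ₗ[ℂ] N)
    (hf : ∀ (k : 𝔨) (e : E), f (ρ k e) = UniversalEnvelopingAlgebra.ι ℂ (k : 𝔤) • f e) :
    Induced 𝔨 ρ →ₗ[UniversalEnvelopingAlgebra ℂ 𝔤] N :=
  haveI : SMulCommClass ℂ (UniversalEnvelopingAlgebra ℂ 𝔤) N := IsScalarTower.to_smulCommClass
  haveI : SMulCommClass (UniversalEnvelopingAlgebra ℂ 𝔤) ℂ N := SMulCommClass.symm _ _ _
  (inducedRel 𝔨 ρ).liftQ
    (TensorProduct.AlgebraTensorModule.lift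
      (LinearMap.toSpanSingleton (UniversalEnvelopingAlgebra ℂ 𝔤) (E →ₗ[ℂ] N) f))
    (by
      rw [inducedRel, Submodule.span_le]
      rintro _ ⟨x, k, e, rfl⟩
      simp [hf, mul_smul])

theorem Induced.lift_unit (𝔨 : LieSubalgebra ℂ 𝔤) {E : Type} [AddCommGroup E] [Module ℂ E]
    (ρ : 𝔨 →ₗ⁅ℂ⁆ Module.End ℂ E) {N : Type} [AddCommGroup N] [Module ℂ N]
    [Module (UniversalEnvelopingAlgebra ℂ 𝔤) N] [IsScalarTower ℂ (UniversalEnvelopingAlgebra ℂ 𝔤) N]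
    (f : E →ₗ[ℂ] N)
    (hf : ∀ (k : 𝔨) (e : E), f (ρ k e) = UniversalEnvelopingAlgebra.ι ℂ (k : 𝔤) • f e) (e : E) :
    Induced.lift 𝔨 ρ f hf (Induced.unit 𝔨 ρ e) = f e := by
  simp [Induced.lift, Induced.unit]

theorem Induced.unit_rep (𝔨 : LieSubalgebra ℂ 𝔤) {E : Type} [AddCommGroup E] [Module ℂ E]
    (ρ : 𝔨 →ₗ⁅ℂ⁆ Module.End ℂ E) (k : 𝔨) (e : E) :
    Induced.unit 𝔨 ρ (ρ k e) =
      UniversalEnvelopingAlgebra.ι ℂ (k : 𝔤) • Induced.unit 𝔨 ρ e := by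
  have h : (1 * UniversalEnvelopingAlgebra.ι ℂ (k : 𝔤)) ⊗ₜ[ℂ] e -
      (1 : UniversalEnvelopingAlgebra ℂ 𝔤) ⊗ₜ[ℂ] (ρ k e) ∈ inducedRel 𝔨 ρ :=
    Submodule.subset_span ⟨1, k, e, rfl⟩
  have h2 := (Submodule.Quotient.eq (inducedRel 𝔨 ρ)).mpr h
  rw [one_mul] at h2
  have h3 : UniversalEnvelopingAlgebra.ι ℂ (k : 𝔤) • Induced.unit 𝔨 ρ e =
      (inducedRel 𝔨 ρ).mkQ (UniversalEnvelopingAlgebra.ι ℂ (k : 𝔤) ⊗ₜ[ℂ] e) := by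
    simp only [Induced.unit, LinearMap.comp_apply, LinearMap.restrictScalars_apply,
      TensorProduct.mk_apply]
    rw [← map_smul, TensorProduct.smul_tmul', smul_eq_mul, mul_one]
  rw [h3]
  exact h2.symm

theorem Induced.span_unit (𝔨 : LieSubalgebra ℂ 𝔤) {E : Type} [AddCommGroup E] [Module ℂ E]
    (ρ : 𝔨 →ₗ⁅ℂ⁆ Module.End ℂ E) :
    Submodule.span (UniversalEnvelopingAlgebra ℂ 𝔤) (Set.range (Induced.unit 𝔨 ρ)) = ⊤ := by
  rw [eq_top_iff]
  rintro x -
  obtain ⟨t, rfl⟩ := Submodule.mkQ_surjective _ x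
  induction t using TensorProduct.induction_on with
  | zero => rw [map_zero]; exact zero_mem _
  | add a b ha hb => rw [map_add]; exact add_mem ha hb
  | tmul u e =>
    have : (inducedRel 𝔨 ρ).mkQ (u ⊗ₜ[ℂ] e) = u • Induced.unit 𝔨 ρ e := by
      simp only [Induced.unit, LinearMap.comp_apply, LinearMap.restrictScalars_apply,
        TensorProduct.mk_apply]
      rw [← map_smul, TensorProduct.smul_tmul', smul_eq_mul, mul_one]
    rw [this]
    exact Submodule.smul_mem _ _ (Submodule.subset_span ⟨e, rfl⟩)

end Enveloping

namespace HV

/-- The Lie algebra map with prescribed values on the basis. -/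
noncomputable def liftLie {A : Type} [Ring A] [Algebra ℂ A] (f : HVIndex → A)
    (h : ∀ i j, lift f (basisBracket i j) = f i * f j - f j * f i) : HV →ₗ⁅ℂ⁆ A :=
  { lift f with
    map_lie' := by
      intro x y
      let T : HV →ₗ[ℂ] HV →ₗ[ℂ] A :=
        LinearMap.mk₂ ℂ (fun x y => lift f (bracketMap x y) - (lift f x * lift f y - lift f y * lift f x))
          (fun x x' y => by simp only [map_add, LinearMap.add_apply, add_mul, mul_add]; abel)
          (fun c x y => by
            simp only [map_smul, LinearMap.smul_apply, smul_mul_assoc, mul_smul_comm, smul_sub])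
          (fun x y y' => by simp only [map_add, add_mul, mul_add]; abel)
          (fun c x y => by
            simp only [map_smul, smul_mul_assoc, mul_smul_comm, smul_sub])
      have hT : T = 0 := by
        refine hom_ext fun i => hom_ext fun j => ?_
        simp [T, bracketMap_of, lift_of, h]
      have := congrArg (fun g => g x y) hT
      exact sub_eq_zero.mp this }

theorem liftLie_of {A : Type} [Ring A] [Algebra ℂ A] (f : HVIndex → A)
    (h : ∀ i j, lift f (basisBracket i j) = f i * f j - f j * f i) (i : HVIndex) : liftLie f h (of i) = f i :=
  lift_of f i

theorem mem_of_basis {M : Type} [AddCommGroup M] [Module ℂ M] (φ : HV →ₗ[ℂ] M) (P : Submodule ℂ M)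
    (h : ∀ i, φ (of i) ∈ P) (x : HV) : φ x ∈ P := by
  have : P.mkQ.comp φ = 0 := hom_ext fun i => by simpa using h i
  have := congrArg (fun g => g x) this
  simpa using this

end HV

/-- The image of a basis vector in the enveloping algebra. -/
noncomputable def opB (i : HVIndex) : UHV := UniversalEnvelopingAlgebra.ι ℂ (HV.of i)


theorem opB_comm (i j : HVIndex) : opB i * opB j - opB j * opB i =
    UniversalEnvelopingAlgebra.ι ℂ (HV.basisBracket i j) := by
  rw [← HV.lie_of, LieHom.map_lie]; rfl

theorem opL_comm (n m : ℤ) : opL n * opL m - opL m * opL n = ((n : ℂ) - m) • opL (n + m) +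
    (if n = -m then ((n : ℂ) ^ 3 - n) / 12 else 0) • opB .CL := by
  have := opB_comm (.L n) (.L m)
  rwa [HV.basisBracket, map_add, map_smul, map_smul] at this

theorem opL_opI_comm (n m : ℤ) : opL n * opI m - opI m * opL n = (-(m : ℂ)) • opI (n + m) -
    (if n = -m then (n : ℂ) ^ 2 + n else 0) • opB .CLI := by
  have := opB_comm (.L n) (.I m)
  rwa [HV.basisBracket, map_sub, map_smul, map_smul] at this

theorem opI_comm (n m : ℤ) : opI n * opI m - opI m * opI n = (if n = -m then (n : ℂ) else 0) • opB .CI := by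
  have := opB_comm (.I n) (.I m)
  rwa [HV.basisBracket, map_smul] at this

/-! ### Commutation relations on modules of level zero -/

section Modules

variable {M : Type} [AddCommGroup M] [Module ℂ M] [Module UHV M] [IsScalarTower ℂ UHV M]

theorem opB_smul_mem (P : Submodule ℂ M) (h : ∀ i, ∀ w ∈ P, opB i • w ∈ P) (x : UHV) {w : M}
    (hw : w ∈ P) : x • w ∈ P := by
  refine uea_smul_mem P (fun y w hw => ?_) x hw
  exact HV.mem_of_basis (((LinearMap.toSpanSingleton UHV M w).restrictScalars ℂ).comp
    (UniversalEnvelopingAlgebra.ι ℂ : HV →ₗ⁅ℂ⁆ UHV).toLinearMap) P (fun i => h i w hw) y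

/-- The action of `L(n)` on a module. -/
noncomputable def modeL (n : ℤ) : Module.End ℂ M := Algebra.lsmul ℂ ℂ M (opL n)

/-- The action of `I(n)` on a module. -/
noncomputable def modeI (n : ℤ) : Module.End ℂ M := Algebra.lsmul ℂ ℂ M (opI n)

theorem modeL_apply (n : ℤ) (w : M) : modeL n w = opL n • w := rfl
theorem modeI_apply (n : ℤ) (w : M) : modeI n w = opI n • w := rfl

variable (M) in
/-- Modules on which the central elements `C_L, C_LI, C_I` act by `cL, cLI, 0`. -/
structure IsLevelZero (cL cLI : ℂ) : Prop where
  cl : ∀ w : M, opB .CL • w = cL • w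
  cli : ∀ w : M, opB .CLI • w = cLI • w
  ci : ∀ w : M, opB .CI • w = 0

variable (M) in
/-- Restricted modules with central elements `C_L, C_LI, C_I` acting by `cL, cLI, 0`. -/
structure IsRestricted (cL cLI : ℂ) : Prop extends IsLevelZero M cL cLI where
  restricted : ∀ w : M, ∃ K : ℤ, ∀ n ≥ K, modeL n w = 0 ∧ modeI n w = 0

section

variable {cL cLI : ℂ} (h : IsLevelZero M cL cLI)

include h

theorem IsLevelZero.smul_mem (P : Submodule ℂ M) (hL : ∀ n, ∀ w ∈ P, modeL n w ∈ P)
    (hI : ∀ n, ∀ w ∈ P, modeI n w ∈ P) (x : UHV) {w : M} (hw : w ∈ P) : x • w ∈ P := by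
  refine opB_smul_mem P (fun i w hw => ?_) x hw
  rcases i with n | n | _ | _ | _
  · exact hL n w hw
  · exact hI n w hw
  · rw [h.cl]; exact P.smul_mem _ hw
  · rw [h.cli]; exact P.smul_mem _ hw
  · rw [h.ci]; exact P.zero_mem

theorem IsLevelZero.LL (n m : ℤ) (w : M) : modeL n (modeL m w) = modeL m (modeL n w) +
    ((n : ℂ) - m) • modeL (n + m) w + (if n = -m then ((n : ℂ) ^ 3 - n) / 12 * cL else 0) • w := by
  have := congrArg (fun x => x • w) (opL_comm n m)
  simp only [sub_smul _ _ w, add_smul, smul_assoc, mul_smul, h.cl, ← modeL_apply] at this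
  rw [sub_eq_iff_eq_add] at this
  rw [this]
  split_ifs <;> module

theorem IsLevelZero.LI (n m : ℤ) (w : M) : modeL n (modeI m w) = modeI m (modeL n w) -
    (m : ℂ) • modeI (n + m) w - (if n = -m then ((n : ℂ) ^ 2 + n) * cLI else 0) • w := by
  have := congrArg (fun x => x • w) (opL_opI_comm n m)
  simp only [sub_smul _ _ w, smul_assoc, mul_smul, h.cli, ← modeL_apply, ← modeI_apply] at this
  rw [sub_eq_iff_eq_add] at this
  rw [this]
  split_ifs <;> module

theorem IsLevelZero.IL (n m : ℤ) (w : M) : modeI n (modeL m w) = modeL m (modeI n w) +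
    (n : ℂ) • modeI (n + m) w + (if n = -m then ((n : ℂ) ^ 2 - n) * cLI else 0) • w := by
  rw [h.LI m n w, add_comm m n]
  by_cases e : n = -m
  · subst e; simp; module
  · have e2 : m ≠ -n := by omega
    simp only [e, e2, if_false]; module

theorem IsLevelZero.II (n m : ℤ) (w : M) : modeI n (modeI m w) = modeI m (modeI n w) := by
  have := congrArg (fun x => x • w) (opI_comm n m)
  simp only [sub_smul _ _ w, smul_assoc, mul_smul, h.ci, smul_zero, ← modeI_apply] at this
  exact sub_eq_zero.mp this

end

end Modules

/-! ### The action on fields -/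

theorem choose_two_cast (l : ℤ) : ((Ring.choose l 2 : ℤ) : ℂ) = (l : ℂ) * (l - 1) / 2 := by
  have h := congrArg (Int.cast : ℤ → ℂ) (choose_succ_mul l 1)
  rw [Ring.choose_one_right] at h
  push_cast at h
  linear_combination h / 2

theorem choose_three_cast (l : ℤ) :
    ((Ring.choose l 3 : ℤ) : ℂ) = (l : ℂ) * (l - 1) * (l - 2) / 6 := by
  have h := congrArg (Int.cast : ℤ → ℂ) (choose_succ_mul l 2)
  have h2 := choose_two_cast (l - 1)
  push_cast at h h2
  rw [h2] at h
  linear_combination h / 3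

namespace IsRestricted

open Fld

variable {M : Type} [AddCommGroup M] [Module ℂ M] [Module UHV M] [IsScalarTower ℂ UHV M]
variable {cL cLI : ℂ} (h : IsRestricted M cL cLI)

/-- The field `L(z)`. -/
noncomputable def fieldL (h : IsRestricted M cL cLI) : Fld M :=
  ⟨fun n => modeL (n - 1), fun w => by
    obtain ⟨K, hK⟩ := h.restricted w
    exact ⟨K + 1, fun k hk => (hK (k - 1) (by omega)).1⟩⟩

/-- The field `I(z)`. -/
noncomputable def fieldI (h : IsRestricted M cL cLI) : Fld M :=
  ⟨fun n => modeI n, fun w => by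
    obtain ⟨K, hK⟩ := h.restricted w
    exact ⟨K, fun k hk => (hK k hk).2⟩⟩

theorem fieldL_apply (n : ℤ) (w : M) : h.fieldL.1 n w = modeL (n - 1) w := rfl
theorem fieldI_apply (n : ℤ) (w : M) : h.fieldI.1 n w = modeI n w := rfl

/-- The singular part of the operator product of `L(z)` with itself. -/
noncomputable def opeLL (h : IsRestricted M cL cLI) : ℕ → Fld M
  | 0 => deriv h.fieldL
  | 1 => (2 : ℂ) • h.fieldL
  | 3 => (cL / 2) • one
  | _ => 0

/-- The singular part of the operator product of `L(z)` with `I(z)`. -/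
noncomputable def opeLI (h : IsRestricted M cL cLI) : ℕ → Fld M
  | 0 => deriv h.fieldI
  | 1 => h.fieldI
  | 2 => (-2 * cLI) • one
  | _ => 0

/-- The singular part of the operator product of `I(z)` with `L(z)`. -/
noncomputable def opeIL (h : IsRestricted M cL cLI) : ℕ → Fld M
  | 1 => h.fieldI
  | 2 => (2 * cLI) • one
  | _ => 0

theorem hasOPE_LL : HasOPE h.fieldL h.fieldL 4 h.opeLL := by
  intro l k
  ext w
  simp only [Finset.sum_range_succ, Finset.sum_range_zero, opeLL, Fld.comm, LinearMap.sub_apply,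
    Module.End.mul_apply, fieldL_apply, LinearMap.add_apply, LinearMap.smul_apply, Fld.smul_apply,
    deriv_apply, one_apply, ← Int.cast_smul_eq_zsmul ℂ, choose_three_cast, Ring.choose_one_right,
    Ring.choose_zero_right, Fld.zero_apply]
  rw [h.LL]
  have e1 : l + k - ((0 : ℕ) : ℤ) - 1 - 1 = l - 1 + (k - 1) := by push_cast; ring
  have e2 : l + k - ((1 : ℕ) : ℤ) - 1 = l - 1 + (k - 1) := by push_cast; ring
  rw [e1, e2]
  -- Mode `l` of the field is `L(l - 1)`, so the central term sits at `l + k = 2`, and `(n^3 - n) /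
  -- 12` at `n = l - 1` equals `choose l 3 / 2`.
  by_cases e : l + k = 2
  · obtain rfl : k = 2 - l := by omega
    rw [if_pos (by ring), if_pos (by push_cast; ring)]
    push_cast; simp; module
  · rw [if_neg (by omega), if_neg (by push_cast; omega)]
    push_cast; simp; module

theorem hasOPE_LI : HasOPE h.fieldL h.fieldI 3 h.opeLI := by
  intro l k
  ext w
  simp only [Finset.sum_range_succ, Finset.sum_range_zero, opeLI, Fld.comm, LinearMap.sub_apply,
    Module.End.mul_apply, fieldL_apply, fieldI_apply, LinearMap.add_apply, LinearMap.smul_apply,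
    Fld.smul_apply, deriv_apply, one_apply, ← Int.cast_smul_eq_zsmul ℂ, choose_two_cast,
    Ring.choose_one_right, Ring.choose_zero_right]
  rw [h.LI]
  have e1 : l + k - ((0 : ℕ) : ℤ) - 1 = l - 1 + k := by push_cast; ring
  have e2 : l + k - ((1 : ℕ) : ℤ) = l - 1 + k := by push_cast; ring
  rw [e1, e2]
  by_cases e : l + k = 1
  · obtain rfl : k = 1 - l := by omega
    rw [if_pos (by ring), if_pos (by push_cast; ring)]
    push_cast; simp; module
  · rw [if_neg (by omega), if_neg (by push_cast; omega)]
    push_cast; simp; module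

theorem hasOPE_IL : HasOPE h.fieldI h.fieldL 3 h.opeIL := by
  intro l k
  ext w
  simp only [Finset.sum_range_succ, Finset.sum_range_zero, opeIL, Fld.comm, LinearMap.sub_apply,
    Module.End.mul_apply, fieldL_apply, fieldI_apply, LinearMap.add_apply, LinearMap.smul_apply,
    Fld.smul_apply, one_apply, ← Int.cast_smul_eq_zsmul ℂ, choose_two_cast,
    Ring.choose_one_right, Ring.choose_zero_right, Fld.zero_apply]
  rw [h.IL]
  have e2 : l + k - ((1 : ℕ) : ℤ) = l + (k - 1) := by push_cast; ring
  rw [e2]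
  by_cases e : l + k = 1
  · obtain rfl : k = 1 - l := by omega
    rw [if_pos (by ring), if_pos (by push_cast; ring)]
    push_cast; simp; module
  · rw [if_neg (by omega), if_neg (by push_cast; omega)]
    push_cast; simp

theorem hasOPE_II : HasOPE h.fieldI h.fieldI 0 fun _ => 0 := by
  intro l k
  ext w
  simp only [Fld.comm, LinearMap.sub_apply, Module.End.mul_apply, fieldI_apply, Finset.sum_range_zero]
  rw [h.II, sub_self]; rfl

/-- The action of the basis of the Heisenberg-Virasoro algebra on fields. -/
noncomputable def fieldAct (h : IsRestricted M cL cLI) : HVIndex → Module.End ℂ (Fld M)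
  | .L n => prod (n + 1) h.fieldL
  | .I n => prod n h.fieldI
  | .CL => cL • 1
  | .CLI => cLI • 1
  | .CI => 0

/-- This is `HasOPE.prod_comm` fed with the singular parts: derivatives become index shifts by
`prod_deriv_left`, and the identity field contributes only at index `-1` by `one_prod`, which
reproduces the central terms. It holds on all fields `C`, local or not. -/
theorem fieldAct_bracket (i j : HVIndex) :
    HV.lift h.fieldAct (HV.basisBracket i j) =
      h.fieldAct i * h.fieldAct j - h.fieldAct j * h.fieldAct i := by
  refine LinearMap.ext fun C => ?_
  rcases i with n | n | _ | _ | _ <;> rcases j with m | m | _ | _ | _ <;>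
    simp only [HV.basisBracket, map_add, map_sub, map_smul, map_zero, HV.lift_of]
  · change _ = prod (n + 1) h.fieldL (prod (m + 1) h.fieldL C) -
      prod (m + 1) h.fieldL (prod (n + 1) h.fieldL C)
    rw [h.hasOPE_LL.prod_comm]
    simp only [Finset.sum_range_succ, Finset.sum_range_zero, opeLL, fieldAct, map_smul,
      LinearMap.smul_apply, LinearMap.add_apply, prod_deriv_left, one_prod,
      ← Int.cast_smul_eq_zsmul ℂ, choose_three_cast, Ring.choose_one_right,
      Ring.choose_zero_right, map_zero, LinearMap.zero_apply, Module.End.one_apply]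
    have e1 : n + 1 + (m + 1) - ((0 : ℕ) : ℤ) - 1 = n + m + 1 := by push_cast; ring
    have e2 : n + 1 + (m + 1) - ((1 : ℕ) : ℤ) = n + m + 1 := by push_cast; ring
    rw [e1, e2]
    by_cases e : n = -m
    · subst e
      rw [if_pos rfl, if_pos (by push_cast; ring)]
      push_cast; simp; module
    · rw [if_neg e, if_neg (by push_cast; omega)]
      push_cast; simp; module
  · change _ = prod (n + 1) h.fieldL (prod m h.fieldI C) -
      prod m h.fieldI (prod (n + 1) h.fieldL C)
    rw [h.hasOPE_LI.prod_comm]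
    simp only [Finset.sum_range_succ, Finset.sum_range_zero, opeLI, fieldAct, map_smul,
      LinearMap.smul_apply, LinearMap.sub_apply, prod_deriv_left, one_prod,
      ← Int.cast_smul_eq_zsmul ℂ, choose_two_cast, Ring.choose_one_right,
      Ring.choose_zero_right, Module.End.one_apply]
    have e1 : n + 1 + m - ((0 : ℕ) : ℤ) - 1 = n + m := by push_cast; ring
    have e2 : n + 1 + m - ((1 : ℕ) : ℤ) = n + m := by push_cast; ring
    rw [e1, e2]
    by_cases e : n = -m
    · subst e
      rw [if_pos rfl, if_pos (by push_cast; ring)]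
      push_cast; simp; module
    · rw [if_neg e, if_neg (by push_cast; omega)]
      push_cast; simp; module
  pick_goal 4
  · change _ = prod n h.fieldI (prod (m + 1) h.fieldL C) -
      prod (m + 1) h.fieldL (prod n h.fieldI C)
    rw [h.hasOPE_IL.prod_comm]
    simp only [Finset.sum_range_succ, Finset.sum_range_zero, opeIL, fieldAct, map_smul,
      LinearMap.smul_apply, LinearMap.add_apply, one_prod, LinearMap.zero_apply, map_zero,
      ← Int.cast_smul_eq_zsmul ℂ, choose_two_cast, Ring.choose_one_right,
      Ring.choose_zero_right, Module.End.one_apply]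
    have e2 : n + (m + 1) - ((1 : ℕ) : ℤ) = m + n := by push_cast; ring
    rw [e2]
    by_cases e : m = -n
    · subst e
      rw [if_pos rfl, if_pos (by push_cast; ring)]
      push_cast; simp; module
    · rw [if_neg e, if_neg (by push_cast; omega)]
      push_cast; simp
  pick_goal 4
  · change _ = prod n h.fieldI (prod m h.fieldI C) - prod m h.fieldI (prod n h.fieldI C)
    rw [h.hasOPE_II.prod_comm]
    simp [fieldAct]
  all_goals
    simp only [fieldAct, LinearMap.sub_apply, Module.End.mul_apply, LinearMap.smul_apply,
      Module.End.one_apply, map_smul, LinearMap.zero_apply, map_zero, smul_zero, sub_self]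
    try module

/-- The action of the enveloping algebra on fields. -/
noncomputable def fieldAlg (h : IsRestricted M cL cLI) : UHV →ₐ[ℂ] Module.End ℂ (Fld M) :=
  UniversalEnvelopingAlgebra.lift (A := Module.End ℂ (Fld M)) ℂ
    (HV.liftLie (A := Module.End ℂ (Fld M)) h.fieldAct h.fieldAct_bracket)

theorem fieldAlg_opB (i : HVIndex) : h.fieldAlg (opB i) = h.fieldAct i :=
  (UniversalEnvelopingAlgebra.lift_ι_apply ℂ _ _).trans (HV.liftLie_of _ _ _)

end IsRestricted

/-! ### Induced modules contain the inducing module -/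

section Embedding

variable {𝔤 : Type} [LieRing 𝔤] [LieAlgebra ℂ 𝔤] (𝔞 𝔨 : LieSubalgebra ℂ 𝔤)
  {E : Type} [AddCommGroup E] [Module ℂ E] (ρ : 𝔨 →ₗ⁅ℂ⁆ Module.End ℂ E)

/-- The action of `𝔞` on `Hom(𝔤, W)`, for a `U(𝔞)`-module `W`. -/
noncomputable def homAct (W : Type) [AddCommGroup W] [Module ℂ W]
    [Module (UniversalEnvelopingAlgebra ℂ 𝔞) W]
    [IsScalarTower ℂ (UniversalEnvelopingAlgebra ℂ 𝔞) W] :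
    𝔞 →ₗ⁅ℂ⁆ Module.End ℂ (𝔤 →ₗ[ℂ] W) where
  toFun y :=
    { toFun := fun f =>
        { toFun := fun x => UniversalEnvelopingAlgebra.ι ℂ y • f x - f ⁅(y : 𝔤), x⁆
          map_add' := fun x x' => by simp only [map_add, smul_add, lie_add]; abel
          map_smul' := fun c x => by
            simp only [map_smul, lie_smul, RingHom.id_apply, smul_sub]
            rw [smul_algebra_smul_comm] }
      map_add' := fun f g => by ext x; simp; abel
      map_smul' := fun c f => by ext x; simp [smul_sub, smul_algebra_smul_comm] }
  map_add' y z := by ext f x; simp [add_smul]; abel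
  map_smul' c y := by ext f x; simp [smul_sub]
  map_lie' {y z} := by
    ext f x
    simp only [LieHom.map_lie, Ring.lie_def, LinearMap.coe_mk, AddHom.coe_mk, LinearMap.sub_apply,
      Module.End.mul_apply, sub_smul, mul_smul, LieSubalgebra.coe_bracket, lie_lie, map_sub, smul_sub]
    abel

/-- The initial values on `E` of the action of `𝔤` on `U(𝔞) ⊗ E`. -/
noncomputable def embInit (pa : 𝔤 →ₗ[ℂ] 𝔞) (pb : 𝔤 →ₗ[ℂ] 𝔨) :
    E →ₗ[ℂ] (𝔤 →ₗ[ℂ] UniversalEnvelopingAlgebra ℂ 𝔞 ⊗[ℂ] E) :=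
  LinearMap.mk₂ ℂ (fun e x => UniversalEnvelopingAlgebra.ι ℂ (pa x) ⊗ₜ[ℂ] e + 1 ⊗ₜ[ℂ] ρ (pb x) e)
    (fun e e' x => by simp only [TensorProduct.tmul_add, map_add]; abel)
    (fun c e x => by simp only [TensorProduct.tmul_smul, map_smul, smul_add])
    (fun e x x' => by
      simp only [map_add, TensorProduct.add_tmul, LinearMap.add_apply, TensorProduct.tmul_add]; abel)
    (fun c e x => by
      simp only [map_smul, LinearMap.smul_apply, TensorProduct.tmul_smul, smul_add,
        TensorProduct.smul_tmul'])

/-- The action of `𝔤` on `U(𝔞) ⊗ E`. -/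
noncomputable def embAct (pa : 𝔤 →ₗ[ℂ] 𝔞) (pb : 𝔤 →ₗ[ℂ] 𝔨) :
    UniversalEnvelopingAlgebra ℂ 𝔞 ⊗[ℂ] E →ₗ[ℂ]
      (𝔤 →ₗ[ℂ] UniversalEnvelopingAlgebra ℂ 𝔞 ⊗[ℂ] E) :=
  TensorProduct.lift (((LinearMap.llcomp ℂ E _ _).flip (embInit 𝔞 𝔨 ρ pa pb)).comp
    (UniversalEnvelopingAlgebra.lift ℂ (homAct 𝔞 _)).toLinearMap)

variable {pa : 𝔤 →ₗ[ℂ] 𝔞} {pb : 𝔤 →ₗ[ℂ] 𝔨}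

theorem embAct_tmul (u : UniversalEnvelopingAlgebra ℂ 𝔞) (e : E) :
    embAct 𝔞 𝔨 ρ pa pb (u ⊗ₜ[ℂ] e) =
      UniversalEnvelopingAlgebra.lift ℂ (homAct 𝔞 _) u (embInit 𝔞 𝔨 ρ pa pb e) := rfl

/-- Any `𝔤`-action on `U(𝔞) ⊗ E` extending left multiplication must obey `x y = y x - [y, x]`. The
module `homAct` turns this rule into an `𝔞`-action on `Hom(𝔤, W)`, so the recursion along `U(𝔞)` is
consistent. -/
theorem embAct_smul (y : 𝔞) (w : UniversalEnvelopingAlgebra ℂ 𝔞 ⊗[ℂ] E) (x : 𝔤) :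
    embAct 𝔞 𝔨 ρ pa pb (UniversalEnvelopingAlgebra.ι ℂ y • w) x =
      UniversalEnvelopingAlgebra.ι ℂ y • embAct 𝔞 𝔨 ρ pa pb w x -
        embAct 𝔞 𝔨 ρ pa pb w ⁅(y : 𝔤), x⁆ := by
  induction w using TensorProduct.induction_on with
  | zero => simp
  | add a b ha hb => simp only [smul_add, map_add, LinearMap.add_apply, ha, hb]; abel
  | tmul u e =>
    rw [TensorProduct.smul_tmul', smul_eq_mul, embAct_tmul, embAct_tmul, map_mul,
      UniversalEnvelopingAlgebra.lift_ι_apply]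
    rfl

theorem embAct_one (e : E) (x : 𝔤) : embAct 𝔞 𝔨 ρ pa pb (1 ⊗ₜ[ℂ] e) x =
    UniversalEnvelopingAlgebra.ι ℂ (pa x) ⊗ₜ[ℂ] e + 1 ⊗ₜ[ℂ] ρ (pb x) e := by
  rw [embAct_tmul, map_one]; rfl

theorem tensor_induction (P : Submodule ℂ (UniversalEnvelopingAlgebra ℂ 𝔞 ⊗[ℂ] E))
    (h1 : ∀ e, 1 ⊗ₜ[ℂ] e ∈ P)
    (h2 : ∀ y : 𝔞, ∀ w ∈ P, UniversalEnvelopingAlgebra.ι ℂ y • w ∈ P)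
    (w : UniversalEnvelopingAlgebra ℂ 𝔞 ⊗[ℂ] E) : w ∈ P := by
  induction w using TensorProduct.induction_on with
  | zero => exact zero_mem _
  | add a b ha hb => exact add_mem ha hb
  | tmul u e =>
    have := uea_smul_mem P h2 u (h1 e)
    rwa [TensorProduct.smul_tmul', smul_eq_mul, mul_one] at this

variable (hsum : ∀ x, (pa x : 𝔤) + pb x = x) (haa : ∀ a : 𝔞, pa a = a) (hab : ∀ a : 𝔞, pb a = 0)
  (hba : ∀ b : 𝔨, pa b = 0) (hbb : ∀ b : 𝔨, pb b = b)

include haa hab in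
theorem embAct_left (a : 𝔞) (w : UniversalEnvelopingAlgebra ℂ 𝔞 ⊗[ℂ] E) :
    embAct 𝔞 𝔨 ρ pa pb w (a : 𝔤) = UniversalEnvelopingAlgebra.ι ℂ a • w := by
  let P : Submodule ℂ (UniversalEnvelopingAlgebra ℂ 𝔞 ⊗[ℂ] E) :=
    { carrier := {w | ∀ a : 𝔞, embAct 𝔞 𝔨 ρ pa pb w (a : 𝔤) = UniversalEnvelopingAlgebra.ι ℂ a • w}
      add_mem' := fun {x y} hx hy a => by
        rw [map_add, LinearMap.add_apply, hx a, hy a, smul_add]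
      zero_mem' := fun a => by simp
      smul_mem' := fun c x hx a => by
        rw [map_smul, LinearMap.smul_apply, hx a, smul_algebra_smul_comm] }
  refine tensor_induction 𝔞 P (fun e a => ?_) (fun y w hw a => ?_) w a
  · rw [embAct_one, haa, hab, map_zero, LinearMap.zero_apply, TensorProduct.tmul_zero, add_zero,
      TensorProduct.smul_tmul', smul_eq_mul, mul_one]
  · have h1 := hw ⁅y, a⁆
    rw [LieSubalgebra.coe_bracket, LieHom.map_lie, Ring.lie_def, sub_smul, mul_smul, mul_smul] at h1
    rw [embAct_smul, hw a, h1]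
    abel

-- On `1 ⊗ e` split both arguments along `𝔤 = 𝔞 ⊕ 𝔨`; the mixed case is `embAct_smul` itself.
-- Passing from `w` to `z • w` is the Jacobi identity.
include hsum haa hab hba hbb in
theorem embAct_lie (w : UniversalEnvelopingAlgebra ℂ 𝔞 ⊗[ℂ] E) (x y : 𝔤) :
    embAct 𝔞 𝔨 ρ pa pb w ⁅x, y⁆ = embAct 𝔞 𝔨 ρ pa pb (embAct 𝔞 𝔨 ρ pa pb w y) x -
      embAct 𝔞 𝔨 ρ pa pb (embAct 𝔞 𝔨 ρ pa pb w x) y := by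
  set β := embAct 𝔞 𝔨 ρ pa pb with hβ
  let P : Submodule ℂ (UniversalEnvelopingAlgebra ℂ 𝔞 ⊗[ℂ] E) :=
    { carrier := {w | ∀ x y, β w ⁅x, y⁆ = β (β w y) x - β (β w x) y}
      add_mem' := fun {v w} hv hw x y => by
        simp only [map_add, LinearMap.add_apply, hv x y, hw x y]; abel
      zero_mem' := fun x y => by simp
      smul_mem' := fun c v hv x y => by
        simp only [map_smul, LinearMap.smul_apply, hv x y, smul_sub] }
  refine tensor_induction 𝔞 P (fun e => ?_) (fun z w hw x y => ?_) w x y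
  · have hk : ∀ b : 𝔨, β (1 ⊗ₜ[ℂ] e) (b : 𝔤) = 1 ⊗ₜ[ℂ] ρ b e := fun b => by
      rw [hβ, embAct_one, hba, hbb, map_zero, TensorProduct.zero_tmul, zero_add]
    have hk' : ∀ (b : 𝔨) (f : E), β (1 ⊗ₜ[ℂ] f) (b : 𝔤) = 1 ⊗ₜ[ℂ] ρ b f := fun b f => by
      rw [hβ, embAct_one, hba, hbb, map_zero, TensorProduct.zero_tmul, zero_add]
    have ha : ∀ (a : 𝔞) w, β w (a : 𝔤) = UniversalEnvelopingAlgebra.ι ℂ a • w :=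
      fun a w => embAct_left 𝔞 𝔨 ρ haa hab a w
    have c1 : ∀ a a' : 𝔞, β (1 ⊗ₜ[ℂ] e) ⁅(a : 𝔤), (a' : 𝔤)⁆ =
        β (β (1 ⊗ₜ[ℂ] e) a') a - β (β (1 ⊗ₜ[ℂ] e) a) a' := by
      intro a a'
      have h1 := ha ⁅a, a'⁆ (1 ⊗ₜ[ℂ] e)
      rw [LieSubalgebra.coe_bracket, LieHom.map_lie, Ring.lie_def, sub_smul, mul_smul, mul_smul] at h1
      rw [h1]
      simp only [ha]
    have c2 : ∀ (a : 𝔞) (b : 𝔨), β (1 ⊗ₜ[ℂ] e) ⁅(a : 𝔤), (b : 𝔤)⁆ =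
        β (β (1 ⊗ₜ[ℂ] e) b) a - β (β (1 ⊗ₜ[ℂ] e) a) b := by
      intro a b
      rw [ha, ha, hβ, embAct_smul]
      abel
    have c3 : ∀ b b' : 𝔨, β (1 ⊗ₜ[ℂ] e) ⁅(b : 𝔤), (b' : 𝔤)⁆ =
        β (β (1 ⊗ₜ[ℂ] e) b') b - β (β (1 ⊗ₜ[ℂ] e) b) b' := by
      intro b b'
      have h1 := hk ⁅b, b'⁆
      rw [LieSubalgebra.coe_bracket, LieHom.map_lie, Ring.lie_def, LinearMap.sub_apply,
        TensorProduct.tmul_sub] at h1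
      rw [h1, hk, hk, hk', hk']
      rfl
    have c4 : ∀ (a : 𝔞) (b : 𝔨), β (1 ⊗ₜ[ℂ] e) ⁅(b : 𝔤), (a : 𝔤)⁆ =
        β (β (1 ⊗ₜ[ℂ] e) a) b - β (β (1 ⊗ₜ[ℂ] e) b) a := by
      intro a b
      rw [← lie_skew, map_neg, c2]; abel
    intro x y
    rw [← hsum x, ← hsum y]
    simp only [add_lie, lie_add, map_add, LinearMap.add_apply, c1, c2, c3, c4]
    abel
  · have h1 := hw x y
    have h2 := hw ⁅(z : 𝔤), x⁆ y
    have h3 := hw x ⁅(z : 𝔤), y⁆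
    have hs : ∀ (v : UniversalEnvelopingAlgebra ℂ 𝔞 ⊗[ℂ] E) (x : 𝔤),
        β (UniversalEnvelopingAlgebra.ι ℂ z • v) x =
        UniversalEnvelopingAlgebra.ι ℂ z • β v x - β v ⁅(z : 𝔤), x⁆ :=
      fun v x => embAct_smul 𝔞 𝔨 ρ z v x
    have h4 : β w ⁅(z : 𝔤), ⁅x, y⁆⁆ = β w ⁅⁅(z : 𝔤), x⁆, y⁆ + β w ⁅x, ⁅(z : 𝔤), y⁆⁆ := by
      rw [← map_add, leibniz_lie]
    rw [hs, hs, hs, h4, h1, h2, h3]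
    simp only [map_sub, LinearMap.sub_apply, hs, smul_sub]
    abel

include hsum haa hab hba hbb in
/-- If `𝔤 = 𝔞 ⊕ 𝔨` for subalgebras `𝔞, 𝔨`, then a `𝔨`-module embeds into the induced `𝔤`-module. -/
theorem Induced.unit_injective : Function.Injective (Induced.unit 𝔨 ρ) := by
  let act : 𝔤 →ₗ⁅ℂ⁆ Module.End ℂ (UniversalEnvelopingAlgebra ℂ 𝔞 ⊗[ℂ] E) :=
    { (embAct 𝔞 𝔨 ρ pa pb).flip with
      map_lie' := fun {x y} => LinearMap.ext fun w =>
        embAct_lie 𝔞 𝔨 ρ hsum haa hab hba hbb w x y }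
  -- A homomorphism from the induced module to this explicit model detects `E`, so no PBW basis of
  -- `U(𝔤)` is needed.
  let _ : Module (UniversalEnvelopingAlgebra ℂ 𝔤) (UniversalEnvelopingAlgebra ℂ 𝔞 ⊗[ℂ] E) :=
    Module.compHom _ (UniversalEnvelopingAlgebra.lift ℂ act).toRingHom
  have hsm : ∀ (u : UniversalEnvelopingAlgebra ℂ 𝔤) (w : UniversalEnvelopingAlgebra ℂ 𝔞 ⊗[ℂ] E),
    u • w = UniversalEnvelopingAlgebra.lift ℂ act u w := fun _ _ => rfl
  have : IsScalarTower ℂ (UniversalEnvelopingAlgebra ℂ 𝔤) (UniversalEnvelopingAlgebra ℂ 𝔞 ⊗[ℂ] E) :=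
    ⟨fun c u w => by rw [hsm, hsm, map_smul]; rfl⟩
  let f : E →ₗ[ℂ] UniversalEnvelopingAlgebra ℂ 𝔞 ⊗[ℂ] E := TensorProduct.mk ℂ _ E 1
  have hf : ∀ (k : 𝔨) (e : E), f (ρ k e) = UniversalEnvelopingAlgebra.ι ℂ (k : 𝔤) • f e := by
    intro k e
    rw [hsm, UniversalEnvelopingAlgebra.lift_ι_apply]
    change 1 ⊗ₜ[ℂ] ρ k e = embAct 𝔞 𝔨 ρ pa pb (1 ⊗ₜ[ℂ] e) (k : 𝔤)
    rw [embAct_one, hba, hbb, map_zero, TensorProduct.zero_tmul, zero_add]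
  have hinj : Function.Injective f := by
    -- The counit of `U(𝔞)` recovers `e` from `1 ⊗ e`.
    let ε : UniversalEnvelopingAlgebra ℂ 𝔞 →ₐ[ℂ] ℂ := UniversalEnvelopingAlgebra.lift ℂ 0
    let g : UniversalEnvelopingAlgebra ℂ 𝔞 ⊗[ℂ] E →ₗ[ℂ] E :=
      TensorProduct.lift ((LinearMap.lsmul ℂ E).comp ε.toLinearMap)
    refine Function.LeftInverse.injective (g := g) fun e => ?_
    change ε 1 • e = e
    rw [map_one, one_smul]
  intro e e' h
  have := congrArg (Induced.lift 𝔨 ρ f hf) h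
  rw [Induced.lift_unit, Induced.lift_unit] at this
  exact hinj this

end Embedding

/-! ### The splitting into the negative and the nonnegative subalgebra -/

namespace HV

/-- The subalgebra spanned by `L(n), I(n)` for `n < 0`. -/
noncomputable def neg : LieSubalgebra ℂ HV where
  toSubmodule := Submodule.span ℂ (of '' {i | ¬ Nonneg i})
  lie_mem' {x y} hx hy := by
    change x ∈ Submodule.span ℂ (of '' {i | ¬ Nonneg i}) at hx
    change y ∈ Submodule.span ℂ (of '' {i | ¬ Nonneg i}) at hy
    change bracketMap x y ∈ Submodule.span ℂ (of '' {i | ¬ Nonneg i})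
    have hL : ∀ n : ℤ, n < 0 → of (.L n) ∈ Submodule.span ℂ (of '' {i | ¬ Nonneg i}) :=
      fun n h => Submodule.subset_span ⟨_, not_le.mpr h, rfl⟩
    have hI : ∀ n : ℤ, n < 0 → of (.I n) ∈ Submodule.span ℂ (of '' {i | ¬ Nonneg i}) :=
      fun n h => Submodule.subset_span ⟨_, not_le.mpr h, rfl⟩
    induction hx using Submodule.span_induction with
    | zero => simp
    | add a b _ _ ha hb => simpa using add_mem ha hb
    | smul c a _ ha => simpa using Submodule.smul_mem _ c ha
    | mem a ha =>
      obtain ⟨i, hi, rfl⟩ := ha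
      induction hy using Submodule.span_induction with
      | zero => simp
      | add a b _ _ ha hb => simpa using add_mem ha hb
      | smul c a _ ha => simpa using Submodule.smul_mem _ c ha
      | mem a ha =>
        obtain ⟨j, hj, rfl⟩ := ha
        rw [bracketMap_of]
        rcases i with n | n | _ | _ | _ <;> rcases j with m | m | _ | _ | _ <;>
          simp only [Set.mem_ofPred_eq, Nonneg, not_le, not_true] at hi hj
        · rw [basisBracket, if_neg (by omega), zero_smul, add_zero]
          exact Submodule.smul_mem _ _ (hL _ (by omega))
        · rw [basisBracket, if_neg (by omega), zero_smul, sub_zero]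
          exact Submodule.smul_mem _ _ (hI _ (by omega))
        · rw [basisBracket, if_neg (by omega), zero_smul, add_zero]
          exact Submodule.smul_mem _ _ (hI _ (by omega))
        · rw [basisBracket, if_neg (by omega), zero_smul]
          exact zero_mem _

open Classical in
/-- The projection to the negative subalgebra. -/
noncomputable def projNeg : HV →ₗ[ℂ] neg :=
  lift fun i => if hi : Nonneg i then 0 else ⟨of i, Submodule.subset_span ⟨i, hi, rfl⟩⟩

open Classical in
/-- The projection to the nonnegative subalgebra. -/
noncomputable def projNonneg : HV →ₗ[ℂ] nonneg :=
  lift fun i => if hi : Nonneg i then ⟨of i, of_mem_nonnegSpan hi⟩ else 0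

theorem proj_add (x : HV) : (projNeg x : HV) + projNonneg x = x := by
  have : neg.toSubmodule.subtype.comp projNeg + nonneg.toSubmodule.subtype.comp projNonneg =
      LinearMap.id := by
    refine hom_ext fun i => ?_
    by_cases hi : Nonneg i
    · simp [projNeg, projNonneg, lift_of, hi]
    · simp [projNeg, projNonneg, lift_of, hi]
  exact congrArg (fun f => f x) this

theorem projNonneg_neg (a : neg) : projNonneg a = 0 := by
  obtain ⟨x, hx⟩ := a
  change x ∈ Submodule.span ℂ (of '' {i | ¬ Nonneg i}) at hx
  change projNonneg x = 0
  induction hx using Submodule.span_induction with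
  | zero => simp
  | add a b _ _ ha hb => rw [map_add, ha, hb, add_zero]
  | smul c a _ ha => rw [map_smul, ha, smul_zero]
  | mem a ha =>
    obtain ⟨i, hi, rfl⟩ := ha
    have hi' : ¬ Nonneg i := hi
    rw [projNonneg, lift_of]
    exact dif_neg hi'

theorem projNeg_nonneg (b : nonneg) : projNeg b = 0 := by
  obtain ⟨x, hx⟩ := b
  change x ∈ nonnegSpan at hx
  change projNeg x = 0
  induction hx using Submodule.span_induction with
  | zero => simp
  | add a b _ _ ha hb => rw [map_add, ha, hb, add_zero]
  | smul c a _ ha => rw [map_smul, ha, smul_zero]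
  | mem a ha =>
    obtain ⟨i, hi, rfl⟩ := ha
    have hi' : Nonneg i := hi
    rw [projNeg, lift_of]
    exact dif_pos hi'

theorem induced_unit_injective {E : Type} [AddCommGroup E] [Module ℂ E]
    (ρ : nonneg →ₗ⁅ℂ⁆ Module.End ℂ E) : Function.Injective (Induced.unit nonneg ρ) := by
  refine Induced.unit_injective neg nonneg ρ (pa := projNeg) (pb := projNonneg) proj_add (fun a => ?_)
    projNonneg_neg projNeg_nonneg (fun b => ?_)
  · have := proj_add (a : HV)
    rw [projNonneg_neg] at this
    exact Subtype.ext (by simpa using this)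
  · have := proj_add (b : HV)
    rw [projNeg_nonneg] at this
    exact Subtype.ext (by simpa using this)

end HV

/-! ### Modules generated by lowest weight spaces -/

/-- The `W i` with eigenvalue `s` and the remaining ones together span everything; independence of
eigenspaces leaves no further eigenvectors for `s`. -/
theorem eigenspace_eq_iSup {M ι : Type} [AddCommGroup M] [Module ℂ M] (f : Module.End ℂ M)
    (W : ι → Submodule ℂ M) (μ : ι → ℂ) (hW : ∀ i, W i ≤ Module.End.eigenspace f (μ i))
    (htop : ⨆ i, W i = ⊤) (s : ℂ) :
    Module.End.eigenspace f s = ⨆ (i) (_ : μ i = s), W i := by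
  have hU : ⨆ (i) (_ : μ i = s), W i ≤ Module.End.eigenspace f s :=
    iSup₂_le fun i hi => hi ▸ hW i
  have hT : ⨆ (i) (_ : μ i ≠ s), W i ≤ ⨆ (t) (_ : t ≠ s), Module.End.eigenspace f t :=
    iSup₂_le fun i hi => (hW i).trans (le_iSup₂_of_le (μ i) hi le_rfl)
  have hd : Disjoint (Module.End.eigenspace f s) (⨆ (i) (_ : μ i ≠ s), W i) :=
    (Module.End.eigenspaces_iSupIndep f s).mono_right hT
  have hc : (⨆ (i) (_ : μ i = s), W i) ⊔ (⨆ (i) (_ : μ i ≠ s), W i) = ⊤ := by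
    rw [eq_top_iff, ← htop]
    refine iSup_le fun i => ?_
    by_cases hi : μ i = s
    · exact le_sup_of_le_left (le_iSup₂_of_le i hi le_rfl)
    · exact le_sup_of_le_right (le_iSup₂_of_le i hi le_rfl)
  refine le_antisymm ?_ hU
  intro x hx
  obtain ⟨u, hu, t, ht, rfl⟩ := Submodule.mem_sup.mp (hc.symm ▸ Submodule.mem_top : x ∈ _)
  have : t ∈ Module.End.eigenspace f s := by
    simpa using sub_mem hx (hU hu)
  have ht0 : t = 0 := Submodule.disjoint_def.mp hd t this ht
  rwa [ht0, add_zero]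

section Generated

variable {M : Type} [AddCommGroup M] [Module ℂ M] [Module UHV M] [IsScalarTower ℂ UHV M]

/-- A central basis element commutes with all of `UHV`, so its action by a scalar spreads from
generators to the whole module. -/
theorem IsLevelZero.of_span {cL cLI : ℂ} (S : Set M) (hS : Submodule.span UHV S = ⊤)
    (hcl : ∀ w ∈ S, opB .CL • w = cL • w) (hcli : ∀ w ∈ S, opB .CLI • w = cLI • w)
    (hci : ∀ w ∈ S, opB .CI • w = 0) : IsLevelZero M cL cLI := by
  have key : ∀ (j : HVIndex) (c : ℂ), (∀ i, HV.basisBracket j i = 0) →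
      (∀ w ∈ S, opB j • w = c • w) → ∀ w : M, opB j • w = c • w := by
    intro j c hj hw w
    let P : Submodule ℂ M := Module.End.eigenspace (Algebra.lsmul ℂ ℂ M (opB j)) c
    have hP : ∀ w, w ∈ P ↔ opB j • w = c • w := fun w => Module.End.mem_eigenspace_iff
    let Q : Submodule UHV M :=
      { P with
        smul_mem' := fun x w hw => opB_smul_mem P (fun i w hw => by
          rw [hP] at hw ⊢
          have e : opB j * opB i = opB i * opB j := by
            have := opB_comm j i
            rwa [hj, map_zero, sub_eq_zero] at this
          rw [← mul_smul, e, mul_smul, hw, smul_algebra_smul_comm]) x hw }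
    have : Submodule.span UHV S ≤ Q := Submodule.span_le.mpr fun w h => (hP w).mpr (hw w h)
    rw [hS] at this
    exact (hP w).mp (this Submodule.mem_top)
  refine ⟨key .CL cL (fun i => ?_) hcl, key .CLI cLI (fun i => ?_) hcli, fun w => ?_⟩
  · cases i <;> rfl
  · cases i <;> rfl
  · have := key .CI 0 (fun i => by cases i <;> rfl) (fun w hw => by rw [hci w hw, zero_smul]) w
    rwa [zero_smul] at this

theorem IsLevelZero.map {cL cLI : ℂ} (hM : IsLevelZero M cL cLI) {N : Type} [AddCommGroup N]
    [Module ℂ N] [Module UHV N] [IsScalarTower ℂ UHV N] (f : M →ₗ[UHV] N)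
    (hf : Function.Surjective f) : IsLevelZero N cL cLI := by
  refine ⟨fun w => ?_, fun w => ?_, fun w => ?_⟩
  · obtain ⟨w, rfl⟩ := hf w
    rw [← map_smul, hM.cl, LinearMap.map_smul_of_tower]
  · obtain ⟨w, rfl⟩ := hf w
    rw [← map_smul, hM.cli, LinearMap.map_smul_of_tower]
  · obtain ⟨w, rfl⟩ := hf w
    rw [← map_smul, hM.ci, map_zero]

/-- `E` consists of vectors of weight `h` annihilated by `L(n), I(n)` for `n > 0`, and is stable
under `I(0)`; the central elements act on `M` by `cL, cLI, 0`. -/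
structure IsSingular (E : Submodule ℂ M) (cL cLI h : ℂ) : Prop extends IsLevelZero M cL cLI where
  killL : ∀ n > 0, ∀ w ∈ E, modeL n w = 0
  killI : ∀ n > 0, ∀ w ∈ E, modeI n w = 0
  weight : ∀ w ∈ E, modeL 0 w = h • w
  stable : ∀ w ∈ E, modeI 0 w ∈ E

/-- `M` is generated by a finite-dimensional space `E` of singular vectors of weight `h`. -/
structure IsLowestWeight (E : Submodule ℂ M) (cL cLI h : ℂ) : Prop
    extends IsSingular E cL cLI h where
  finite : FiniteDimensional ℂ E
  span : Submodule.span UHV (E : Set M) = ⊤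

/-- Words of degree `k` in the negative modes, applied to elements of `E`. -/
inductive IsWord (E : Submodule ℂ M) : ℤ → M → Prop
  | base (w : M) : w ∈ E → IsWord E 0 w
  | consL (n k : ℤ) (w : M) : 0 < n → IsWord E k w → IsWord E (k + n) (modeL (-n) w)
  | consI (n k : ℤ) (w : M) : 0 < n → IsWord E k w → IsWord E (k + n) (modeI (-n) w)

/-- The span of the words of degree `k`. -/
def wordSpan (E : Submodule ℂ M) (k : ℤ) : Submodule ℂ M := Submodule.span ℂ {w | IsWord E k w}

theorem IsWord.nonneg {E : Submodule ℂ M} {k : ℤ} {w : M} (h : IsWord E k w) : 0 ≤ k := by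
  induction h with
  | base => exact le_rfl
  | consL n k w hn _ ih => omega
  | consI n k w hn _ ih => omega

theorem wordSpan_neg (E : Submodule ℂ M) {k : ℤ} (hk : k < 0) : wordSpan E k = ⊥ := by
  rw [wordSpan, Submodule.span_eq_bot]
  intro w hw
  exact absurd (IsWord.nonneg hw) (by omega)

theorem modeL_mem_wordSpan (E : Submodule ℂ M) {n k : ℤ} (hn : 0 < n) {w : M}
    (hw : w ∈ wordSpan E k) : modeL (-n) w ∈ wordSpan E (k + n) := by
  have : wordSpan E k ≤ (wordSpan E (k + n)).comap (modeL (-n)) :=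
    Submodule.span_le.mpr fun w hw => Submodule.subset_span (.consL n k w hn hw)
  exact this hw

theorem modeI_mem_wordSpan (E : Submodule ℂ M) {n k : ℤ} (hn : 0 < n) {w : M}
    (hw : w ∈ wordSpan E k) : modeI (-n) w ∈ wordSpan E (k + n) := by
  have : wordSpan E k ≤ (wordSpan E (k + n)).comap (modeI (-n)) :=
    Submodule.span_le.mpr fun w hw => Submodule.subset_span (.consI n k w hn hw)
  exact this hw

theorem wordSpan_zero (E : Submodule ℂ M) : wordSpan E 0 = E := by
  refine le_antisymm (Submodule.span_le.mpr fun w hw => ?_)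
    fun w hw => Submodule.subset_span (.base w hw)
  have : ∀ k w, IsWord E k w → k = 0 → w ∈ E := by
    intro k w h
    cases h with
    | base w hw => exact fun _ => hw
    | consL n k w hn hw => exact fun hk => absurd hw.nonneg (by omega)
    | consI n k w hn hw => exact fun hk => absurd hw.nonneg (by omega)
  exact this 0 w hw rfl

/-- Peeling off the outermost letter reduces degree `k` to the finitely many degrees `k - n` with `0
< n ≤ k`. -/
theorem wordSpan_finite (E : Submodule ℂ M) [FiniteDimensional ℂ E] (k : ℤ) :
    FiniteDimensional ℂ (wordSpan E k) := by
  have key : ∀ m : ℕ, ∀ k : ℤ, k < m → FiniteDimensional ℂ (wordSpan E k) := by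
    intro m
    induction m with
    | zero => intro k hk; rw [wordSpan_neg E (by exact_mod_cast hk)]; infer_instance
    | succ m ih =>
      intro k hk
      have hf : ∀ n : Fin (m + 1), FiniteDimensional ℂ (wordSpan E (k - (n + 1 : ℕ))) := fun n =>
        ih _ (by push_cast at hk ⊢; omega)
      let S : Submodule ℂ M := E ⊔ (⨆ n : Fin (m + 1),
        ((wordSpan E (k - (n + 1 : ℕ))).map (modeL (-((n + 1 : ℕ) : ℤ))) ⊔
          (wordSpan E (k - (n + 1 : ℕ))).map (modeI (-((n + 1 : ℕ) : ℤ)))))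
      have hS : FiniteDimensional ℂ S := inferInstance
      refine Submodule.finiteDimensional_of_le (S₂ := S) (Submodule.span_le.mpr fun w hw => ?_)
      cases hw with
      | base w hw => exact Submodule.mem_sup_left hw
      | consL n k w hn hw =>
        have h0 := hw.nonneg
        obtain ⟨j, rfl⟩ : ∃ j : ℕ, n = (j + 1 : ℕ) := ⟨(n - 1).toNat, by push_cast; omega⟩
        refine Submodule.mem_sup_right (Submodule.mem_iSup_of_mem ⟨j, by push_cast at hk; omega⟩
          (Submodule.mem_sup_left ⟨w, ?_, rfl⟩))
        rw [add_sub_cancel_right]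
        exact Submodule.subset_span hw
      | consI n k w hn hw =>
        have h0 := hw.nonneg
        obtain ⟨j, rfl⟩ : ∃ j : ℕ, n = (j + 1 : ℕ) := ⟨(n - 1).toNat, by push_cast; omega⟩
        refine Submodule.mem_sup_right (Submodule.mem_iSup_of_mem ⟨j, by push_cast at hk; omega⟩
          (Submodule.mem_sup_right ⟨w, ?_, rfl⟩))
        rw [add_sub_cancel_right]
        exact Submodule.subset_span hw
  exact key (k.toNat + 1) k (by push_cast; omega)

/-! ### Words in the modes and their weights under `L(0)` -/

namespace IsSingular

variable {E : Submodule ℂ M} {cL cLI h : ℂ} (hE : IsSingular E cL cLI h)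

include hE

/-- Words are not ordered, so a mode only has to be commuted past one letter at a time until it
meets `E`; no ordered basis is involved. -/
theorem mode_word {k : ℤ} {w : M} (hw : IsWord E k w) :
    ∀ n : ℤ, modeL n w ∈ wordSpan E (k - n) ∧ modeI n w ∈ wordSpan E (k - n) := by
  induction hw with
  | base w hw =>
    have hw' : w ∈ wordSpan E 0 := (wordSpan_zero E).symm ▸ hw
    intro n
    rcases lt_trichotomy n 0 with hn | rfl | hn
    · have h1 := modeL_mem_wordSpan E (n := -n) (by omega) hw'
      have h2 := modeI_mem_wordSpan E (n := -n) (by omega) hw'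
      rw [neg_neg, ← sub_eq_add_neg] at h1 h2
      exact ⟨h1, h2⟩
    · rw [sub_zero, hE.weight w hw]
      exact ⟨Submodule.smul_mem _ _ hw', (wordSpan_zero E).symm ▸ hE.stable w hw⟩
    · rw [hE.killL n hn w hw, hE.killI n hn w hw]
      exact ⟨zero_mem _, zero_mem _⟩
  | consL m k w hm hw ih =>
    intro n
    have e : k + m - n = k - n + m := by ring
    have e' : k + m - n = k - (n + -m) := by ring
    rw [hE.LL, hE.IL]
    refine ⟨add_mem (add_mem (e ▸ modeL_mem_wordSpan E hm (ih n).1)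
      (Submodule.smul_mem _ _ (e' ▸ (ih _).1))) ?_,
      add_mem (add_mem (e ▸ modeL_mem_wordSpan E hm (ih n).2)
      (Submodule.smul_mem _ _ (e' ▸ (ih _).2))) ?_⟩
    all_goals
      split_ifs with hnm
      · have : k + m - n = k := by omega
        rw [this]
        exact Submodule.smul_mem _ _ (Submodule.subset_span hw)
      · rw [zero_smul]; exact zero_mem _
  | consI m k w hm hw ih =>
    intro n
    have e : k + m - n = k - n + m := by ring
    have e' : k + m - n = k - (n + -m) := by ring
    rw [hE.LI, hE.II]
    refine ⟨sub_mem (sub_mem (e ▸ modeI_mem_wordSpan E hm (ih n).1)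
      (Submodule.smul_mem _ _ (e' ▸ (ih _).2))) ?_, e ▸ modeI_mem_wordSpan E hm (ih n).2⟩
    split_ifs with hnm
    · have : k + m - n = k := by omega
      rw [this]
      exact Submodule.smul_mem _ _ (Submodule.subset_span hw)
    · rw [zero_smul]; exact zero_mem _

theorem modeL_mem {k : ℤ} {w : M} (hw : w ∈ wordSpan E k) (n : ℤ) :
    modeL n w ∈ wordSpan E (k - n) := by
  have : wordSpan E k ≤ (wordSpan E (k - n)).comap (modeL n) :=
    Submodule.span_le.mpr fun w hw => (hE.mode_word hw n).1
  exact this hw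

theorem modeI_mem {k : ℤ} {w : M} (hw : w ∈ wordSpan E k) (n : ℤ) :
    modeI n w ∈ wordSpan E (k - n) := by
  have : wordSpan E k ≤ (wordSpan E (k - n)).comap (modeI n) :=
    Submodule.span_le.mpr fun w hw => (hE.mode_word hw n).2
  exact this hw

theorem wordSpan_le (k : ℤ) : wordSpan E k ≤ Module.End.eigenspace (modeL 0) (h + k) := by
  refine Submodule.span_le.mpr fun w hw => ?_
  rw [SetLike.mem_coe, Module.End.mem_eigenspace_iff]
  induction hw with
  | base w hw => rw [hE.weight w hw]; simp
  | consL m k w hm hw ih =>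
    rw [hE.LL, ih, map_smul, if_neg (by omega), zero_add]
    push_cast
    module
  | consI m k w hm hw ih =>
    rw [hE.LI, ih, map_smul, if_neg (by omega), zero_add]
    push_cast
    module

theorem span_le_iSup {w : M} (hw : w ∈ Submodule.span UHV (E : Set M)) :
    w ∈ ⨆ k, wordSpan E k := by
  have hmap : ∀ f : Module.End ℂ M, ∀ n : ℤ, (∀ k, ∀ w ∈ wordSpan E k, f w ∈ wordSpan E (k - n)) →
      ∀ w ∈ ⨆ k, wordSpan E k, f w ∈ ⨆ k, wordSpan E k := by
    intro f n hf w hw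
    have : ⨆ k, wordSpan E k ≤ (⨆ k, wordSpan E k).comap f :=
      iSup_le fun k w hw => Submodule.mem_iSup_of_mem (k - n) (hf k w hw)
    exact this hw
  let Q : Submodule UHV M :=
    { ⨆ k, wordSpan E k with
      smul_mem' := fun x w hw => hE.toIsLevelZero.smul_mem _
        (fun n => hmap _ n fun k w hw => hE.modeL_mem hw n)
        (fun n => hmap _ n fun k w hw => hE.modeI_mem hw n) x hw }
  have hQ : (E : Set M) ⊆ Q := fun w hw =>
    Submodule.mem_iSup_of_mem 0 ((wordSpan_zero E).symm ▸ hw : w ∈ wordSpan E 0)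
  exact Submodule.span_le.mpr hQ hw

theorem le_eigenspace : E ≤ Module.End.eigenspace (modeL 0) h := fun w hw =>
  Module.End.mem_eigenspace_iff.mpr (hE.weight w hw)

/-- Submodules generated by singular vectors of higher weight do not meet `E`. -/
theorem eq_zero_of_mem {F : Submodule ℂ M} {k : ℤ} (hk : 0 < k) (hF : IsSingular F cL cLI (h + k))
    {w : M} (hw : w ∈ Submodule.span UHV (F : Set M)) (hw' : w ∈ E) : w = 0 := by
  have h1 : ⨆ j, wordSpan F j ≤ ⨆ (t) (_ : t ≠ h), Module.End.eigenspace (modeL 0) t := by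
    refine iSup_le fun j => ?_
    rcases lt_or_ge j 0 with hj | hj
    · rw [wordSpan_neg F hj]; exact bot_le
    -- What `F` generates has weights `h + k + j` with `k + j > 0`, never `h`.
    · refine (hF.wordSpan_le j).trans (le_iSup₂_of_le (h + k + j) (fun he => ?_) le_rfl)
      have : ((k + j : ℤ) : ℂ) = (0 : ℤ) := by
        push_cast
        linear_combination he
      have := Int.cast_injective this
      omega
  exact Submodule.disjoint_def.mp (Module.End.eigenspaces_iSupIndep (modeL 0) h) w
    (hE.le_eigenspace hw') (h1 (hF.span_le_iSup hw))

theorem map {N : Type} [AddCommGroup N] [Module ℂ N] [Module UHV N] [IsScalarTower ℂ UHV N]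
    (f : M →ₗ[UHV] N) (hN : IsLevelZero N cL cLI) :
    IsSingular (E.map (f.restrictScalars ℂ)) cL cLI h := by
  have hL : ∀ n w, modeL n (f w) = f (modeL n w) := fun n w => (f.map_smul _ w).symm
  have hI : ∀ n w, modeI n (f w) = f (modeI n w) := fun n w => (f.map_smul _ w).symm
  refine { hN with killL := ?_, killI := ?_, weight := ?_, stable := ?_ }
  · rintro n hn _ ⟨w, hw, rfl⟩
    rw [LinearMap.restrictScalars_apply, hL, hE.killL n hn w hw, map_zero]
  · rintro n hn _ ⟨w, hw, rfl⟩
    rw [LinearMap.restrictScalars_apply, hI, hE.killI n hn w hw, map_zero]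
  · rintro _ ⟨w, hw, rfl⟩
    rw [LinearMap.restrictScalars_apply, hL, hE.weight w hw, LinearMap.map_smul_of_tower]
  · rintro _ ⟨w, hw, rfl⟩
    rw [LinearMap.restrictScalars_apply, hI]
    exact ⟨_, hE.stable w hw, rfl⟩

end IsSingular

namespace IsLowestWeight

variable {E : Submodule ℂ M} {cL cLI h : ℂ} (hE : IsLowestWeight E cL cLI h)

include hE

theorem iSup_wordSpan : ⨆ k, wordSpan E k = ⊤ :=
  eq_top_iff.mpr fun _ _ => hE.span_le_iSup (hE.span ▸ Submodule.mem_top)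

theorem eigenspace_eq (k : ℤ) : Module.End.eigenspace (modeL 0) (h + k) = wordSpan E k := by
  rw [eigenspace_eq_iSup _ _ _ hE.wordSpan_le hE.iSup_wordSpan]
  refine le_antisymm (iSup₂_le fun i hi => ?_) (le_iSup₂_of_le k rfl le_rfl)
  rw [Int.cast_injective (add_left_cancel hi)]

theorem eigenspace_eq_bot {s : ℂ} (hs : ∀ k : ℤ, 0 ≤ k → s ≠ h + k) :
    Module.End.eigenspace (modeL 0 : Module.End ℂ M) s = ⊥ := by
  rw [eigenspace_eq_iSup _ _ _ hE.wordSpan_le hE.iSup_wordSpan, eq_bot_iff]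
  refine iSup₂_le fun i hi => ?_
  rw [wordSpan_neg]
  by_contra h0
  exact hs i (by omega) hi.symm

theorem iSup_eigenspace : ⨆ k : ℤ, Module.End.eigenspace (modeL 0 : Module.End ℂ M) (h + k) = ⊤ := by
  rw [← hE.iSup_wordSpan]
  exact iSup_congr fun k => hE.eigenspace_eq k

theorem isInternal : DirectSum.IsInternal fun s : ℂ =>
    Module.End.eigenspace (modeL 0 : Module.End ℂ M) s := by
  rw [DirectSum.isInternal_submodule_iff_iSupIndep_and_iSup_eq_top]
  refine ⟨Module.End.eigenspaces_iSupIndep _, eq_top_iff.mpr ?_⟩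
  rw [← hE.iSup_eigenspace]
  exact iSup_le fun k => le_iSup_of_le (h + k) le_rfl

theorem isInternal_int : DirectSum.IsInternal fun k : ℤ =>
    Module.End.eigenspace (modeL 0 : Module.End ℂ M) (h + k) := by
  rw [DirectSum.isInternal_submodule_iff_iSupIndep_and_iSup_eq_top]
  exact ⟨(Module.End.eigenspaces_iSupIndep _).comp
    ((add_right_injective h).comp Int.cast_injective), hE.iSup_eigenspace⟩

theorem isInternal_nat : DirectSum.IsInternal fun k : ℕ =>
    Module.End.eigenspace (modeL 0 : Module.End ℂ M) (h + k) := by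
  rw [DirectSum.isInternal_submodule_iff_iSupIndep_and_iSup_eq_top]
  refine ⟨(Module.End.eigenspaces_iSupIndep _).comp
    ((add_right_injective h).comp Nat.cast_injective), eq_top_iff.mpr ?_⟩
  rw [← hE.iSup_eigenspace]
  refine iSup_le fun k => ?_
  rcases lt_or_ge k 0 with hk | hk
  · rw [hE.eigenspace_eq, wordSpan_neg E hk]; exact bot_le
  · obtain ⟨n, rfl⟩ := Int.eq_ofNat_of_zero_le hk
    exact le_iSup_of_le n (by simp)

theorem eigenspace_finite (s : ℂ) :
    FiniteDimensional ℂ (Module.End.eigenspace (modeL 0 : Module.End ℂ M) s) := by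
  have := hE.finite
  by_cases hs : ∃ k : ℤ, s = h + k
  · obtain ⟨k, rfl⟩ := hs
    rw [hE.eigenspace_eq]
    exact wordSpan_finite E k
  · rw [hE.eigenspace_eq_bot fun k _ hk => hs ⟨k, hk⟩]
    infer_instance

theorem eigenspace_bounded (s : ℂ) : ∃ N : ℤ, ∀ n < N,
    Module.End.eigenspace (modeL 0 : Module.End ℂ M) (s + n) = ⊥ := by
  by_cases hs : ∃ k : ℤ, s = h + k
  · obtain ⟨k, rfl⟩ := hs
    refine ⟨-k, fun n hn => hE.eigenspace_eq_bot fun j hj he => ?_⟩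
    have : ((k + n : ℤ) : ℂ) = j := by
      push_cast
      linear_combination he
    have := Int.cast_injective this
    omega
  · refine ⟨0, fun n _ => hE.eigenspace_eq_bot fun k _ hk => hs ⟨k - n, ?_⟩⟩
    push_cast
    linear_combination hk

theorem isRestricted : IsRestricted M cL cLI := by
  refine ⟨hE.toIsLevelZero, fun w => ?_⟩
  have hw : w ∈ ⨆ k, wordSpan E k := hE.iSup_wordSpan ▸ Submodule.mem_top
  induction hw using Submodule.iSup_induction' with
  | mem k w hw =>
    refine ⟨k + 1, fun n hn => ?_⟩
    have h1 := hE.modeL_mem hw n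
    have h2 := hE.modeI_mem hw n
    rw [wordSpan_neg E (by omega), Submodule.mem_bot] at h1 h2
    exact ⟨h1, h2⟩
  | zero => exact ⟨0, fun n _ => by simp⟩
  | add x y _ _ hx hy =>
    obtain ⟨K, hK⟩ := hx
    obtain ⟨K', hK'⟩ := hy
    refine ⟨max K K', fun n hn => ?_⟩
    rw [map_add, map_add, (hK n (by omega)).1, (hK n (by omega)).2, (hK' n (by omega)).1,
      (hK' n (by omega)).2, add_zero]
    exact ⟨rfl, rfl⟩

theorem map {N : Type} [AddCommGroup N] [Module ℂ N] [Module UHV N] [IsScalarTower ℂ UHV N]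
    (f : M →ₗ[UHV] N) (hf : Function.Surjective f) :
    IsLowestWeight (E.map (f.restrictScalars ℂ)) cL cLI h := by
  have := hE.finite
  refine { hE.toIsSingular.map f (hE.toIsLevelZero.map f hf) with
    finite := inferInstance, span := ?_ }
  have : ((E.map (f.restrictScalars ℂ) : Submodule ℂ N) : Set N) = f '' (E : Set M) := rfl
  rw [this, ← Submodule.map_span, hE.span, Submodule.map_top, LinearMap.range_eq_top.mpr hf]

end IsLowestWeight

end Generated

/-! ### Irreducibility of a highest weight module with a singular vector of degree one -/

section Irreducible

variable {M : Type} [AddCommGroup M] [Module ℂ M] [Module UHV M] [IsScalarTower ℂ UHV M]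

/-- Words in `L(-n)` for `n ≥ 2` and `I(-n)` for `n ≥ 1` applied to `v`, where `L(-n)` has weight
`2n + 1` and `I(-n)` has weight `2n - 1`. -/
inductive IsFiltWord (v : M) : ℤ → M → Prop
  | base (p : ℤ) : 0 ≤ p → IsFiltWord v p v
  | consL (n p : ℤ) (w : M) : 2 ≤ n → IsFiltWord v p w →
      IsFiltWord v (p + (2 * n + 1)) (modeL (-n) w)
  | consI (n p : ℤ) (w : M) : 1 ≤ n → IsFiltWord v p w →
      IsFiltWord v (p + (2 * n - 1)) (modeI (-n) w)

/-- The filtration by weight. -/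
def filt (v : M) (p : ℤ) : Submodule ℂ M := Submodule.span ℂ {w | IsFiltWord v p w}

theorem IsFiltWord.nonneg {v : M} {p : ℤ} {w : M} (h : IsFiltWord v p w) : 0 ≤ p := by
  induction h with
  | base p hp => exact hp
  | consL n k w hn _ ih => omega
  | consI n k w hn _ ih => omega

theorem IsFiltWord.mono {v : M} {p : ℤ} {w : M} (h : IsFiltWord v p w) :
    ∀ {q : ℤ}, p ≤ q → IsFiltWord v q w := by
  induction h with
  | base p hp => exact fun hq => .base _ (hp.trans hq)
  | consL n p w hn _ ih =>
    intro q hq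
    have := IsFiltWord.consL n _ w hn (ih (q := q - (2 * n + 1)) (by omega))
    rwa [sub_add_cancel] at this
  | consI n p w hn _ ih =>
    intro q hq
    have := IsFiltWord.consI n _ w hn (ih (q := q - (2 * n - 1)) (by omega))
    rwa [sub_add_cancel] at this

theorem filt_mono (v : M) {p q : ℤ} (h : p ≤ q) : filt v p ≤ filt v q :=
  Submodule.span_mono fun _ hw => hw.mono h

theorem filt_neg (v : M) {p : ℤ} (hp : p < 0) : filt v p = ⊥ := by
  rw [filt, Submodule.span_eq_bot]
  intro w hw
  exact absurd (IsFiltWord.nonneg hw) (by omega)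

theorem filt_zero (v : M) : filt v 0 ≤ Submodule.span ℂ {v} := by
  refine Submodule.span_le.mpr fun w hw => ?_
  have : ∀ k w, IsFiltWord v k w → k = 0 → w ∈ Submodule.span ℂ {v} := by
    intro k w h
    cases h with
    | base => exact fun _ => Submodule.mem_span_singleton_self v
    | consL n k w hn hw => exact fun hk => absurd hw.nonneg (by omega)
    | consI n k w hn hw => exact fun hk => absurd hw.nonneg (by omega)
  exact this 0 w hw rfl

theorem modeL_mem_filt (v : M) {n p : ℤ} (hn : 2 ≤ n) {w : M} (hw : w ∈ filt v p) :
    modeL (-n) w ∈ filt v (p + (2 * n + 1)) := by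
  have : filt v p ≤ (filt v (p + (2 * n + 1))).comap (modeL (-n)) :=
    Submodule.span_le.mpr fun w hw => Submodule.subset_span (.consL n p w hn hw)
  exact this hw

theorem modeI_mem_filt (v : M) {n p : ℤ} (hn : 1 ≤ n) {w : M} (hw : w ∈ filt v p) :
    modeI (-n) w ∈ filt v (p + (2 * n - 1)) := by
  have : filt v p ≤ (filt v (p + (2 * n - 1))).comap (modeI (-n)) :=
    Submodule.span_le.mpr fun w hw => Submodule.subset_span (.consI n p w hn hw)
  exact this hw

variable (M) in
/-- `v` is a vector of weight `h` annihilated by `L(n)` for `n > 0` and `I(n)` for `n ≥ 0`. -/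
structure IsHighestWeight (cL cLI : ℂ) (v : M) (h : ℂ) : Prop extends IsLevelZero M cL cLI where
  killL : ∀ n > 0, modeL n v = 0
  killI : ∀ n ≥ 0, modeI n v = 0
  weight : modeL 0 v = h • v

variable (M) in
/-- `M` is generated by a highest weight vector `v` on which `L(-1)` is proportional to `I(-1)`. -/
structure IsSpecial (cL cLI : ℂ) (v : M) (h a : ℂ) : Prop extends IsHighestWeight M cL cLI v h where
  singular : modeL (-1) v = a • modeI (-1) v
  span : Submodule.span UHV {v} = ⊤

namespace IsSpecial

variable {cL cLI h a : ℂ} {v : M} (hv : IsSpecial M cL cLI v h a)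

include hv

/-- With these weights a commutator of two modes loses one unit, while the `cLI`-term has exactly
the sum of the two weights, namely zero. The mode `L(-1)` is not a letter: when it reaches `v` it
becomes a multiple of `I(-1)`, of smaller weight. -/
theorem mode_filtWord {p : ℤ} {w : M} (hw : IsFiltWord v p w) : ∀ n : ℤ,
    modeL n w ∈ filt v (p + (1 - 2 * n)) ∧ modeI n w ∈ filt v (p + (-1 - 2 * n)) := by
  induction hw with
  | base p hp =>
    have hv' : ∀ q, 0 ≤ q → v ∈ filt v q := fun q hq => Submodule.subset_span (.base _ hq)
    have hI : ∀ n, modeI n v ∈ filt v (p + (-1 - 2 * n)) := by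
      intro n
      rcases lt_or_ge n 0 with hn | hn
      · have := modeI_mem_filt v (n := -n) (by omega) (hv' p hp)
        rw [neg_neg] at this
        exact filt_mono v (by omega) this
      · rw [hv.killI n hn]; exact zero_mem _
    refine fun n => ⟨?_, hI n⟩
    rcases lt_trichotomy n 0 with hn | rfl | hn
    · rcases eq_or_ne n (-1) with rfl | hn'
      · rw [hv.singular]
        exact Submodule.smul_mem _ _ (filt_mono v (by omega) (hI (-1)))
      · have := modeL_mem_filt v (n := -n) (by omega) (hv' p hp)
        rw [neg_neg] at this
        exact filt_mono v (by omega) this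
    · rw [hv.weight]
      exact Submodule.smul_mem _ _ (hv' _ (by omega))
    · rw [hv.killL n hn]; exact zero_mem _
  | consL m p w hm hw ih =>
    intro n
    rw [hv.LL, hv.IL]
    refine ⟨add_mem (add_mem (filt_mono v (by omega) (modeL_mem_filt v hm (ih n).1))
      (Submodule.smul_mem _ _ (filt_mono v (by omega) (ih _).1))) ?_,
      add_mem (add_mem (filt_mono v (by omega) (modeL_mem_filt v hm (ih n).2))
      (Submodule.smul_mem _ _ (filt_mono v (by omega) (ih _).2))) ?_⟩
    all_goals
      split_ifs with hnm
      · exact Submodule.smul_mem _ _ (filt_mono v (by omega) (Submodule.subset_span hw))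
      · rw [zero_smul]; exact zero_mem _
  | consI m p w hm hw ih =>
    intro n
    rw [hv.LI, hv.II]
    refine ⟨sub_mem (sub_mem (filt_mono v (by omega) (modeI_mem_filt v hm (ih n).1))
      (Submodule.smul_mem _ _ (filt_mono v (by omega) (ih _).2))) ?_,
      filt_mono v (by omega) (modeI_mem_filt v hm (ih n).2)⟩
    split_ifs with hnm
    · exact Submodule.smul_mem _ _ (filt_mono v (by omega) (Submodule.subset_span hw))
    · rw [zero_smul]; exact zero_mem _

theorem modeL_mem {p q : ℤ} {w : M} (hw : w ∈ filt v p) (n : ℤ) (hq : p + (1 - 2 * n) ≤ q) :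
    modeL n w ∈ filt v q := by
  have : filt v p ≤ (filt v (p + (1 - 2 * n))).comap (modeL n) :=
    Submodule.span_le.mpr fun w hw => (hv.mode_filtWord hw n).1
  exact filt_mono v hq (this hw)

theorem modeI_mem {p q : ℤ} {w : M} (hw : w ∈ filt v p) (n : ℤ) (hq : p + (-1 - 2 * n) ≤ q) :
    modeI n w ∈ filt v q := by
  have : filt v p ≤ (filt v (p + (-1 - 2 * n))).comap (modeI n) :=
    Submodule.span_le.mpr fun w hw => (hv.mode_filtWord hw n).2
  exact filt_mono v hq (this hw)

theorem exists_mem_filt (w : M) : ∃ p : ℕ, w ∈ filt v p := by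
  have hmono : Monotone fun p : ℕ => filt v p := fun p q hpq => filt_mono v (by exact_mod_cast hpq)
  have hw : w ∈ ⨆ p : ℕ, filt v p := by
    have hmap : ∀ f : Module.End ℂ M, ∀ n : ℤ, (∀ p, ∀ w ∈ filt v p, f w ∈ filt v (p + n)) →
        ∀ w ∈ ⨆ p : ℕ, filt v p, f w ∈ ⨆ p : ℕ, filt v p := by
      intro f n hf w hw
      have : ⨆ p : ℕ, filt v p ≤ (⨆ p : ℕ, filt v p).comap f :=
        iSup_le fun p w hw => Submodule.mem_iSup_of_mem (p + n).toNat
          (filt_mono v (by omega) (hf p w hw))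
      exact this hw
    let Q : Submodule UHV M :=
      { ⨆ p : ℕ, filt v p with
        smul_mem' := fun x w hw => hv.toIsLevelZero.smul_mem _
          (fun n => hmap _ (1 - 2 * n) fun k w hw => hv.modeL_mem hw n le_rfl)
          (fun n => hmap _ (-1 - 2 * n) fun k w hw => hv.modeI_mem hw n le_rfl) x hw }
    have hQ : Submodule.span UHV {v} ≤ Q := (Submodule.span_singleton_le_iff_mem _ _).mpr
      (Submodule.mem_iSup_of_mem 0 (Submodule.subset_span (.base _ le_rfl) : v ∈ filt v 0))
    rw [hv.span] at hQ
    exact hQ Submodule.mem_top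
  exact (Submodule.mem_iSup_of_directed _ hmono.directed_le).mp hw

end IsSpecial

/-- The summands of the operator measuring the weight. -/
noncomputable def weightOp (cLI : ℂ) (j : ℤ) : Module.End ℂ M :=
  -- Up to lower terms `[I(j), L(-j)]` is `(j^2 - j) cLI` and `[L(j), I(-j)]` is `-(j^2 + j) cLI`,
  -- so the two summands count letters with their weights. At `j = 1` the first coefficient is a
  -- division by zero, hence `0`, in accordance with `L(-1)` not being a letter.
  ((2 * j + 1) / (((j : ℂ) ^ 2 - j) * cLI)) • (modeL (-j) * modeI j) -
    ((2 * j - 1) / (((j : ℂ) ^ 2 + j) * cLI)) • (modeI (-j) * modeL j)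

namespace IsSpecial

variable {cL cLI h a : ℂ} {v : M} (hv : IsSpecial M cL cLI v h a)

include hv

/-- Up to lower weight, `weightOp` is a derivation counting the letter: only the central term of
`[I(j), L(-j)]` keeps the full weight `p + (2 * m + 1)`, and everything else drops by at least one.
-/
theorem weightOp_modeL (hc : cLI ≠ 0) {j m p : ℤ} (hj : 1 ≤ j) (hm : 2 ≤ m) {w : M} (hw : w ∈ filt v p) :
    weightOp cLI j (modeL (-m) w) - modeL (-m) (weightOp cLI j w) -
      (if j = m then (2 * m + 1 : ℂ) else 0) • modeL (-m) w ∈ filt v (p + 2 * m) := by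
  have e1 : modeL (-j) (modeI j (modeL (-m) w)) - modeL (-m) (modeL (-j) (modeI j w)) =
      ((m - j : ℂ)) • modeL (-j + -m) (modeI j w) + (j : ℂ) • modeL (-j) (modeI (j + -m) w) +
        ((if j = m then ((j : ℂ) ^ 2 - j) * cLI else 0)) • modeL (-j) w := by
    rw [hv.IL, map_add, map_add, map_smul, map_smul, hv.LL (-j) (-m), if_neg (by omega : ¬ -j = - -m),
      neg_neg]
    push_cast
    module
  have e2 : modeI (-j) (modeL j (modeL (-m) w)) - modeL (-m) (modeI (-j) (modeL j w)) =
      (-j : ℂ) • modeI (-j + -m) (modeL j w) + (j + m : ℂ) • modeI (-j) (modeL (j + -m) w) +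
        ((if j = m then ((j : ℂ) ^ 3 - j) / 12 * cL else 0)) • modeI (-j) w := by
    rw [hv.LL, map_add, map_add, map_smul, map_smul, hv.IL (-j) (-m), if_neg (by omega : ¬ -j = - -m),
      neg_neg]
    push_cast
    module
  have e3 : (2 * j + 1) / (((j : ℂ) ^ 2 - j) * cLI) * (if j = m then ((j : ℂ) ^ 2 - j) * cLI else 0) =
      if j = m then (2 * m + 1 : ℂ) else 0 := by
    split_ifs with hjm
    · subst hjm
      have h1 : (j : ℂ) ≠ 0 := by exact_mod_cast (by omega : j ≠ 0)
      have h2 : (j : ℂ) - 1 ≠ 0 := by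
        rw [sub_ne_zero]; exact_mod_cast (by omega : j ≠ 1)
      have h3 : ((j : ℂ) ^ 2 - j) * cLI ≠ 0 := by
        rw [show (j : ℂ) ^ 2 - j = j * (j - 1) by ring]
        exact mul_ne_zero (mul_ne_zero h1 h2) hc
      exact div_mul_cancel₀ _ h3
    · rw [mul_zero]
  have e4 : (if j = m then (2 * m + 1 : ℂ) else 0) • modeL (-m) w =
      (if j = m then (2 * m + 1 : ℂ) else 0) • modeL (-j) w := by
    split_ifs with hjm
    · rw [hjm]
    · rw [zero_smul, zero_smul]
  have e5 : weightOp cLI j (modeL (-m) w) - modeL (-m) (weightOp cLI j w) -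
      (if j = m then (2 * m + 1 : ℂ) else 0) • modeL (-m) w =
      ((2 * j + 1) / (((j : ℂ) ^ 2 - j) * cLI)) •
        ((m - j : ℂ) • modeL (-j + -m) (modeI j w) + (j : ℂ) • modeL (-j) (modeI (j + -m) w)) -
      ((2 * j - 1) / (((j : ℂ) ^ 2 + j) * cLI)) •
        ((-j : ℂ) • modeI (-j + -m) (modeL j w) + (j + m : ℂ) • modeI (-j) (modeL (j + -m) w) +
        ((if j = m then ((j : ℂ) ^ 3 - j) / 12 * cL else 0)) • modeI (-j) w) := by
    rw [e4, ← e3, mul_smul]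
    simp only [weightOp, LinearMap.sub_apply, LinearMap.smul_apply, Module.End.mul_apply, map_sub,
      map_smul]
    rw [eq_add_of_sub_eq e1, eq_add_of_sub_eq e2]
    module
  rw [e5]
  refine sub_mem (Submodule.smul_mem _ _ (add_mem (Submodule.smul_mem _ _ ?_)
    (Submodule.smul_mem _ _ ?_))) (Submodule.smul_mem _ _ (add_mem (add_mem
      (Submodule.smul_mem _ _ ?_) (Submodule.smul_mem _ _ ?_)) ?_))
  · exact hv.modeL_mem (hv.modeI_mem hw _ le_rfl) _ (by omega)
  · exact hv.modeL_mem (hv.modeI_mem hw _ le_rfl) _ (by omega)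
  · exact hv.modeI_mem (hv.modeL_mem hw _ le_rfl) _ (by omega)
  · exact hv.modeI_mem (hv.modeL_mem hw _ le_rfl) _ (by omega)
  · split_ifs with hjm
    · exact Submodule.smul_mem _ _ (hv.modeI_mem hw _ (by omega))
    · rw [zero_smul]; exact zero_mem _

/-- The same count for the other kind of letter, now through the central term of `[L(j), I(-j)]`. -/
theorem weightOp_modeI (hc : cLI ≠ 0) {j m p : ℤ} (hj : 1 ≤ j) (hm : 1 ≤ m) {w : M}
    (hw : w ∈ filt v p) :
    weightOp cLI j (modeI (-m) w) - modeI (-m) (weightOp cLI j w) -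
      (if j = m then (2 * m - 1 : ℂ) else 0) • modeI (-m) w ∈ filt v (p + (2 * m - 2)) := by
  have e1 : modeL (-j) (modeI j (modeI (-m) w)) - modeI (-m) (modeL (-j) (modeI j w)) =
      (m : ℂ) • modeI (-j + -m) (modeI j w) := by
    rw [hv.II, hv.LI (-j) (-m), if_neg (by omega : ¬ -j = - -m)]
    push_cast
    module
  have e2 : modeI (-j) (modeL j (modeI (-m) w)) - modeI (-m) (modeI (-j) (modeL j w)) =
      (m : ℂ) • modeI (-j) (modeI (j + -m) w) -
        ((if j = m then ((j : ℂ) ^ 2 + j) * cLI else 0)) • modeI (-j) w := by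
    rw [hv.LI, map_sub, map_sub, map_smul, map_smul, hv.II (-j) (-m), neg_neg]
    push_cast
    module
  have e3 : (2 * j - 1) / (((j : ℂ) ^ 2 + j) * cLI) * (if j = m then ((j : ℂ) ^ 2 + j) * cLI else 0) =
      if j = m then (2 * m - 1 : ℂ) else 0 := by
    split_ifs with hjm
    · subst hjm
      have h1 : (j : ℂ) ≠ 0 := by exact_mod_cast (by omega : j ≠ 0)
      have h2 : (j : ℂ) + 1 ≠ 0 := by exact_mod_cast (by omega : j + 1 ≠ 0)
      have h3 : ((j : ℂ) ^ 2 + j) * cLI ≠ 0 := by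
        rw [show (j : ℂ) ^ 2 + j = j * (j + 1) by ring]
        exact mul_ne_zero (mul_ne_zero h1 h2) hc
      exact div_mul_cancel₀ _ h3
    · rw [mul_zero]
  have e4 : (if j = m then (2 * m - 1 : ℂ) else 0) • modeI (-m) w =
      (if j = m then (2 * m - 1 : ℂ) else 0) • modeI (-j) w := by
    split_ifs with hjm
    · rw [hjm]
    · rw [zero_smul, zero_smul]
  have e5 : weightOp cLI j (modeI (-m) w) - modeI (-m) (weightOp cLI j w) -
      (if j = m then (2 * m - 1 : ℂ) else 0) • modeI (-m) w =
      ((2 * j + 1) / (((j : ℂ) ^ 2 - j) * cLI)) • (m : ℂ) • modeI (-j + -m) (modeI j w) -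
      ((2 * j - 1) / (((j : ℂ) ^ 2 + j) * cLI)) • (m : ℂ) • modeI (-j) (modeI (j + -m) w) := by
    rw [← e1, e4, ← e3, mul_smul, eq_add_of_sub_eq e2.symm]
    simp only [weightOp, LinearMap.sub_apply, LinearMap.smul_apply, Module.End.mul_apply, map_sub,
      map_smul]
    module
  rw [e5]
  refine sub_mem (Submodule.smul_mem _ _ (Submodule.smul_mem _ _ ?_))
    (Submodule.smul_mem _ _ (Submodule.smul_mem _ _ ?_))
  · exact hv.modeI_mem (hv.modeI_mem hw _ le_rfl) _ (by omega)
  · exact hv.modeI_mem (hv.modeI_mem hw _ le_rfl) _ (by omega)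

/-- An Euler identity: adding the counts of all letters returns the weight, up to lower terms. The
bound `p ≤ K` ensures that every letter of the word is among those counted. -/
theorem sum_weightOp (hc : cLI ≠ 0) {K p : ℤ} (hp : p ≤ K) {w : M} (hw : w ∈ filt v p) :
    ∑ j ∈ Finset.Icc 1 K, weightOp cLI j w - (p : ℂ) • w ∈ filt v (p - 1) := by
  have hword : ∀ p w, IsFiltWord v p w → p ≤ K →
      ∑ j ∈ Finset.Icc 1 K, weightOp cLI j w - (p : ℂ) • w ∈ filt v (p - 1) := by
    intro p w hw
    induction hw with
    | base p hp =>
      intro _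
      have : ∑ j ∈ Finset.Icc 1 K, weightOp cLI j v = 0 := Finset.sum_eq_zero fun j hj => by
        rw [Finset.mem_Icc] at hj
        simp [weightOp, hv.killI j (by omega), hv.killL j (by omega)]
      rw [this, zero_sub]
      -- `v` belongs to every `filt v p` with `p ≥ 0`, so for `p > 0` the multiple of `v` is already
      -- a lower term.
      rcases eq_or_ne p 0 with rfl | h0
      · simp
      · exact neg_mem (Submodule.smul_mem _ _ (Submodule.subset_span (.base _ (by omega))))
    | consL m p w hm hw ih =>
      intro hK
      have h0 := hw.nonneg
      have h1 := modeL_mem_filt v hm (ih (by omega))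
      have h2 := Submodule.sum_mem (filt v (p + 2 * m)) fun j (hj : j ∈ Finset.Icc 1 K) =>
        hv.weightOp_modeL hc (Finset.mem_Icc.mp hj).1 hm (Submodule.subset_span hw)
      rw [Finset.sum_sub_distrib, Finset.sum_sub_distrib, ← map_sum, ← Finset.sum_smul,
        Finset.sum_ite_eq', if_pos (Finset.mem_Icc.mpr (by omega))] at h2
      have h3 := add_mem (filt_mono v (by omega : p + 2 * m ≤ p + (2 * m + 1) - 1) h2)
        (filt_mono v (by omega : p - 1 + (2 * m + 1) ≤ p + (2 * m + 1) - 1) h1)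
      convert h3 using 1
      rw [map_sub, map_smul]
      push_cast
      module
    | consI m p w hm hw ih =>
      intro hK
      have h0 := hw.nonneg
      have h1 := modeI_mem_filt v hm (ih (by omega))
      have h2 := Submodule.sum_mem (filt v (p + (2 * m - 2))) fun j (hj : j ∈ Finset.Icc 1 K) =>
        hv.weightOp_modeI hc (Finset.mem_Icc.mp hj).1 hm (Submodule.subset_span hw)
      rw [Finset.sum_sub_distrib, Finset.sum_sub_distrib, ← map_sum, ← Finset.sum_smul,
        Finset.sum_ite_eq', if_pos (Finset.mem_Icc.mpr (by omega))] at h2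
      have h3 := add_mem (filt_mono v (by omega : p + (2 * m - 2) ≤ p + (2 * m - 1) - 1) h2)
        (filt_mono v (by omega : p - 1 + (2 * m - 1) ≤ p + (2 * m - 1) - 1) h1)
      convert h3 using 1
      rw [map_sub, map_smul]
      push_cast
      module
  have : filt v p ≤ (filt v (p - 1)).comap
      (∑ j ∈ Finset.Icc 1 K, weightOp cLI j - (p : ℂ) • (1 : Module.End ℂ M)) :=
    Submodule.span_le.mpr fun w hw => by simpa using hword p w hw hp
  simpa using this hw

/-- Take a nonzero element `w` of `N` of least filtration degree `p`. Positive modes lower the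
degree, so they kill `w`, and so do all the `weightOp`; by `sum_weightOp` then `p • w` lies one step
lower, forcing `p = 0`. In degree `0` there are only multiples of `v`. -/
theorem mem_of_ne_bot (hc : cLI ≠ 0) (N : Submodule UHV M) (hN : N ≠ ⊥) : v ∈ N := by
  classical
  obtain ⟨w₀, hw₀, hne₀⟩ := (Submodule.ne_bot_iff N).mp hN
  have hex : ∃ p : ℕ, ∃ w ∈ N, w ≠ 0 ∧ w ∈ filt v p := by
    obtain ⟨p, hp⟩ := hv.exists_mem_filt w₀
    exact ⟨p, w₀, hw₀, hne₀, hp⟩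
  obtain ⟨w, hwN, hne, hwp⟩ := Nat.find_spec hex
  set p := Nat.find hex with hpdef
  have hmin : ∀ q : ℤ, q < p → ∀ w ∈ N, w ∈ filt v q → w = 0 := by
    intro q hq w hw hwq
    by_contra h0
    rcases lt_or_ge q 0 with h1 | h1
    · rw [filt_neg v h1, Submodule.mem_bot] at hwq
      exact h0 hwq
    · obtain ⟨n, rfl⟩ := Int.eq_ofNat_of_zero_le h1
      exact Nat.find_min hex (m := n) (by exact_mod_cast hq) ⟨w, hw, h0, hwq⟩
  have hp0 : p = 0 := by
    by_contra hp0
    have h1 := hv.sum_weightOp hc le_rfl hwp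
    have h2 : ∑ j ∈ Finset.Icc 1 (p : ℤ), weightOp cLI j w = 0 := Finset.sum_eq_zero fun j hj => by
      rw [Finset.mem_Icc] at hj
      have hI : modeI j w = 0 := hmin (p - 1) (by omega) _ (N.smul_mem _ hwN)
        (hv.modeI_mem hwp j (by omega))
      have hL : modeL j w = 0 := hmin (p - 1) (by omega) _ (N.smul_mem _ hwN)
        (hv.modeL_mem hwp j (by omega))
      simp [weightOp, hI, hL]
    rw [h2, zero_sub] at h1
    have h3 : w ∈ filt v ((p : ℤ) - 1) := by
      rw [neg_mem_iff] at h1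
      exact (Submodule.smul_mem_iff _ (by exact_mod_cast hp0)).mp h1
    exact hne (hmin _ (by omega) w hwN h3)
  rw [hp0] at hwp
  obtain ⟨c, rfl⟩ := Submodule.mem_span_singleton.mp (filt_zero v hwp)
  have hc0 : c ≠ 0 := by
    rintro rfl
    simp at hne
  have := N.smul_of_tower_mem c⁻¹ hwN
  rwa [inv_smul_smul₀ hc0] at this

theorem eq_top_of_ne_bot (hc : cLI ≠ 0) (N : Submodule UHV M) (hN : N ≠ ⊥) : N = ⊤ := by
  rw [eq_top_iff, ← hv.span, Submodule.span_singleton_le_iff_mem]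
  exact hv.mem_of_ne_bot hc N hN

end IsSpecial

end Irreducible

/-! ### Verma modules and their irreducible quotients -/

section InducedTop

variable {E : Type} [AddCommGroup E] [Module ℂ E] {cL cLI : ℂ} {A B : Module.End ℂ E}
  (hAB : Commute A B)

theorem HV.opB_smul_unit {i : HVIndex} (hi : HV.Nonneg i) (e : E) :
    opB i • Induced.unit HV.nonneg (HV.topRep cL cLI 0 A B hAB) e =
      Induced.unit HV.nonneg (HV.topRep cL cLI 0 A B hAB) (HV.topOp cL cLI 0 A B i e) := by
  rw [← HV.topRep_of cL cLI 0 A B hAB hi, Induced.unit_rep]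
  rfl

theorem HV.induced_isLowestWeight [FiniteDimensional ℂ E] {h : ℂ} (hA : ∀ e, A e = h • e) :
    IsLowestWeight (LinearMap.range (Induced.unit HV.nonneg (HV.topRep cL cLI 0 A B hAB)))
      cL cLI h := by
  have hu : ∀ i, HV.Nonneg i → ∀ e, _ := fun i hi e => HV.opB_smul_unit (cL := cL) (cLI := cLI) hAB hi e
  have hspan := Induced.span_unit HV.nonneg (HV.topRep cL cLI 0 A B hAB)
  have hlz : IsLevelZero (Induced HV.nonneg (HV.topRep cL cLI 0 A B hAB)) cL cLI := by
    refine IsLevelZero.of_span _ hspan ?_ ?_ ?_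
    · rintro _ ⟨e, rfl⟩
      rw [hu .CL trivial]; exact map_smul _ cL e
    · rintro _ ⟨e, rfl⟩
      rw [hu .CLI trivial]; exact map_smul _ cLI e
    · rintro _ ⟨e, rfl⟩
      rw [hu .CI trivial]
      exact (map_smul _ (0 : ℂ) e).trans (zero_smul ℂ _)
  refine { hlz with killL := ?_, killI := ?_, weight := ?_, stable := ?_, finite := inferInstance,
                    span := ?_ }
  · rintro n hn _ ⟨e, rfl⟩
    refine (hu (.L n) hn.le e).trans ?_
    rw [HV.topOp, if_neg hn.ne', LinearMap.zero_apply, map_zero]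
  · rintro n hn _ ⟨e, rfl⟩
    refine (hu (.I n) hn.le e).trans ?_
    rw [HV.topOp, if_neg hn.ne', LinearMap.zero_apply, map_zero]
  · rintro _ ⟨e, rfl⟩
    refine (hu (.L 0) le_rfl e).trans ?_
    rw [HV.topOp, if_pos rfl, hA, map_smul]
  · rintro _ ⟨e, rfl⟩
    exact ⟨_, (hu (.I 0) le_rfl e).symm⟩
  · rw [LinearMap.coe_range]; exact hspan

/-- The map out of the induced module given by a map of `H^{≥0}`-modules. -/
theorem HV.exists_lift {N : Type} [AddCommGroup N] [Module ℂ N] [Module UHV N]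
    [IsScalarTower ℂ UHV N] (f : E →ₗ[ℂ] N) (hN : IsLevelZero N cL cLI)
    (killL : ∀ n > 0, ∀ e, modeL n (f e) = 0) (killI : ∀ n > 0, ∀ e, modeI n (f e) = 0)
    (hA : ∀ e, f (A e) = modeL 0 (f e)) (hB : ∀ e, f (B e) = modeI 0 (f e)) :
    ∃ F : Induced HV.nonneg (HV.topRep cL cLI 0 A B hAB) →ₗ[UHV] N,
      ∀ e, F (Induced.unit HV.nonneg (HV.topRep cL cLI 0 A B hAB) e) = f e := by
  have hi : ∀ i, HV.Nonneg i → ∀ e, f (HV.topOp cL cLI 0 A B i e) = opB i • f e := by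
    intro i hi e
    rcases i with n | n | _ | _ | _
    · rcases eq_or_ne n 0 with rfl | hn
      · exact hA e
      · rw [HV.topOp, if_neg hn, LinearMap.zero_apply, map_zero]
        exact (killL n (lt_of_le_of_ne hi hn.symm) e).symm
    · rcases eq_or_ne n 0 with rfl | hn
      · exact hB e
      · rw [HV.topOp, if_neg hn, LinearMap.zero_apply, map_zero]
        exact (killI n (lt_of_le_of_ne hi hn.symm) e).symm
    · rw [hN.cl]; exact map_smul f cL e
    · rw [hN.cli]; exact map_smul f cLI e
    · rw [hN.ci]; exact (map_smul f (0 : ℂ) e).trans (zero_smul ℂ _)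
  have hf : ∀ (k : HV.nonneg) (e : E), f (HV.topRep cL cLI 0 A B hAB k e) =
      UniversalEnvelopingAlgebra.ι ℂ (k : HV) • f e := by
    rintro ⟨x, hx⟩ e
    change x ∈ HV.nonnegSpan at hx
    change f (HV.lift (HV.topOp cL cLI 0 A B) x e) = UniversalEnvelopingAlgebra.ι ℂ x • f e
    induction hx using Submodule.span_induction with
    | zero => simp
    | add a b _ _ ha hb => rw [map_add, map_add, add_smul, LinearMap.add_apply, map_add, ha, hb]
    | smul c a _ ha => rw [map_smul, map_smul, smul_assoc, LinearMap.smul_apply, map_smul, ha]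
    | mem a ha =>
      obtain ⟨i, hi', rfl⟩ := ha
      rw [HV.lift_of]
      exact hi i hi' e
  exact ⟨Induced.lift _ _ f hf, fun e => Induced.lift_unit _ _ f hf e⟩

end InducedTop

/-! ### Highest weight vectors and the singular vector of degree one -/

section HighestWeight

variable {M : Type} [AddCommGroup M] [Module ℂ M] [Module UHV M] [IsScalarTower ℂ UHV M]
  {cL cLI h : ℂ} {v : M}

theorem IsHighestWeight.isSingular (hv : IsHighestWeight M cL cLI v h) :
    IsSingular (Submodule.span ℂ {v}) cL cLI h := by
  refine { hv.toIsLevelZero with killL := ?_, killI := ?_, weight := ?_, stable := ?_ } <;>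
    simp only [Submodule.mem_span_singleton]
  · rintro n hn _ ⟨c, rfl⟩
    rw [map_smul, hv.killL n hn, smul_zero]
  · rintro n hn _ ⟨c, rfl⟩
    rw [map_smul, hv.killI n hn.le, smul_zero]
  · rintro _ ⟨c, rfl⟩
    rw [map_smul, hv.weight, smul_comm]
  · rintro _ ⟨c, rfl⟩
    exact ⟨0, by rw [map_smul, hv.killI 0 le_rfl, smul_zero, zero_smul]⟩

theorem IsHighestWeight.map (hv : IsHighestWeight M cL cLI v h) {N : Type} [AddCommGroup N]
    [Module ℂ N] [Module UHV N] [IsScalarTower ℂ UHV N] (f : M →ₗ[UHV] N)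
    (hN : IsLevelZero N cL cLI) : IsHighestWeight N cL cLI (f v) h := by
  have hL : ∀ n w, modeL n (f w) = f (modeL n w) := fun n w => (f.map_smul _ w).symm
  have hI : ∀ n w, modeI n (f w) = f (modeI n w) := fun n w => (f.map_smul _ w).symm
  refine { hN with killL := fun n hn => ?_, killI := fun n hn => ?_, weight := ?_ }
  · rw [hL, hv.killL n hn, map_zero]
  · rw [hI, hv.killI n hn, map_zero]
  · rw [hL, hv.weight, LinearMap.map_smul_of_tower]

/-- The singular vector of degree one. -/
theorem IsHighestWeight.singular (hv : IsHighestWeight M cL cLI v h) (hc : cLI ≠ 0) :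
    IsHighestWeight M cL cLI (modeL (-1) v + (h / cLI) • modeI (-1) v) (h + 1) := by
  refine { hv.toIsLevelZero with killL := fun n hn => ?_, killI := fun n hn => ?_, weight := ?_ }
  · rw [map_add, map_smul, hv.LL, hv.LI, hv.killL n hn, map_zero, map_zero, hv.killI _ (by omega)]
    rcases eq_or_ne n 1 with rfl | h1
    -- The coefficient `h / cLI` is determined here: `[L(1), L(-1)]` contributes `2 h` and `[L(1),
    -- I(-1)]` contributes `-2 cLI`.
    · rw [if_pos (by ring), if_pos (by ring), show (1 : ℤ) + -1 = 0 by ring, hv.weight]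
      rw [smul_zero, zero_add, sub_zero, zero_sub, smul_neg, smul_smul, smul_smul, ← add_smul,
        ← sub_eq_add_neg, ← sub_smul]
      convert zero_smul ℂ v
      push_cast
      field_simp
      ring
    · rw [if_neg (by omega), if_neg (by omega), hv.killL _ (by omega)]
      simp
  · rw [map_add, map_smul, hv.IL, hv.II, hv.killI n hn, map_zero, map_zero]
    rcases eq_or_ne n 0 with rfl | h0
    · simp
    · rw [hv.killI _ (by omega)]
      split_ifs with h1
      -- The central term of `[I(1), L(-1)]` has the factor `1^2 - 1 = 0`.
      · obtain rfl : n = 1 := by omega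
        simp
      · simp
  · rw [map_add, map_smul, hv.LL, hv.LI, hv.weight, map_smul, map_smul]
    simp
    module

end HighestWeight

namespace Verma

variable (cL cLI h : ℂ)

theorem isLowestWeight : IsLowestWeight (M := Verma cL 0 cLI h 0)
    (Submodule.span ℂ {hw cL 0 cLI h 0}) cL cLI h := by
  have := HV.induced_isLowestWeight (cL := cL) (cLI := cLI)
    ((Commute.one_left (1 : Module.End ℂ ℂ)).smul_left h |>.smul_right (0 : ℂ)) (h := h)
    (fun e => by simp)
  have he : Submodule.span ℂ {hw cL 0 cLI h 0} =
      LinearMap.range (Induced.unit HV.nonneg (vermaTop cL 0 cLI h 0)) := by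
    refine le_antisymm ((Submodule.span_singleton_le_iff_mem _ _).mpr ⟨1, rfl⟩) ?_
    rintro _ ⟨e, rfl⟩
    exact Submodule.mem_span_singleton.mpr ⟨e, by rw [hw, ← map_smul, smul_eq_mul, mul_one]⟩
  rw [he]
  exact this

theorem isHighestWeight :
    IsHighestWeight (Verma cL 0 cLI h 0) cL cLI (hw cL 0 cLI h 0) h := by
  have hl := isLowestWeight cL cLI h
  have hm := Submodule.mem_span_singleton_self (R := ℂ) (hw cL 0 cLI h 0)
  refine { hl.toIsLevelZero with killL := fun n hn => hl.killL n hn _ hm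
                                 killI := fun n hn => ?_, weight := hl.weight _ hm }
  rcases eq_or_lt_of_le (show 0 ≤ n from hn) with rfl | hn
  · refine (HV.opB_smul_unit _ (i := .I 0) le_rfl (1 : ℂ)).trans ?_
    simp [HV.topOp]
    rfl
  · exact hl.killI n hn _ hm

theorem hw_ne_zero : hw cL 0 cLI h 0 ≠ 0 := fun h0 =>
  one_ne_zero (HV.induced_unit_injective _ (h0.trans (map_zero _).symm) : (1 : ℂ) = 0)

theorem span_hw : Submodule.span UHV {hw cL 0 cLI h 0} = ⊤ := by
  rw [eq_top_iff, ← (isLowestWeight cL cLI h).span, Submodule.span_le]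
  intro w hw'
  obtain ⟨c, rfl⟩ := Submodule.mem_span_singleton.mp hw'
  exact Submodule.smul_of_tower_mem _ c (Submodule.mem_span_singleton_self _)

theorem exists_lift {N : Type} [AddCommGroup N] [Module ℂ N] [Module UHV N]
    [IsScalarTower ℂ UHV N] {w : N} (hw' : IsHighestWeight N cL cLI w h) :
    ∃ F : Verma cL 0 cLI h 0 →ₗ[UHV] N, F (hw cL 0 cLI h 0) = w := by
  obtain ⟨F, hF⟩ := HV.exists_lift (cL := cL) (cLI := cLI)
    ((Commute.one_left (1 : Module.End ℂ ℂ)).smul_left h |>.smul_right (0 : ℂ))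
    (LinearMap.toSpanSingleton ℂ N w) hw'.toIsLevelZero
    (fun n hn e => by simp [hw'.killL n hn]) (fun n hn e => by simp [hw'.killI n hn.le])
    (fun e => by simp [hw'.weight, mul_comm h e, mul_smul]) (fun e => by simp [hw'.killI 0 le_rfl])
  exact ⟨F, (hF 1).trans (by simp)⟩

/-- The singular vector of degree one in the Verma module. -/
noncomputable def sing : Verma cL 0 cLI h 0 :=
  modeL (-1) (hw cL 0 cLI h 0) + (h / cLI) • modeI (-1) (hw cL 0 cLI h 0)

variable {cLI} in
theorem hw_notMem_span_sing (hc : cLI ≠ 0) :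
    hw cL 0 cLI h 0 ∉ Submodule.span UHV {sing cL cLI h} := by
  intro hmem
  have hs := ((isHighestWeight cL cLI h).singular hc).isSingular
  refine hw_ne_zero cL cLI h ((isHighestWeight cL cLI h).isSingular.eq_zero_of_mem one_pos
    (by rw [Int.cast_one]; exact hs) (Submodule.span_mono ?_ hmem) (Submodule.mem_span_singleton_self _))
  exact Submodule.subset_span

theorem isSpecial_quotient :
    IsSpecial (Verma cL 0 cLI h 0 ⧸ Submodule.span UHV {sing cL cLI h}) cL cLI
      (Submodule.mkQ _ (hw cL 0 cLI h 0)) h (-(h / cLI)) := by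
  have hv := isHighestWeight cL cLI h
  have hq := hv.map (Submodule.mkQ (Submodule.span UHV {sing cL cLI h}))
    (hv.toIsLevelZero.map _ (Submodule.mkQ_surjective _))
  refine { hq with singular := ?_, span := ?_ }
  · have : Submodule.mkQ (Submodule.span UHV {sing cL cLI h}) (sing cL cLI h) = 0 := by
      rw [Submodule.mkQ_apply, Submodule.Quotient.mk_eq_zero]
      exact Submodule.mem_span_singleton_self _
    rw [sing, map_add, LinearMap.map_smul_of_tower, modeL_apply, modeI_apply, map_smul, map_smul] at this
    rw [neg_smul]
    exact eq_neg_of_add_eq_zero_left this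
  · rw [← Set.image_singleton, ← Submodule.map_span, span_hw, Submodule.map_top,
      Submodule.range_mkQ]

-- Irreducibility of the quotient makes this submodule `S` maximal; that it contains every proper
-- `N` needs weights as well. Otherwise the generator would be `n + s` with `n ∈ N` and `s ∈ S`.
-- Modulo `N` it would then lie in the submodule generated by a singular vector of weight `h + 1`,
-- so it would vanish there and `N` would be everything.
variable {cLI} in
theorem maxSub_eq (hc : cLI ≠ 0) :
    maxSub cL 0 cLI h 0 = Submodule.span UHV {sing cL cLI h} := by
  have hv := isHighestWeight cL cLI h
  refine le_antisymm (sSup_le fun N hN => ?_) (le_sSup fun ht => ?_)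
  · set S := Submodule.span UHV {sing cL cLI h} with hS
    by_contra hNS
    have h1 : N.map S.mkQ ≠ ⊥ := by
      refine fun hb => hNS fun x hx => ?_
      have : S.mkQ x ∈ N.map S.mkQ := ⟨x, hx, rfl⟩
      rwa [hb, Submodule.mem_bot, Submodule.mkQ_apply, Submodule.Quotient.mk_eq_zero] at this
    have h2 := (isSpecial_quotient cL cLI h).eq_top_of_ne_bot hc _ h1
    have h3 : hw cL 0 cLI h 0 ∈ N ⊔ S := by
      have : S.mkQ (hw cL 0 cLI h 0) ∈ N.map S.mkQ := by rw [h2]; exact Submodule.mem_top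
      obtain ⟨n, hn, he⟩ := this
      rw [← sub_eq_zero, ← map_sub, ← LinearMap.mem_ker, Submodule.ker_mkQ] at he
      rw [← sub_sub_self n (hw cL 0 cLI h 0)]
      exact sub_mem (Submodule.mem_sup_left hn) (Submodule.mem_sup_right he)
    obtain ⟨n, hn, s, hs, hns⟩ := Submodule.mem_sup.mp h3
    have hlz := hv.toIsLevelZero.map N.mkQ (Submodule.mkQ_surjective _)
    have hv' := (hv.map N.mkQ hlz).isSingular
    have hs' := ((hv.singular hc).map N.mkQ hlz).isSingular
    have h4 : N.mkQ s = N.mkQ (hw cL 0 cLI h 0) := by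
      rw [← hns, map_add, (Submodule.Quotient.mk_eq_zero N).mpr hn |> fun e => (e : N.mkQ n = 0),
        zero_add]
    have h5 : N.mkQ s ∈ Submodule.span UHV {N.mkQ (sing cL cLI h)} := by
      rw [← Set.image_singleton, ← Submodule.map_span]
      exact ⟨s, hs, rfl⟩
    have h6 : N.mkQ s = 0 := by
      refine hv'.eq_zero_of_mem one_pos (by rw [Int.cast_one]; exact hs')
        (Submodule.span_mono Submodule.subset_span h5) ?_
      rw [h4]
      exact Submodule.mem_span_singleton_self _
    rw [h4, Submodule.mkQ_apply, Submodule.Quotient.mk_eq_zero] at h6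
    refine hN (eq_top_iff.mpr ?_)
    rw [← span_hw, Submodule.span_singleton_le_iff_mem]
    exact h6
  · exact hw_notMem_span_sing cL h hc (ht ▸ Submodule.mem_top)

end Verma

namespace Irr

variable (cL : ℂ) {cLI : ℂ} (h : ℂ) (hc : cLI ≠ 0)

theorem isLowestWeight : IsLowestWeight (M := Irr cL 0 cLI h 0)
    (Submodule.span ℂ {hw cL 0 cLI h 0}) cL cLI h := by
  have := (Verma.isLowestWeight cL cLI h).map (Verma.maxSub cL 0 cLI h 0).mkQ
    (Submodule.mkQ_surjective _)
  rw [Submodule.map_span, Set.image_singleton] at this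
  exact this

theorem isHighestWeight :
    IsHighestWeight (Irr cL 0 cLI h 0) cL cLI (hw cL 0 cLI h 0) h :=
  (Verma.isHighestWeight cL cLI h).map _ (isLowestWeight cL h).toIsLevelZero

theorem span_hw : Submodule.span UHV {hw cL 0 cLI h 0} = ⊤ := by
  rw [hw, ← Set.image_singleton, ← Submodule.map_span, Verma.span_hw, Submodule.map_top,
      Submodule.range_mkQ]

include hc

theorem singular :
    modeL (-1) (hw cL 0 cLI h 0) + (h / cLI) • modeI (-1) (hw cL 0 cLI h 0) = 0 := by
  have : (Verma.maxSub cL 0 cLI h 0).mkQ (Verma.sing cL cLI h) = 0 := by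
    rw [Submodule.mkQ_apply, Submodule.Quotient.mk_eq_zero, Verma.maxSub_eq cL h hc]
    exact Submodule.mem_span_singleton_self _
  rw [Verma.sing, map_add, LinearMap.map_smul_of_tower, modeL_apply, modeI_apply, map_smul,
    map_smul] at this
  exact this

/-- This presentation by one relation is used twice: with `h = 0` and the space of fields as target,
and with `h = 1` and target `U`. -/
theorem exists_lift {N : Type} [AddCommGroup N] [Module ℂ N] [Module UHV N]
    [IsScalarTower ℂ UHV N] {w : N} (hw' : IsHighestWeight N cL cLI w h)
    (hs : modeL (-1) w + (h / cLI) • modeI (-1) w = 0) :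
    ∃ F : Irr cL 0 cLI h 0 →ₗ[UHV] N, F (hw cL 0 cLI h 0) = w := by
  obtain ⟨F, hF⟩ := Verma.exists_lift cL cLI h hw'
  have hker : Verma.maxSub cL 0 cLI h 0 ≤ LinearMap.ker F := by
    rw [Verma.maxSub_eq cL h hc, Submodule.span_singleton_le_iff_mem, LinearMap.mem_ker, Verma.sing,
      map_add, LinearMap.map_smul_of_tower, modeL_apply, modeI_apply, map_smul, map_smul, hF]
    exact hs
  exact ⟨Submodule.liftQ _ F hker, (Submodule.liftQ_apply _ _ _).trans hF⟩

-- The kernel pulled back to the Verma module is proper, hence contained in the sum of all proper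
-- submodules.
omit hc in
theorem injective_of_ne_zero {N : Type} [AddCommGroup N] [Module ℂ N] [Module UHV N]
    [IsScalarTower ℂ UHV N] (F : Irr cL 0 cLI h 0 →ₗ[UHV] N) (hF : F (hw cL 0 cLI h 0) ≠ 0) :
    Function.Injective F := by
  set K := LinearMap.ker (F.comp (Verma.maxSub cL 0 cLI h 0).mkQ) with hK
  have hKt : K ≠ ⊤ := by
    intro ht
    have : Verma.hw cL 0 cLI h 0 ∈ K := ht ▸ Submodule.mem_top
    exact hF this
  have hle : K ≤ Verma.maxSub cL 0 cLI h 0 := le_sSup hKt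
  rw [← LinearMap.ker_eq_bot, eq_bot_iff]
  intro x hx
  obtain ⟨y, rfl⟩ := Submodule.mkQ_surjective _ x
  have : y ∈ K := hx
  rw [Submodule.mem_bot, Submodule.mkQ_apply, Submodule.Quotient.mk_eq_zero]
  exact hle this

end Irr

/-! ### Vertex operator maps on the Heisenberg-Virasoro vertex algebra -/

namespace Fld

variable {M : Type} [AddCommGroup M] [Module ℂ M]

theorem local_iff (A B : Fld M) : Local A B ↔ ∃ n, (diffFld ^ n) (adFld A B) = 0 :=
  exists_congr fun _ => diffFld_pow_eq_zero.symm

/-- The fields local to a given field. -/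
def localTo (A : Fld M) : Submodule ℂ (Fld M) where
  carrier := {B | Local A B}
  zero_mem' := (local_iff _ _).mpr ⟨0, by simp⟩
  smul_mem' c B h := by
    obtain ⟨n, hn⟩ := (local_iff _ _).mp h
    exact (local_iff _ _).mpr ⟨n, by rw [map_smul, map_smul, hn, smul_zero]⟩
  add_mem' {B C} hB hC := by
    obtain ⟨n, hn⟩ := (local_iff _ _).mp hB
    obtain ⟨m, hm⟩ := (local_iff _ _).mp hC
    refine (local_iff _ _).mpr ⟨n + m, ?_⟩
    have h1 : (diffFld ^ (n + m)) (adFld A B) = 0 := by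
      rw [add_comm, pow_add, Module.End.mul_apply, hn, map_zero]
    have h2 : (diffFld ^ (n + m)) (adFld A C) = 0 := by
      rw [pow_add, Module.End.mul_apply, hm, map_zero]
    rw [map_add, map_add, h1, h2, add_zero]

/-- Products of fields annihilating `v` by their nonnegative modes. -/
theorem prod_vacuum {A B : Fld M} {v : M} (hA : ∀ k : ℕ, A.1 k v = 0) (hB : ∀ k : ℕ, B.1 k v = 0)
    (n : ℤ) : (prod n A B).1 (-1) v = A.1 n (B.1 (-1) v) ∧ ∀ k : ℕ, (prod n A B).1 k v = 0 := by
  constructor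
  · rw [prod_apply]
    simp only [hA, map_zero, smul_zero, finsum_zero, sub_zero]
    rw [finsum_eq_range (K := 1)]
    · simp [bc_zero_right]
    · intro i hi
      rw [show (-1 : ℤ) + i = ((i - 1 : ℕ) : ℤ) by omega, hB, map_zero, smul_zero]
  · intro k
    rw [prod_apply]
    simp only [hA, map_zero, smul_zero, finsum_zero, sub_zero]
    refine finsum_eq_zero_of_forall_eq_zero fun i => ?_
    rw [← Nat.cast_add, hB, map_zero, smul_zero]

theorem prod_zero_eq_ad (A B : Fld M) : prod 0 A B = ad (A.1 0) B := by
  apply Subtype.ext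
  funext k
  rw [prod_val, bor_zero]
  rfl

theorem map_prod {N : Type} [AddCommGroup N] [Module ℂ N] (f : M →ₗ[ℂ] N) {A B : Fld M}
    {A' B' : Fld N} (hA : ∀ k w, f (A.1 k w) = A'.1 k (f w)) (hB : ∀ k w, f (B.1 k w) = B'.1 k (f w))
    (n k : ℤ) (w : M) : f ((prod n A B).1 k w) = (prod n A' B').1 k (f w) := by
  have h1 := (((evZero_plus A B (fun i => n - i) k w)).smul (bc n)).map_finsum f.toAddMonoidHom
  have h2 := (((evZero_plus B A (fun i => k + n - i) 0 w)).smul (bc n)).map_finsum f.toAddMonoidHom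
  simp only [zero_add, LinearMap.toAddMonoidHom_coe, map_smul, hA, hB] at h1 h2
  rw [prod_apply, prod_apply, map_sub, map_smul, h1, h2]

theorem HasOPE_common {M N : Type} [AddCommGroup M] [Module ℂ M] [AddCommGroup N] [Module ℂ N]
    {A B : Fld M} {C D : Fld N} (h : Local A B) (h' : Local C D) :
    ∃ n, (HasOPE A B n fun i => prod i A B) ∧ HasOPE C D n fun i => prod i C D := by
  obtain ⟨n, hn⟩ := h
  obtain ⟨m, hm⟩ := h'
  exact ⟨max n m, hasOPE_of_diffOp (diffOp_iterate_eq_zero_of_le hn (le_max_left _ _)),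
    hasOPE_of_diffOp (diffOp_iterate_eq_zero_of_le hm (le_max_right _ _))⟩

/-- The inductive step of associativity. Commutator formulas in `V` and among fields on `M` both
express the claim at `G.1 m b` through products at `b`, where it is known; a common order of
locality makes the two finite sums match. -/
theorem map_mode_mode {V M : Type} [AddCommGroup V] [Module ℂ V] [AddCommGroup M] [Module ℂ M]
    {Ψ : V →ₗ[ℂ] Fld V} {Φ : V →ₗ[ℂ] Fld M} {G : Fld V} {H : Fld M} (hG : ∀ a, Local G (Ψ a))
    (hH : ∀ a, Local H (Φ a)) (hGΨ : ∀ k a, Ψ (G.1 k a) = prod k G (Ψ a))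
    (hHΦ : ∀ k a, Φ (G.1 k a) = prod k H (Φ a)) {b : V}
    (hb : ∀ a n, Φ ((Ψ a).1 n b) = prod n (Φ a) (Φ b)) (m : ℤ) (a : V) (n : ℤ) :
    Φ ((Ψ a).1 n (G.1 m b)) = prod n (Φ a) (Φ (G.1 m b)) := by
  obtain ⟨N, h1, h2⟩ := HasOPE_common (hG a) (hH a)
  have h3 : (Ψ a).1 n (G.1 m b) = G.1 m ((Ψ a).1 n b) -
      ∑ i ∈ Finset.range N, (Ring.choose m i : ℤ) • (prod i G (Ψ a)).1 (m + n - i) b := by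
    have := congrArg (fun f => f b) (h1 m n)
    simp only [Fld.comm, LinearMap.sub_apply, Module.End.mul_apply, LinearMap.sum_apply,
      LinearMap.smul_apply] at this
    rw [← this, sub_sub_cancel]
  have h4 := h2.prod_comm (Φ b) m n
  rw [sub_eq_iff_eq_add, ← sub_eq_iff_eq_add'] at h4
  rw [hHΦ, ← h4, h3, map_sub, hHΦ, hb, map_sum]
  refine congrArg _ (Finset.sum_congr rfl fun i _ => ?_)
  rw [map_zsmul, ← hGΨ, hb, hHΦ]

theorem bor_eq_finsum (A B : Fld M) (r p q : ℤ) (w : M) :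
    bor A B r p q w = ∑ᶠ i : ℕ, ((-1 : ℂ) ^ i * ((Ring.choose r i : ℤ) : ℂ)) •
      (A.1 (p + r - i) (B.1 (q + i) w) - (-1 : ℂ) ^ r • B.1 (q + r - i) (A.1 (p + i) w)) := by
  have h1 := (evZero_plus A B (fun i => p + r - i) q w).smul (bc r)
  have h2 := ((evZero_plus B A (fun i => q + r - i) p w).smul (bc r))
  rw [bor_apply, resPlus_apply, resMinus_apply, h2.smul_finsum,
    ← h1.finsum_sub (h2.smul fun _ => (-1 : ℂ) ^ r)]
  refine finsum_congr fun i => ?_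
  rw [smul_sub, smul_comm]
  rfl

/-- The vertex operator with given modes. -/
noncomputable def toVertexOperator : Fld M →ₗ[ℂ] VertexOperator ℂ M where
  toFun A := VertexOperator.of_coeff (fun n => A.1 (-n - 1)) fun w => by
    obtain ⟨K, hK⟩ := A.2 w
    refine ⟨-K - 1, fun n hn => ?_⟩
    by_contra hlt
    exact hn (hK _ (by omega))
  map_add' A B := HVertexOperator.coeff_inj rfl
  map_smul' c A := HVertexOperator.coeff_inj rfl

theorem ncoeff_toVertexOperator (A : Fld M) (n : ℤ) :
    VertexOperator.ncoeff (toVertexOperator A) n = A.1 n := by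
  have h := VertexOperator.ncoeff_of_coeff (fun n => A.1 (-n - 1)) (fun w => by
    obtain ⟨K, hK⟩ := A.2 w
    refine ⟨-K - 1, fun n hn => ?_⟩
    by_contra hlt
    exact hn (hK _ (by omega))) n
  rw [show -(-n - 1) - 1 = n by ring] at h
  exact h

end Fld

theorem VertexOperator.ext_ncoeff {M : Type} [AddCommGroup M] [Module ℂ M] {A B : VertexOperator ℂ M}
    (h : ∀ n, VertexOperator.ncoeff A n = VertexOperator.ncoeff B n) : A = B := by
  refine HVertexOperator.coeff_inj (funext fun n => ?_)
  rw [VertexOperator.coeff_eq_ncoeff, VertexOperator.coeff_eq_ncoeff, h]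

/-! ### Maps from the vacuum module to fields: locality, translation, associativity and existence -/

section VertexMap

open Fld

variable {cL cLI : ℂ}

/-- `V` is generated by a vacuum vector `v`. -/
structure IsVacuumModule {V : Type} [AddCommGroup V] [Module ℂ V] [Module UHV V]
    [IsScalarTower ℂ UHV V] (v : V) (cL cLI : ℂ) : Prop extends IsLevelZero V cL cLI where
  killL : ∀ n ≥ -1, modeL n v = 0
  killI : ∀ n ≥ 0, modeI n v = 0
  span : Submodule.span UHV {v} = ⊤

/-- At `h = 0` the singular vector of degree one is `L(-1) 1` itself, so it vanishes in the
irreducible quotient. -/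
theorem isVacuumModule_vac (hc : cLI ≠ 0) : IsVacuumModule (vac cL cLI) cL cLI := by
  have hv := Irr.isHighestWeight cL (cLI := cLI) 0
  refine { hv.toIsLevelZero with killL := fun n hn => ?_, killI := hv.killI,
                                 span := Irr.span_hw cL 0 }
  rcases lt_trichotomy n 0 with h | rfl | h
  · obtain rfl : n = -1 := by omega
    have := Irr.singular cL 0 hc
    rwa [zero_div, zero_smul, add_zero] at this
  · exact hv.weight.trans (zero_smul ℂ _)
  · exact hv.killL n h

variable {V : Type} [AddCommGroup V] [Module ℂ V] [Module UHV V] [IsScalarTower ℂ UHV V] {v : V}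

theorem IsVacuumModule.induction (hv : IsVacuumModule v cL cLI) (P : Submodule ℂ V) (hvac : v ∈ P)
    (hL : ∀ n, ∀ a ∈ P, modeL n a ∈ P) (hI : ∀ n, ∀ a ∈ P, modeI n a ∈ P) (a : V) :
    a ∈ P := by
  let Q : Submodule UHV V :=
    { P with smul_mem' := fun x w hw => hv.toIsLevelZero.smul_mem P hL hI x hw }
  have : Submodule.span UHV {v} ≤ Q := (Submodule.span_singleton_le_iff_mem _ _).mpr hvac
  rw [hv.span] at this
  exact this Submodule.mem_top

/-- A vertex operator map into the fields on a restricted module. -/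
structure IsVertexMap (v : V) {M : Type} [AddCommGroup M] [Module ℂ M] [Module UHV M] [IsScalarTower ℂ UHV M]
    (hM : IsRestricted M cL cLI) (Φ : V →ₗ[ℂ] Fld M) : Prop where
  map_vac : Φ v = one
  map_modeL : ∀ n a, Φ (modeL n a) = prod (n + 1) hM.fieldL (Φ a)
  map_modeI : ∀ n a, Φ (modeI n a) = prod n hM.fieldI (Φ a)

variable {M : Type} [AddCommGroup M] [Module ℂ M] [Module UHV M] [IsScalarTower ℂ UHV M]
  (hM : IsRestricted M cL cLI)

namespace IsVertexMap

variable {hM} (hv : IsVacuumModule v cL cLI) {Φ : V →ₗ[ℂ] Fld M} (hΦ : IsVertexMap v hM Φ)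

include hΦ

theorem map_omega : Φ (modeL (-2) v) = hM.fieldL :=
  (hΦ.map_modeL (-2) _).trans (by rw [hΦ.map_vac]; exact prod_one_neg_one _)

theorem map_heis : Φ (modeI (-1) v) = hM.fieldI :=
  (hΦ.map_modeI (-1) _).trans (by rw [hΦ.map_vac]; exact prod_one_neg_one _)

include hv

/-- Induction along the generation of `V` by modes: the generating fields are mutually local by
their operator products, and Dong's lemma handles each further mode. -/
theorem local_LI (a : V) : Local hM.fieldL (Φ a) ∧ Local hM.fieldI (Φ a) := by
  have h1 := hM.hasOPE_LL.isLocal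
  have h2 := hM.hasOPE_LI.isLocal
  have h3 := hM.hasOPE_IL.isLocal
  have h4 := hM.hasOPE_II.isLocal
  have := hv.induction ((localTo hM.fieldL).comap Φ ⊓ (localTo hM.fieldI).comap Φ)
    ?_ (fun n a ha => ?_) (fun n a ha => ?_) a
  · exact this
  · simp only [Submodule.mem_inf, Submodule.mem_comap, hΦ.map_vac]
    exact ⟨local_one _, local_one _⟩
  · simp only [Submodule.mem_inf, Submodule.mem_comap, hΦ.map_modeL] at ha ⊢
    exact ⟨Local.prod h1 ha.1 ha.1 _, Local.prod h3 ha.2 ha.1 _⟩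
  · simp only [Submodule.mem_inf, Submodule.mem_comap, hΦ.map_modeI] at ha ⊢
    exact ⟨Local.prod h2 ha.1 ha.2 _, Local.prod h4 ha.2 ha.2 _⟩

theorem isLocal (a b : V) : Local (Φ a) (Φ b) := by
  refine hv.induction ((localTo (Φ a)).comap Φ) ?_ (fun n b hb => ?_) (fun n b hb => ?_) b
  · rw [Submodule.mem_comap, hΦ.map_vac]; exact local_one _
  · rw [Submodule.mem_comap, hΦ.map_modeL]
    exact Local.prod (hΦ.local_LI hv a).1.symm hb (hΦ.local_LI hv b).1 _
  · rw [Submodule.mem_comap, hΦ.map_modeI]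
    exact Local.prod (hΦ.local_LI hv a).2.symm hb (hΦ.local_LI hv b).2 _

/-- `prod 0 L` is the commutator with `L(-1)`. It and `deriv` are both derivations of all residue
products, and they agree on the identity field and on the two generating fields. -/
theorem map_derivative (a : V) : Φ (modeL (-1) a) = Fld.deriv (Φ a) := by
  rw [hΦ.map_modeL]
  change prod 0 hM.fieldL (Φ a) = _
  have hL : prod 0 hM.fieldL hM.fieldL = Fld.deriv hM.fieldL :=
    hM.hasOPE_LL.prod_eq (i := 0) (by norm_num)
  have hI : prod 0 hM.fieldL hM.fieldI = Fld.deriv hM.fieldI :=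
    hM.hasOPE_LI.prod_eq (i := 0) (by norm_num)
  have hP : ∀ (n : ℤ) (A B : Fld M), prod 0 hM.fieldL A = Fld.deriv A → prod 0 hM.fieldL B = Fld.deriv B →
      prod 0 hM.fieldL (prod n A B) = Fld.deriv (prod n A B) := by
    intro n A B hA hB
    rw [prod_zero_eq_ad] at hA hB ⊢
    rw [ad_prod, deriv_prod, hA, hB]
  have := hv.induction (LinearMap.ker ((prod 0 hM.fieldL - Fld.deriv).comp Φ)) ?_
    (fun n b hb => ?_) (fun n b hb => ?_) a
  · exact sub_eq_zero.mp this
  · rw [LinearMap.mem_ker, LinearMap.comp_apply, LinearMap.sub_apply, sub_eq_zero, hΦ.map_vac]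
    have h0 : prod 0 hM.fieldL one = 0 := prod_one_nonneg 0 _
    rw [h0]
    ext k w
    rw [deriv_apply, one_apply]
    split_ifs with h
    · obtain rfl : k = 0 := by omega
      simp
    · simp
  · rw [LinearMap.mem_ker, LinearMap.comp_apply, LinearMap.sub_apply, sub_eq_zero] at hb ⊢
    rw [hΦ.map_modeL]
    exact hP _ _ _ hL hb
  · rw [LinearMap.mem_ker, LinearMap.comp_apply, LinearMap.sub_apply, sub_eq_zero] at hb ⊢
    rw [hΦ.map_modeI]
    exact hP _ _ _ hI hb

end IsVertexMap

section Vacuum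

variable {hV : IsRestricted V cL cLI} {Ψ : V →ₗ[ℂ] Fld V}
  (hv : IsVacuumModule v cL cLI) (hΨ : IsVertexMap v hV Ψ)

include hv hΨ

theorem IsVertexMap.creation_aux (a : V) :
    (Ψ a).1 (-1) v = a ∧ ∀ k : ℕ, (Ψ a).1 k v = 0 := by
  have hL : ∀ k : ℕ, hV.fieldL.1 k v = 0 := fun k => hv.killL _ (by omega)
  have hI : ∀ k : ℕ, hV.fieldI.1 k v = 0 := fun k => hv.killI k (by omega)
  let P : Submodule ℂ V :=
    { carrier := {a | (Ψ a).1 (-1) v = a ∧ ∀ k : ℕ, (Ψ a).1 k v = 0}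
      add_mem' := fun {a b} ha hb => by
        refine ⟨?_, fun k => ?_⟩
        · rw [map_add, Fld.add_apply, ha.1, hb.1]
        · rw [map_add, Fld.add_apply, ha.2, hb.2, add_zero]
      zero_mem' := by simp
      smul_mem' := fun c a ha => by
        refine ⟨?_, fun k => ?_⟩
        · rw [map_smul, Fld.smul_apply, ha.1]
        · rw [map_smul, Fld.smul_apply, ha.2, smul_zero] }
  refine hv.induction P ?_ (fun n a ha => ?_) (fun n a ha => ?_) a
  · refine ⟨?_, fun k => ?_⟩
    · rw [hΨ.map_vac, one_apply, if_pos rfl]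
    · rw [hΨ.map_vac, one_apply, if_neg (by omega)]
  · have := prod_vacuum hL ha.2 (n + 1)
    rw [← hΨ.map_modeL, ha.1] at this
    refine ⟨this.1.trans ?_, this.2⟩
    rw [hV.fieldL_apply, add_sub_cancel_right]
  · have := prod_vacuum hI ha.2 n
    rw [← hΨ.map_modeI, ha.1] at this
    exact ⟨this.1.trans (hV.fieldI_apply _ _), this.2⟩

/-- For `n ≥ 0` both sides vanish. For `n < 0` descend from the creation property at `n = -1`:
replacing `a` by `L(-1) a` lowers the index by one, at the cost of the nonzero factor `-n`. -/
theorem IsVertexMap.assoc_vac {Φ : V →ₗ[ℂ] Fld M} (hΦ : IsVertexMap v hM Φ)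
    (a : V) (n : ℤ) : Φ ((Ψ a).1 n v) = prod n (Φ a) one := by
  rcases lt_or_ge n 0 with hn | hn
  · obtain ⟨k, rfl⟩ : ∃ k : ℕ, n = -k - 1 := ⟨(-n - 1).toNat, by omega⟩
    clear hn
    induction k generalizing a with
    | zero =>
      rw [Nat.cast_zero, neg_zero, zero_sub, (hΨ.creation_aux hv a).1, prod_one_neg_one]
    | succ k ih =>
      have h1 := ih (modeL (-1) a)
      rw [hΨ.map_derivative hv, hΦ.map_derivative hv, prod_deriv_left, deriv_apply, map_smul] at h1
      have h2 : (-((-(k : ℤ) - 1 : ℤ) : ℂ)) ≠ 0 := by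
        push_cast
        rw [neg_sub, sub_neg_eq_add]
        exact_mod_cast (by omega : 1 + k ≠ 0)
      have h3 := smul_right_injective _ h2 h1
      rw [show -((k + 1 : ℕ) : ℤ) - 1 = -(k : ℤ) - 1 - 1 by push_cast; ring]
      exact h3
  · obtain ⟨k, rfl⟩ := Int.eq_ofNat_of_zero_le hn
    rw [(hΨ.creation_aux hv a).2, map_zero, prod_one_nonneg]

/-- Induction on `b`, starting from `assoc_vac` and continued by `map_mode_mode`; `a` stays
universally quantified because commutators change it. -/
theorem IsVertexMap.assoc {Φ : V →ₗ[ℂ] Fld M} (hΦ : IsVertexMap v hM Φ)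
    (a b : V) (n : ℤ) : Φ ((Ψ a).1 n b) = prod n (Φ a) (Φ b) := by
  let P : Submodule ℂ V :=
    { carrier := {b | ∀ a n, Φ ((Ψ a).1 n b) = Fld.prod n (Φ a) (Φ b)}
      add_mem' := fun {b b'} hb hb' a n => by rw [map_add, map_add, map_add, map_add, hb, hb']
      zero_mem' := fun a n => by simp
      smul_mem' := fun c b hb a n => by rw [map_smul, map_smul, map_smul, map_smul, hb] }
  have eL : ∀ k a, Ψ (hV.fieldL.1 k a) = Fld.prod k hV.fieldL (Ψ a) := fun k a => by
    rw [hV.fieldL_apply, hΨ.map_modeL, sub_add_cancel]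
  have eL' : ∀ k a, Φ (hV.fieldL.1 k a) = Fld.prod k hM.fieldL (Φ a) := fun k a => by
    rw [hV.fieldL_apply, hΦ.map_modeL, sub_add_cancel]
  have eI : ∀ k a, Ψ (hV.fieldI.1 k a) = Fld.prod k hV.fieldI (Ψ a) := fun k a => by
    rw [hV.fieldI_apply, hΨ.map_modeI]
  have eI' : ∀ k a, Φ (hV.fieldI.1 k a) = Fld.prod k hM.fieldI (Φ a) := fun k a => by
    rw [hV.fieldI_apply, hΦ.map_modeI]
  have sL := fun b => map_mode_mode (fun a => (hΨ.local_LI hv a).1) (fun a => (hΦ.local_LI hv a).1)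
    eL eL' (b := b)
  have sI := fun b => map_mode_mode (fun a => (hΨ.local_LI hv a).2) (fun a => (hΦ.local_LI hv a).2)
    eI eI' (b := b)
  have hP : ∀ b, b ∈ P := by
    refine hv.induction P (fun a n => ?_) (fun m b hb a n => ?_) (fun m b hb a n => ?_)
    · rw [hΦ.map_vac]; exact hΨ.assoc_vac hM hv hΦ a n
    · have := sL b hb (m + 1) a n
      rwa [hV.fieldL_apply, add_sub_cancel_right] at this
    · exact sI b hb m a n
  exact hP b a n

end Vacuum

/-- The fields on `M` form a module through residue products, and the identity field satisfies the
defining relations of the vacuum there. The presentation of the vacuum module then supplies the map.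
-/
theorem exists_isVertexMap (hc : cLI ≠ 0) : ∃ Φ : HVVac cL cLI →ₗ[ℂ] Fld M, IsVertexMap (vac cL cLI) hM Φ := by
  let _ : Module UHV (Fld M) := Module.compHom _ hM.fieldAlg.toRingHom
  have hsm : ∀ (u : UHV) (A : Fld M), u • A = hM.fieldAlg u A := fun _ _ => rfl
  have : IsScalarTower ℂ UHV (Fld M) := ⟨fun c u A => by rw [hsm, hsm, map_smul]; rfl⟩
  have hB : ∀ i (A : Fld M), opB i • A = hM.fieldAct i A := fun i A => by
    rw [hsm, hM.fieldAlg_opB]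
  have hL : ∀ n (A : Fld M), modeL n A = prod (n + 1) hM.fieldL A := fun n A => hB (.L n) A
  have hI : ∀ n (A : Fld M), modeI n A = prod n hM.fieldI A := fun n A => hB (.I n) A
  have hone : IsHighestWeight (Fld M) cL cLI one 0 := by
    refine { cl := hB .CL, cli := hB .CLI, ci := hB .CI, killL := fun n hn => ?_,
             killI := fun n hn => ?_, weight := ?_ }
    · rw [hL]
      obtain ⟨m, rfl⟩ := Int.eq_ofNat_of_zero_le hn.le
      exact prod_one_nonneg (m + 1) _
    · rw [hI]
      obtain ⟨m, rfl⟩ := Int.eq_ofNat_of_zero_le hn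
      exact prod_one_nonneg m _
    · rw [hL, zero_smul]
      exact prod_one_nonneg 1 _
  obtain ⟨F, hF⟩ := Irr.exists_lift cL 0 hc hone (by
    rw [zero_div, zero_smul, add_zero, hL]
    exact prod_one_nonneg 0 _)
  exact ⟨F.restrictScalars ℂ, hF, fun n a => (F.map_smul _ a).trans (hL n _),
    fun n a => (F.map_smul _ a).trans (hI n _)⟩

end VertexMap

/-! ### Vertex operator algebras and modules from vertex operator maps -/

section Structures

open Fld

variable {cL cLI : ℂ}
  {V : Type} [AddCommGroup V] [Module ℂ V] [Module UHV V] [IsScalarTower ℂ UHV V] {v : V}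
  {M : Type} [AddCommGroup M] [Module ℂ M] [Module UHV M] [IsScalarTower ℂ UHV M]

/-- The modes as vertex operators. -/
noncomputable def vertexMap {V M : Type} [AddCommGroup V] [Module ℂ V] [AddCommGroup M] [Module ℂ M]
    (Φ : V →ₗ[ℂ] Fld M) : V →ₗ[ℂ] VertexOperator ℂ M :=
  toVertexOperator.comp Φ

theorem mode_vertexMap {V M : Type} [AddCommGroup V] [Module ℂ V] [AddCommGroup M] [Module ℂ M]
    (Φ : V →ₗ[ℂ] Fld M) (a : V) (n : ℤ) : mode (vertexMap Φ) a n = (Φ a).1 n :=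
  ncoeff_toVertexOperator (Φ a) n

theorem BorcherdsIdentity.iterate {V M : Type} [AddCommGroup V] [Module ℂ V] [AddCommGroup M]
    [Module ℂ M] {Y : V →ₗ[ℂ] VertexOperator ℂ V} {YM : V →ₗ[ℂ] VertexOperator ℂ M}
    (hJ : BorcherdsIdentity Y YM) (a b : V) (w : M) (q r : ℤ) :
    mode YM (mode Y a r b) q w =
      ∑ᶠ i : ℕ, ((-1 : ℂ) ^ i * ((Ring.choose r i : ℤ) : ℂ)) •
        (mode YM a (r - i) (mode YM b (q + i) w)
          - (-1 : ℂ) ^ r • mode YM b (q + r - i) (mode YM a i w)) := by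
  have h := hJ a b w 0 q r
  simp only [zero_add] at h
  rw [← h, finsum_eq_range (K := 1)]
  · simp
  · rintro (_ | i) hi
    · omega
    · rw [Ring.choose_zero_succ, Int.cast_zero, zero_smul]

/-- A vertex operator map is determined by the fields of two generators. -/
theorem vertexMap_unique (hv : IsVacuumModule v cL cLI) {Y Y' : V →ₗ[ℂ] VertexOperator ℂ V}
    (hJ : BorcherdsIdentity Y Y) (hJ' : BorcherdsIdentity Y' Y') {ω ι : V}
    (h1 : ∀ (n : ℤ) (b : V), mode Y v n b = if n = -1 then b else 0)
    (h1' : ∀ (n : ℤ) (b : V), mode Y' v n b = if n = -1 then b else 0)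
    (hω : ∀ (n : ℤ) (w : V), mode Y ω (n + 1) w = opL n • w)
    (hω' : ∀ (n : ℤ) (w : V), mode Y' ω (n + 1) w = opL n • w)
    (hι : ∀ (n : ℤ) (w : V), mode Y ι n w = opI n • w)
    (hι' : ∀ (n : ℤ) (w : V), mode Y' ι n w = opI n • w) : Y' = Y := by
  let P : Submodule ℂ V := LinearMap.ker (Y' - Y)
  have hP : ∀ a, a ∈ P ↔ ∀ n w, mode Y' a n w = mode Y a n w := by
    intro a
    rw [LinearMap.mem_ker, LinearMap.sub_apply, sub_eq_zero]
    refine ⟨fun h n w => by rw [mode, h], fun h => VertexOperator.ext_ncoeff fun n => ?_⟩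
    exact LinearMap.ext fun w => h n w
  -- The iterate formula writes the modes of `c_r a` through those of `c` and of `a`, so agreement
  -- of `Y` and `Y'` spreads from the generators to everything they generate.
  have step : ∀ c, (∀ n w, mode Y' c n w = mode Y c n w) → ∀ a ∈ P, ∀ r, mode Y c r a ∈ P := by
    intro c hc a ha r
    rw [hP] at ha ⊢
    intro n w
    rw [← hc, hJ'.iterate, hc, hJ.iterate]
    simp only [hc, ha]
  have hω₂ : ∀ n w, mode Y' ω n w = mode Y ω n w := fun n w => by
    have h1 := hω (n - 1) w
    have h2 := hω' (n - 1) w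
    rw [sub_add_cancel] at h1 h2
    rw [h1, h2]
  have hι₂ : ∀ n w, mode Y' ι n w = mode Y ι n w := fun n w => by rw [hι, hι']
  refine LinearMap.ext fun a => ?_
  have ha : a ∈ P := by
    refine hv.induction P ((hP v).mpr fun n w => by rw [h1, h1']) (fun n a ha => ?_)
      (fun n a ha => ?_) a
    · rw [modeL_apply, ← hω]; exact step ω hω₂ a ha _
    · rw [modeI_apply, ← hι]; exact step ι hι₂ a ha _
  exact sub_eq_zero.mp ha

namespace IsVertexMap

variable {hV : IsRestricted V cL cLI} {Ψ : V →ₗ[ℂ] Fld V} {hM : IsRestricted M cL cLI}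
  {Φ : V →ₗ[ℂ] Fld M} (hv : IsVacuumModule v cL cLI) (hΨ : IsVertexMap v hV Ψ)
  (hΦ : IsVertexMap v hM Φ)

include hΦ in
theorem mode_omega (n : ℤ) : mode (vertexMap Φ) (modeL (-2) v) (n + 1) = modeL n := by
  rw [mode_vertexMap, hΦ.map_omega]
  ext w
  rw [hM.fieldL_apply, add_sub_cancel_right]

include hv

-- `assoc` turns the modes of `a_n b` into those of a residue product; what is left is the Borcherds
-- identity for two mutually local fields.
include hΨ hΦ in
theorem borcherds : BorcherdsIdentity (vertexMap Ψ) (vertexMap Φ) := by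
  intro a b w p q r
  simp only [mode_vertexMap]
  rw [← bor_eq_finsum, ← (hΦ.isLocal hv a b).bor_eq]
  refine finsum_congr fun i => ?_
  rw [hΨ.assoc hM hv hΦ]

-- `L(0)` is mode `1` of the field `L(z)`. In the identity with `p = 1`, `r = 0` only `i = 0, 1`
-- survive, giving `(L(-1) a)_(n+1)` and `(L(0) a)_n`.
include hΦ in
theorem eigenvalue {d s : ℂ} {a : V} (ha : modeL 0 a = d • a) {u : M} (hu : modeL 0 u = s • u)
    (n : ℤ) : modeL 0 ((Φ a).1 n u) = (s + d - n - 1) • (Φ a).1 n u := by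
  have h := (hΦ.local_LI hv a).1.bor_eq 1 n 0 u
  rw [bor_zero, finsum_eq_range (K := 2), Finset.sum_range_succ, Finset.sum_range_one] at h
  · have e0 : prod (0 + ((0 : ℕ) : ℤ)) hM.fieldL (Φ a) = Fld.deriv (Φ a) := by
      rw [← hΦ.map_derivative hv, hΦ.map_modeL]; rfl
    have e1 : prod (0 + ((1 : ℕ) : ℤ)) hM.fieldL (Φ a) = d • Φ a := by
      rw [← map_smul, ← ha, hΦ.map_modeL]; rfl
    rw [e0, e1, Ring.choose_zero_right, Ring.choose_one_right, Fld.deriv_apply, Fld.smul_apply] at h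
    simp only [Fld.comm, LinearMap.sub_apply, Module.End.mul_apply, hM.fieldL_apply, sub_self, hu,
      map_smul] at h
    rw [eq_comm, sub_eq_iff_eq_add] at h
    rw [h, show 1 + n - ((0 : ℕ) : ℤ) - 1 = n by push_cast; ring,
      show 1 + n - ((1 : ℕ) : ℤ) = n by push_cast; ring]
    push_cast
    module
  · intro i hi
    have : (Ring.choose (1 : ℤ) i) = 0 := by
      have := Ring.choose_natCast (R := ℤ) 1 i
      rw [Nat.choose_eq_zero_of_lt (by omega)] at this
      exact_mod_cast this
    rw [this, Int.cast_zero, zero_smul]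

include hΦ in
theorem mode_mem_eigenspace {E : Submodule ℂ M} {h : ℂ} (hE : IsLowestWeight E cL cLI h) {d : ℤ}
    {a : V} (ha : modeL 0 a = (d : ℂ) • a) (n : ℤ) {m : ℕ} {u : M}
    (hu : u ∈ Module.End.eigenspace (modeL 0) (h + m)) : (Φ a).1 n u = 0 ∨
      ∃ k : ℕ, (k : ℤ) = m + d - n - 1 ∧ (Φ a).1 n u ∈ Module.End.eigenspace (modeL 0) (h + k) := by
  rw [Module.End.mem_eigenspace_iff] at hu
  have h1 := Module.End.mem_eigenspace_iff.mpr (hΦ.eigenvalue hv ha hu n)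
  rw [show h + m + d - n - 1 = h + ((m + d - n - 1 : ℤ) : ℂ) by push_cast; ring] at h1
  rcases lt_or_ge ((m : ℤ) + d - n - 1) 0 with hlt | hge
  · rw [hE.eigenspace_eq, wordSpan_neg _ hlt, Submodule.mem_bot] at h1
    exact Or.inl h1
  · obtain ⟨k, hk⟩ := Int.eq_ofNat_of_zero_le hge
    rw [hk, Int.cast_natCast] at h1
    exact Or.inr ⟨k, hk.symm, h1⟩

theorem isVOAModule {E : Submodule ℂ M} {h : ℂ} (hΨ : IsVertexMap v hV Ψ) (hΦ : IsVertexMap v hM Φ)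
    (hE : IsLowestWeight E cL cLI h) :
    IsVOAModule (vertexMap Ψ) v (modeL (-2) v) (vertexMap Φ) := by
  have h0 := hΦ.mode_omega 0
  rw [zero_add] at h0
  refine { vacuum := fun n w => ?_, jacobi := borcherds hv hΨ hΦ, derivative := fun a n w => ?_,
           grading := ?_, finite := ?_, bounded := ?_ }
  · rw [mode_vertexMap, hΦ.map_vac, one_apply]
  · have h1 := hΨ.mode_omega (-1)
    rw [neg_add_cancel] at h1
    rw [h1, mode_vertexMap, mode_vertexMap, hΦ.map_derivative hv, Fld.deriv_apply]
  · rw [h0]; exact hE.isInternal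
  · rw [h0]; exact hE.eigenspace_finite
  · rw [h0]; exact hE.eigenspace_bounded

theorem isVOA {E : Submodule ℂ V} (hΨ : IsVertexMap v hV Ψ) (hE : IsLowestWeight E cL cLI 0) :
    IsVOA (vertexMap Ψ) v (modeL (-2) v) cL := by
  have hm := hΨ.isVOAModule hv hΨ hE
  have h0 := hΨ.mode_omega 0
  rw [zero_add] at h0
  refine { vacuum := hm.vacuum, creation := fun a => ?_, creation_nonneg := fun a n hn => ?_,
           jacobi := hm.jacobi, virasoro := fun m n b => ?_, derivative := hm.derivative,
           grading := ?_, finite := fun n => hm.finite n, bounded := ?_ }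
  · rw [mode_vertexMap]; exact (hΨ.creation_aux hv a).1
  · obtain ⟨k, rfl⟩ := Int.eq_ofNat_of_zero_le hn
    rw [mode_vertexMap]; exact (hΨ.creation_aux hv a).2 k
  · rw [hΨ.mode_omega, hΨ.mode_omega, hΨ.mode_omega, hV.LL]
    have : n = -m ↔ m + n = 0 := by omega
    by_cases e : m + n = 0
    · rw [if_pos e, if_pos (by omega)]; abel
    · rw [if_neg e, if_neg (by omega)]; abel
  · rw [h0]
    have := hE.isInternal_int
    simpa only [zero_add] using this
  · obtain ⟨N, hN⟩ := hm.bounded 0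
    exact ⟨N, fun n hn => by have := hN n hn; rwa [zero_add] at this⟩

-- All fields are built from `L(z)`, `I(z)` and the identity by residue products, and these are
-- respected by any `UHV`-linear map (`map_prod`).
include hΦ in
theorem intertwines {N : Type} [AddCommGroup N] [Module ℂ N] [Module UHV N] [IsScalarTower ℂ UHV N]
    {hN : IsRestricted N cL cLI} {Φ' : V →ₗ[ℂ] Fld N} (hΦ' : IsVertexMap v hN Φ')
    (f : M →ₗ[UHV] N) : Intertwines (vertexMap Φ) (vertexMap Φ') f := by
  let F : M →ₗ[ℂ] N := f.restrictScalars ℂ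
  have hL : ∀ n w, F (modeL n w) = modeL n (F w) := fun n w => f.map_smul _ w
  have hI : ∀ n w, F (modeI n w) = modeI n (F w) := fun n w => f.map_smul _ w
  let P : Submodule ℂ V :=
    { carrier := {a | ∀ n w, F ((Φ a).1 n w) = (Φ' a).1 n (F w)}
      add_mem' := fun {a b} ha hb n w => by
        rw [map_add, map_add, Fld.add_apply, Fld.add_apply, map_add, ha, hb]
      zero_mem' := fun n w => by simp
      smul_mem' := fun c a ha n w => by
        rw [map_smul, map_smul, Fld.smul_apply, Fld.smul_apply, map_smul, ha] }
  intro a n w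
  rw [mode_vertexMap, mode_vertexMap]
  have : a ∈ P := by
    refine hv.induction P (fun n w => ?_) (fun m a ha n w => ?_) (fun m a ha n w => ?_) a
    · rw [hΦ.map_vac, hΦ'.map_vac, one_apply, one_apply]
      split_ifs
      · rfl
      · exact map_zero F
    · rw [hΦ.map_modeL, hΦ'.map_modeL]
      exact map_prod F (fun k w => hL _ w) ha _ _ _
    · rw [hΦ.map_modeI, hΦ'.map_modeI]
      exact map_prod F (fun k w => hI _ w) ha _ _ _
  exact this n w

end IsVertexMap

end Structures

/-! ### The module `U` -/

theorem nilE_apply_zero (e : ESpace) : nilE e 0 = e 1 := by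
  simp [nilE, Matrix.mulVec, dotProduct, Fin.sum_univ_two]

theorem nilE_apply_one (e : ESpace) : nilE e 1 = 0 := by
  simp [nilE, Matrix.mulVec, dotProduct, Fin.sum_univ_two]

theorem ESpace.eq_add (e : ESpace) : e = e 0 • vE 0 + e 1 • vE 1 := by
  ext i; fin_cases i <;> simp [vE]

namespace ETilde

variable (cL cLI : ℂ)

theorem isLowestWeight : IsLowestWeight (M := ETilde cL cLI)
    (LinearMap.range (Induced.unit HV.nonneg (repE cL cLI))) cL cLI 1 :=
  HV.induced_isLowestWeight (cL := cL) (cLI := cLI) (Commute.one_left nilE) (h := 1)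
    fun e => (one_smul ℂ e).symm

theorem modeI_zero (e : ESpace) :
    modeI 0 (Induced.unit HV.nonneg (repE cL cLI) e) =
      Induced.unit HV.nonneg (repE cL cLI) (nilE e) :=
  (HV.opB_smul_unit (Commute.one_left nilE) (i := .I 0) le_rfl e).trans (by
    rw [HV.topOp, if_pos rfl]; rfl)

theorem isHighestWeight : IsHighestWeight (ETilde cL cLI) cL cLI (vTilde cL cLI 0) 1 := by
  have hl := isLowestWeight cL cLI
  have hm : vTilde cL cLI 0 ∈ LinearMap.range (Induced.unit HV.nonneg (repE cL cLI)) := ⟨vE 0, rfl⟩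
  refine { hl.toIsLevelZero with killL := fun n hn => hl.killL n hn _ hm
                                 killI := fun n hn => ?_, weight := hl.weight _ hm }
  rcases eq_or_lt_of_le (show 0 ≤ n from hn) with rfl | hn
  · rw [vTilde, modeI_zero, nilE_zero, map_zero]
  · exact hl.killI n hn _ hm

theorem singSub_eq : singSub cL cLI = Submodule.span UHV
    {modeL (-1) (vTilde cL cLI 0) + ((1 : ℂ) / cLI) • modeI (-1) (vTilde cL cLI 0)} := by
  rw [singSub, add_smul, smul_assoc]
  rfl

end ETilde

namespace UMod

variable (cL : ℂ) {cLI : ℂ}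

theorem isLowestWeight :
    IsLowestWeight (M := UMod cL cLI) (LinearMap.range (ofE cL cLI)) cL cLI 1 := by
  have := (ETilde.isLowestWeight cL cLI).map (singSub cL cLI).mkQ (Submodule.mkQ_surjective _)
  rwa [← LinearMap.range_comp] at this

/-- The relation defining `U` is a singular vector of weight `2`, so what it generates misses the
weight `1`, where `E` lives. -/
theorem ofE_injective (hc : cLI ≠ 0) : Function.Injective (ofE cL cLI) := by
  rw [injective_iff_map_eq_zero]
  intro e he
  have h1 : Induced.unit HV.nonneg (repE cL cLI) e ∈ singSub cL cLI :=
    (Submodule.Quotient.mk_eq_zero _).mp he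
  rw [ETilde.singSub_eq] at h1
  have hs := ((ETilde.isHighestWeight cL cLI).singular hc).isSingular
  have h2 := (ETilde.isLowestWeight cL cLI).toIsSingular.eq_zero_of_mem one_pos
    (by rw [Int.cast_one]; exact hs) (Submodule.span_mono Submodule.subset_span h1) ⟨e, rfl⟩
  exact HV.induced_unit_injective _ (h2.trans (map_zero _).symm)

theorem modeI_ofE (e : ESpace) : modeI 0 (ofE cL cLI e) = ofE cL cLI (nilE e) :=
  ((singSub cL cLI).mkQ.map_smul _ _).symm.trans
    (congrArg (singSub cL cLI).mkQ (ETilde.modeI_zero cL cLI e))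

theorem ofE_rep (x : HV.nonneg) (e : ESpace) : ofE cL cLI (repE cL cLI x e) =
    UniversalEnvelopingAlgebra.ι ℂ (x : HV) • ofE cL cLI e :=
  (congrArg (singSub cL cLI).mkQ (Induced.unit_rep HV.nonneg (repE cL cLI) x e)).trans
    ((singSub cL cLI).mkQ.map_smul _ _)

theorem isHighestWeight : IsHighestWeight (UMod cL cLI) cL cLI (ofE cL cLI (vE 0)) 1 :=
  (ETilde.isHighestWeight cL cLI).map (singSub cL cLI).mkQ (isLowestWeight cL).toIsLevelZero

theorem singular : modeL (-1) (ofE cL cLI (vE 0)) +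
    ((1 : ℂ) / cLI) • modeI (-1) (ofE cL cLI (vE 0)) = 0 := by
  have h : (singSub cL cLI).mkQ
      (modeL (-1) (vTilde cL cLI 0) + ((1 : ℂ) / cLI) • modeI (-1) (vTilde cL cLI 0)) = 0 := by
    rw [Submodule.mkQ_apply, Submodule.Quotient.mk_eq_zero, ETilde.singSub_eq]
    exact Submodule.mem_span_singleton_self _
  rw [map_add, LinearMap.map_smul_of_tower, modeL_apply, modeI_apply, map_smul, map_smul] at h
  exact h

theorem piece_eq (m : ℕ) :
    piece cL cLI m = Module.End.eigenspace (modeL 0 : Module.End ℂ (UMod cL cLI)) (1 + m) := by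
  rw [piece, add_comm]
  rfl

theorem piece_zero : LinearMap.range (ofE cL cLI) = piece cL cLI 0 := by
  have := (isLowestWeight cL (cLI := cLI)).eigenspace_eq 0
  rw [wordSpan_zero] at this
  rw [piece_eq, ← this]
  simp

theorem hom_ext {N : Type} [AddCommGroup N] [Module UHV N] {f g : UMod cL cLI →ₗ[UHV] N}
    (h : ∀ e, f (ofE cL cLI e) = g (ofE cL cLI e)) : f = g := by
  refine LinearMap.ext_on (isLowestWeight cL (cLI := cLI)).span ?_
  rintro _ ⟨e, rfl⟩
  exact h e

/-- Killing `v^0` makes `I(0)` act by zero on the image of `v^1`, as in the Verma module; the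
relation defining `U` is a multiple of `v^0` and disappears with it. -/
theorem exists_toVerma : ∃ g : UMod cL cLI →ₗ[UHV] Verma cL 0 cLI 1 0,
    ∀ e, g (ofE cL cLI e) = e 1 • Verma.hw cL 0 cLI 1 0 := by
  have hw := Verma.isHighestWeight cL cLI 1
  let f : ESpace →ₗ[ℂ] Verma cL 0 cLI 1 0 :=
    (LinearMap.toSpanSingleton ℂ _ (Verma.hw cL 0 cLI 1 0)).comp (LinearMap.proj 1)
  have hf : ∀ e, f e = e 1 • Verma.hw cL 0 cLI 1 0 := fun _ => rfl
  obtain ⟨F, hF⟩ : ∃ F : ETilde cL cLI →ₗ[UHV] Verma cL 0 cLI 1 0,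
      ∀ e, F (Induced.unit HV.nonneg (repE cL cLI) e) = f e := HV.exists_lift (cL := cL) (cLI := cLI) (Commute.one_left nilE) f
    hw.toIsLevelZero (fun n hn e => by rw [hf, map_smul, hw.killL n hn, smul_zero])
    (fun n hn e => by rw [hf, map_smul, hw.killI n hn.le, smul_zero])
    (fun e => by rw [Module.End.one_apply, hf, map_smul, hw.weight, one_smul])
    (fun e => by rw [hf, hf, map_smul, hw.killI 0 le_rfl, nilE_apply_one, zero_smul, smul_zero])
  have h0 : F (vTilde cL cLI 0) = 0 := (hF (vE 0)).trans (by rw [hf]; simp [vE])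
  have hker : singSub cL cLI ≤ LinearMap.ker F := by
    rw [singSub, Submodule.span_singleton_le_iff_mem, LinearMap.mem_ker, map_smul, h0, smul_zero]
  exact ⟨Submodule.liftQ _ F hker, fun e => (Submodule.liftQ_apply _ _ _).trans (hF e)⟩

/-- Modulo the image of `f`, `v^1` is a highest weight vector, so the Verma module maps to the
cokernel of `f`. Composed with `g` this map is the projection, hence the kernel of `g` lies in the
image of `f`. -/
theorem exact_of {f : Irr cL 0 cLI 1 0 →ₗ[UHV] UMod cL cLI}
    {g : UMod cL cLI →ₗ[UHV] Verma cL 0 cLI 1 0}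
    (hf : f (Irr.hw cL 0 cLI 1 0) = ofE cL cLI (vE 0))
    (hg : ∀ e, g (ofE cL cLI e) = e 1 • Verma.hw cL 0 cLI 1 0) : Function.Exact f g := by
  have hgf : g.comp f = 0 := by
    refine LinearMap.ext_on (Irr.span_hw cL 1) ?_
    rintro _ rfl
    rw [LinearMap.comp_apply, hf, hg]
    simp [vE]
  have hl := isLowestWeight cL (cLI := cLI)
  set R := LinearMap.range f
  have h0 : R.mkQ (ofE cL cLI (vE 0)) = 0 := by
    rw [Submodule.mkQ_apply, Submodule.Quotient.mk_eq_zero]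
    exact ⟨_, hf⟩
  have hq := hl.map R.mkQ (Submodule.mkQ_surjective _)
  have hm : R.mkQ (ofE cL cLI (vE 1)) ∈
      (LinearMap.range (ofE cL cLI)).map (R.mkQ.restrictScalars ℂ) := ⟨_, ⟨vE 1, rfl⟩, rfl⟩
  have hw : IsHighestWeight (UMod cL cLI ⧸ R) cL cLI (R.mkQ (ofE cL cLI (vE 1))) 1 := by
    refine { hq.toIsLevelZero with killL := fun n hn => hq.killL n hn _ hm
                                   killI := fun n hn => ?_, weight := hq.weight _ hm }
    rcases eq_or_lt_of_le (show 0 ≤ n from hn) with rfl | hn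
    · rw [modeI_apply, ← map_smul, ← modeI_apply, modeI_ofE, nilE_one, h0]
    · exact hq.killI n hn _ hm
  obtain ⟨k, hk⟩ := Verma.exists_lift cL cLI 1 hw
  have hkg : k.comp g = R.mkQ := by
    refine hom_ext cL fun e => ?_
    rw [LinearMap.comp_apply, hg, LinearMap.map_smul_of_tower, hk]
    conv_rhs => rw [ESpace.eq_add e]
    rw [map_add, map_smul, map_smul, map_add, LinearMap.map_smul_of_tower, h0, smul_zero, zero_add,
      LinearMap.map_smul_of_tower]
  intro x
  constructor
  · intro hx
    have : R.mkQ x = 0 := by rw [← hkg, LinearMap.comp_apply, hx, map_zero]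
    rwa [Submodule.mkQ_apply, Submodule.Quotient.mk_eq_zero] at this
  · rintro ⟨y, rfl⟩
    exact congrArg (fun f => f y) hgf

theorem surjective_of {g : UMod cL cLI →ₗ[UHV] Verma cL 0 cLI 1 0}
    (hg : ∀ e, g (ofE cL cLI e) = e 1 • Verma.hw cL 0 cLI 1 0) : Function.Surjective g := by
  rw [← LinearMap.range_eq_top, eq_top_iff, ← Verma.span_hw, Submodule.span_singleton_le_iff_mem]
  exact ⟨ofE cL cLI (vE 1), by rw [hg]; simp [vE]⟩

/-- By weight, a section sends the highest weight vector into `E`, to a vector killed by `I(0)`.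
Only multiples of `v^0` are such, and `g` maps them to zero. -/
theorem not_split {g : UMod cL cLI →ₗ[UHV] Verma cL 0 cLI 1 0} (hc : cLI ≠ 0)
    (hg : ∀ e, g (ofE cL cLI e) = e 1 • Verma.hw cL 0 cLI 1 0) :
    ¬ ∃ s : Verma cL 0 cLI 1 0 →ₗ[UHV] UMod cL cLI, g.comp s = LinearMap.id := by
  rintro ⟨s, hs⟩
  have hw := (Verma.isHighestWeight cL cLI 1).map s (isLowestWeight cL).toIsLevelZero
  have h1 : s (Verma.hw cL 0 cLI 1 0) ∈ LinearMap.range (ofE cL cLI) := by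
    rw [piece_zero, piece_eq, Module.End.mem_eigenspace_iff, hw.weight]
    simp
  obtain ⟨e, he⟩ := h1
  have h2 : g (s (Verma.hw cL 0 cLI 1 0)) = Verma.hw cL 0 cLI 1 0 := LinearMap.congr_fun hs _
  have h3 := hw.killI 0 le_rfl
  rw [← he, modeI_ofE] at h3
  have h4 : nilE e = 0 := ofE_injective cL hc (h3.trans (map_zero _).symm)
  rw [← he, hg, ← nilE_apply_zero e, h4, Pi.zero_apply, zero_smul] at h2
  exact Verma.hw_ne_zero cL cLI 1 h2.symm

end UMod

/-! ### The main theorem -/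

theorem IsVertexMap.hasHVFields {cL cLI : ℂ} {M : Type} [AddCommGroup M] [Module ℂ M] [Module UHV M]
    [IsScalarTower ℂ UHV M] {hM : IsRestricted M cL cLI} {Φ : HVVac cL cLI →ₗ[ℂ] Fld M}
    (hΦ : IsVertexMap (vac cL cLI) hM Φ) : HasHVFields (vertexMap Φ) := by
  refine ⟨fun n w => LinearMap.congr_fun (hΦ.mode_omega n) w, fun n w => ?_⟩
  have : Φ (heis cL cLI) = hM.fieldI := hΦ.map_heis
  rw [mode_vertexMap, this]
  rfl

/-- `Y` is the unique vertex operator algebra structure on `L(cL, 0, cLI, 0, 0)` with the given fields,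
and `YU, YL, YV` are the module structures extending the action of `HV`. -/
theorem proposition4p1 (cL cLI : ℂ) (hc : cLI ≠ 0) :
    ∃ Y : HVVac cL cLI →ₗ[ℂ] VertexOperator ℂ (HVVac cL cLI),
      (IsHVVOA Y ∧ ∀ Y', IsHVVOA Y' → Y' = Y) ∧
      ∃ (YU : HVVac cL cLI →ₗ[ℂ] VertexOperator ℂ (UMod cL cLI))
        (YL : HVVac cL cLI →ₗ[ℂ] VertexOperator ℂ (Irr cL 0 cLI 1 0))
        (YV : HVVac cL cLI →ₗ[ℂ] VertexOperator ℂ (Verma cL 0 cLI 1 0)),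
        IsHVModule Y YU ∧ IsHVModule Y YL ∧ IsHVModule Y YV ∧
        -- the grading of `U`, compatible with the grading of the vertex operator algebra
        DirectSum.IsInternal (UMod.piece cL cLI) ∧
        (∀ (d : ℤ) (a : HVVac cL cLI), mode Y (omega cL cLI) 1 a = (d : ℂ) • a →
          ∀ (n : ℤ) (m : ℕ), ∀ u ∈ UMod.piece cL cLI m,
            mode YU a n u = 0 ∨
              ∃ k : ℕ, (k : ℤ) = m + d - n - 1 ∧ mode YU a n u ∈ UMod.piece cL cLI k) ∧
        -- the lowest component is isomorphic to `E` as an `H^{≥0}`-module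
        (∃ φ : ESpace ≃ₗ[ℂ] UMod.piece cL cLI 0,
          (∀ e, (φ e : UMod cL cLI) = UMod.ofE cL cLI e) ∧
          ∀ (x : HV.nonneg) (e : ESpace),
            (φ (repE cL cLI x e) : UMod cL cLI) =
              UniversalEnvelopingAlgebra.ι ℂ (x : HV) • (φ e : UMod cL cLI)) ∧
        -- the non-split extension `0 → L(1, 0) → U → V(1, 0) → 0`
        ∃ (f : Irr cL 0 cLI 1 0 →ₗ[UHV] UMod cL cLI)
          (g : UMod cL cLI →ₗ[UHV] Verma cL 0 cLI 1 0),
          Intertwines YL YU f ∧ Intertwines YU YV g ∧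
          Function.Injective f ∧ Function.Exact f g ∧ Function.Surjective g ∧
          ¬ ∃ s : Verma cL 0 cLI 1 0 →ₗ[UHV] UMod cL cLI, g.comp s = LinearMap.id := by
  have hv : IsVacuumModule (vac cL cLI) cL cLI := isVacuumModule_vac hc
  have lV := Irr.isLowestWeight cL (cLI := cLI) 0
  have lU := UMod.isLowestWeight cL (cLI := cLI)
  have lL := Irr.isLowestWeight cL (cLI := cLI) 1
  have lW := Verma.isLowestWeight cL cLI 1
  -- All four modules are generated by finite-dimensional spaces of singular vectors, hence
  -- restricted, so the same construction applies to each.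
  obtain ⟨Ψ, hΨ⟩ := exists_isVertexMap lV.isRestricted hc
  obtain ⟨ΦU, hU⟩ := exists_isVertexMap lU.isRestricted hc
  obtain ⟨ΦL, hL⟩ := exists_isVertexMap lL.isRestricted hc
  obtain ⟨ΦW, hW⟩ := exists_isVertexMap lW.isRestricted hc
  have hVOA : IsHVVOA (vertexMap Ψ) := ⟨hΨ.isVOA hv lV, hΨ.hasHVFields⟩
  refine ⟨vertexMap Ψ, ⟨hVOA, fun Y' hY' => ?_⟩, vertexMap ΦU, vertexMap ΦL, vertexMap ΦW,
    ⟨hΨ.isVOAModule hv hU lU, hU.hasHVFields⟩, ⟨hΨ.isVOAModule hv hL lL, hL.hasHVFields⟩,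
    ⟨hΨ.isVOAModule hv hW lW, hW.hasHVFields⟩, ?_, ?_, ?_, ?_⟩
  · exact vertexMap_unique hv hVOA.voa.jacobi hY'.voa.jacobi hVOA.voa.vacuum hY'.voa.vacuum
      hVOA.fields.1 hY'.fields.1 hVOA.fields.2 hY'.fields.2
  · have : UMod.piece cL cLI = fun k : ℕ =>
        Module.End.eigenspace (modeL 0 : Module.End ℂ (UMod cL cLI)) (1 + k) :=
      funext fun k => UMod.piece_eq cL k
    rw [this]
    exact lU.isInternal_nat
  · intro d a ha n m u hu
    have ha' : modeL 0 a = (d : ℂ) • a := ((hVOA.fields.1 0 a).symm).trans ha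
    rw [UMod.piece_eq] at hu
    rw [mode_vertexMap]
    simp only [UMod.piece_eq]
    exact hU.mode_mem_eigenspace hv lU ha' n hu
  · let φ : ESpace ≃ₗ[ℂ] UMod.piece cL cLI 0 :=
      (LinearEquiv.ofInjective _ (UMod.ofE_injective cL hc)).trans
        (LinearEquiv.ofEq _ _ (UMod.piece_zero cL))
    exact ⟨φ, fun e => rfl, fun x e => UMod.ofE_rep cL x e⟩
  · obtain ⟨f, hf⟩ := Irr.exists_lift cL 1 hc (UMod.isHighestWeight cL) (UMod.singular cL)
    obtain ⟨g, hg⟩ := UMod.exists_toVerma cL (cLI := cLI)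
    refine ⟨f, g, hL.intertwines hv hU f, hU.intertwines hv hW g,
      Irr.injective_of_ne_zero cL 1 f ?_, UMod.exact_of cL hf hg, UMod.surjective_of cL hg,
      UMod.not_split cL hc hg⟩
    rw [hf, Ne, map_eq_zero_iff _ (UMod.ofE_injective cL hc)]
    intro h
    have := congrFun h 0
    simp [vE] at this
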